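/- **Setting.** Let $\hat{\mathfrak g}$ be a complex semisimple Lie algebra with Cartan subalgebra $V_{\mathbb C}=\hat{\mathfrak t}$ and root system $\hat R\subset V_{\mathbb C}^*$ (its elements are called coroots: $\hat{\mathfrak g}$ is the Lie algebra of the dual of a split group), Weyl group $W$, base $\hat\Delta$, positive system $\hat R_+$, and let $V\subset V_{\mathbb C}$ be the real form on which all coroots are real, with the Killing form as inner product. Let $\hat R'\subset\hat R$ be a maximal proper standard Levi subsystem (spanned by $\hat\Delta$ minus one element), with Weyl group $W'$. For an entire function $\rho\neq0$ on $\mathbb C$ with $\rho(z)=\rho(1-z)$ put $r(\lambda)=\prod_{\hat\alpha\in\hat R_+}\rho(\hat\alpha(\lambda))$, $c(\lambda)=\prod_{\hat\alpha\in\hat R_+}\frac{\hat\alpha(\lambda)+1}{\hat\alpha(\lambda)}$, $c'(\lambda)=\prod_{\hat\alpha\in\hat R'_+}\frac{\hat\alpha(\lambda)+1}{\hat\alpha(\lambda)}$, and for an entire function $\phi$ on $V_{\mathbb C}$ and $x\in W$ $$\Sigma(\lambda)=\sum_{w\in W}c(-w\lambda)\tfrac{r(\lambda)}{r(w\lambda)}\phi(-w\lambda),\quad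 \Sigma_\tau(\lambda)=\Sigma(-\lambda),\quad \Sigma'_{x}(\lambda)=\sum_{u\in W'}c'(ux\lambda)\tfrac{r(ux\lambda)}{r(\lambda)}\phi(ux\lambda).$$ *Pole spaces.* For a nonempty affine subspace $L\subset V$ let $\hat P_L,\hat Z_L,\hat R_L$ be the sets of coroots that are equal to $1$, equal to $0$, constant on $L$. $L$ is a *pole space* if for some $w\in W$, with $S=w(\hat R_+\cup\hat R'_-)$, one has $|\hat P_L\cap S|\ge|\hat Z_L\cap S|+\operatorname{codim}L$ and $L=\{v\in V\mid\hat\alpha(v)=1\ \forall\hat\alpha\in\hat P_L\cap S\}$. It is *standard* if $\hat R_L$ is a standard Levi subsystem and its positive elements are $\ge0$ on $L$, and *regular* if $\hat Z_L=\emptyset$. For $L$ regular and $w\in W$ the pair $(L,w)$ is *good* if $w(\hat P_L)\subset\hat R_+\cup\hat R'$. *Affine functions.* Let $\mathrm{Aff}^*(L)$ be the set of nonconstant complex affine functions on $L_{\mathbb C}$, with $Y\sim1-Y$. Let $c_L\in L$ be the point orthogonal to the direction of $L$, $\hat{\mathfrak z}^L$ the direction of $L_{\mathbb C}$, and $\nabla_X=X-X(c_L)$.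 Let $\mathrm{Aff}^*_+(L)$ be the set of $X\in\mathrm{Aff}^*(L)$ such that $\nabla_X>0$ on $L^+=\{v\in L\mid\nabla_{\hat\alpha}(v)>0\ \forall\hat\alpha\in\hat R_+\setminus\hat R_L\}$, and put $D_L=\{Y\in\mathrm{Aff}^*_+(L)\mid Y(c_L)\ge1\}$, $D'_L=\{Y\in\mathrm{Aff}^*_+(L)\mid Y(c_L)\le0\}$. *Denominators.* For $A=\Sigma,\Sigma_\tau,\Sigma'_x$, let $m_A:\mathrm{Aff}^*(L)/{\sim}\to\mathbb Z_{\ge0}$ be the least finitely supported function such that $\prod_\nu\rho(\nu)^{m_A(\nu)}\cdot A|_{L_{\mathbb C}}$ is entire on $L_{\mathbb C}$ for all entire $\phi$ and all entire $\rho\ne0$ with $\rho(z)=\rho(1-z)$ that do not vanish at the points $\hat\alpha(L),1-\hat\alpha(L)$, where $\hat\alpha$ runs through $\hat R_L\cap\hat R_-$ if $A=\Sigma$ and through $\hat R_L\cap\hat R_+$ otherwise. Its support, with multiplicities, viewed as a subset of $\mathrm{Aff}^*(L)$ stable under $Y\mapsto1-Y$, is denoted $\mathrm{Den}_{nc}(L,\Sigma)$,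 $\mathrm{Den}_{nc}(L,\Sigma_\tau)$, $\mathrm{Den}_{nc}(L,x,\Sigma')$ respectively; the subscripts $+$ and $-$ denote the elements $Y$ with $Y\in\mathrm{Aff}^*_+(L)$ and with $-Y\in\mathrm{Aff}^*_+(L)$. Inclusions of such sets in $D_L$ or $D'_L$ are inclusions of sets of equivalence classes. *Modules.* Let $\hat{\mathfrak g}^L=\hat{\mathfrak t}\oplus\bigoplus_{\hat\alpha\in\hat R_L}\hat{\mathfrak g}_{\hat\alpha}$, $\hat{\mathfrak u}^L=\bigoplus_{\hat\alpha\in\hat R_+\setminus\hat R_L}\hat{\mathfrak g}_{\hat\alpha}$, $\overline{\hat{\mathfrak u}}^L=\bigoplus_{\hat\alpha\in\hat R_-\setminus\hat R_L}\hat{\mathfrak g}_{\hat\alpha}$. Given an $\mathfrak{sl}_2$-triple $e,f,h=2c_L$ with $e,f\in\hat{\mathfrak g}^L$ (the zero triple if $c_L=0$), put $\hat{\mathfrak q}^L=\langle e,f,h\rangle\oplus\hat{\mathfrak z}^L$, and regard the weight $(m,\chi)$ of $\mathbb Ch\oplus\hat{\mathfrak z}^L$ as the affine function $\chi+\frac m2$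 on $L_{\mathbb C}=\frac h2+\hat{\mathfrak z}^L$ (value $\frac m2$ at $c_L$, gradient $\chi$). The multiplicity of the highest weight module $V^L(\mu)$ in a $\hat{\mathfrak q}^L$-module is the dimension of the space of highest weight vectors of weight $\mu$. **Proposition 2.14.** Let $L$ be a standard regular pole space. Triples as above exist, the multiplicity functions of $\Sigma$ and $\Sigma_\tau$ on $L$ exist, and for every such triple: 1. Every highest $\hat{\mathfrak q}^L$-weight $\mu$ of $\hat{\mathfrak u}^L$ is of the form $\mu=\hat\alpha|_L=\nabla_{\hat\alpha}+\frac m2$ with $\hat\alpha\in\hat R_+\setminus\hat R_L$ and $m\in\mathbb Z_{\ge0}$. 2. $\mathrm{Den}_{nc}(L,\Sigma)=\bigcup_\mu\{\mu+1,-\mu\}$, over the highest weights $\mu$ of $\hat{\mathfrak u}^L$; for each $\hat\alpha\in\hat R_+\setminus\hat R_L$ the multiplicity of $\hat\alpha|_L+1$ in it equals the multiplicity of $V^L(\hat\alpha|_L)$ in $\hat{\mathfrak u}^L$; $\mathrm{Den}_{nc}(L,\Sigma)_+$ is the set of all $\mu+1$; and $\mathrm{Den}_{nc}(L,\Sigma)\subset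 D_L$. 3. $\mathrm{Den}_{nc}(L,\Sigma_\tau)=\bigcup_\mu\{\nabla_\mu-\mu(c_L),\,-\nabla_\mu+\mu(c_L)+1\}$, over the highest weights $\mu$ of $\hat{\mathfrak u}^L$, the pair of $\mu$ having as multiplicity that of $V^L(\mu)$ in $\hat{\mathfrak u}^L$; $\mathrm{Den}_{nc}(L,\Sigma_\tau)_-$ is the set of all $\mu'+1$ with $\mu'$ a highest $\hat{\mathfrak q}^L$-weight of $\overline{\hat{\mathfrak u}}^L$, with multiplicity that of $V^L(\mu')$ in $\overline{\hat{\mathfrak u}}^L$; and $\mathrm{Den}_{nc}(L,\Sigma_\tau)\subset D'_L$. 4. If $w\in W$ and $(L,w)$ is good, then the multiplicity function of $\Sigma'_w$ on $L$ exists and is at most that of $\Sigma_\tau$. In particular $\mathrm{Den}_{nc}(L,w,\Sigma')\subset\mathrm{Den}_{nc}(L,\Sigma_\tau)$ and $\mathrm{Den}_{nc}(L,w,\Sigma')_-\subset\mathrm{Den}_{nc}(L,\Sigma_\tau)_-$, and $\mathrm{Den}_{nc}(L,w,\Sigma')\subset D'_L$. -/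

import Mathlib

/-!
Conventions. `𝔤` is the complex semisimple Lie algebra of the dual group, `H` its maximal torus, so
that `H` is the complex vector space `V_ℂ` and the *coroots* of the split group are the roots of
`(𝔤, H)`, regarded as linear functionals on `V_ℂ`.  The Borel subalgebra is given by a base `b` of
the root system, and the maximal proper standard Levi subsystem by the simple coroot `i₀` that is
removed.
-/

open Module

noncomputable section

namespace PoleSpaces

variable {𝔤 : Type*} [LieRing 𝔤] [LieAlgebra ℂ 𝔤] [FiniteDimensional ℂ 𝔤]
  [LieAlgebra.IsKilling ℂ 𝔤] {H : LieSubalgebra ℂ 𝔤} [H.IsCartanSubalgebra]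

/-! ### Coroots, Weyl groups, positive systems -/

/-- A coroot (of the split group) as a linear functional on `V_ℂ = H`. -/
def ev (α : H.root) : H →ₗ[ℂ] ℂ := (LieAlgebra.IsKilling.rootSystem H).root α

variable (H) in
/-- The real form `V` of `V_ℂ = H`, on which all coroots are real. -/
def realForm : Submodule ℝ H :=
  Submodule.span ℝ (Set.range (LieAlgebra.IsKilling.rootSystem H).coroot)

/-- The group of linear automorphisms of `V_ℂ` generated by the reflections attached to the
coroots in `S`. -/
def reflGroup (S : Set H.root) : Subgroup (H ≃ₗ[ℂ] H) :=
  Subgroup.closure ((LieAlgebra.IsKilling.rootSystem H).coreflection '' S)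

variable (H) in
/-- The Weyl group `W`, acting on `V_ℂ`. -/
def weyl : Subgroup (H ≃ₗ[ℂ] H) := reflGroup Set.univ

lemma weyl_coroot (w : weyl H) (α : H.root) :
    w.1 ((LieAlgebra.IsKilling.rootSystem H).coroot α) ∈
      Set.range (LieAlgebra.IsKilling.rootSystem H).coroot := by
  obtain ⟨w, hw⟩ := w
  simp only
  induction hw using Subgroup.closure_induction'' generalizing α with
  | mem x hx =>
    obtain ⟨β, -, rfl⟩ := hx
    exact ⟨_, (LieAlgebra.IsKilling.rootSystem H).coroot_reflectionPerm β α⟩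
  | inv_mem x hx =>
    obtain ⟨β, -, rfl⟩ := hx
    exact ⟨_, (LieAlgebra.IsKilling.rootSystem H).coroot_reflectionPerm β α⟩
  | one => exact ⟨α, rfl⟩
  | mul x y _ _ hx hy =>
    obtain ⟨β, hβ⟩ := hy α
    rw [LinearEquiv.mul_apply, ← hβ]
    exact hx β

instance finite_weyl : Finite (weyl H) := by
  refine Finite.of_injective
    (β := H.root → Set.range (LieAlgebra.IsKilling.rootSystem H).coroot)
    (fun w α => ⟨_, weyl_coroot w α⟩) ?_
  intro w w' h
  refine Subtype.ext (LinearEquiv.toLinearMap_injective ?_)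
  refine LinearMap.ext_on_range
    (RootPairing.IsRootSystem.span_coroot_eq_top (P := LieAlgebra.IsKilling.rootSystem H)) ?_
  intro α
  exact congrArg Subtype.val (congrFun h α)

lemma reflGroup_le (S : Set H.root) : reflGroup S ≤ weyl H :=
  Subgroup.closure_mono (Set.image_mono (Set.subset_univ S))

instance finite_reflGroup (S : Set H.root) : Finite (reflGroup S) :=
  Finite.of_injective (Subgroup.inclusion (reflGroup_le S))
    (Subgroup.inclusion_injective (reflGroup_le S))

instance fintype_reflGroup (S : Set H.root) : Fintype (reflGroup S) := Fintype.ofFinite _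

instance fintype_weyl : Fintype (weyl H) := Fintype.ofFinite _

/-- The image `w(S)` of a set of coroots, where `(w α)(w v) = α(v)`. -/
def act (w : H ≃ₗ[ℂ] H) (S : Set H.root) : Set H.root :=
  {β | ∃ α ∈ S, ∀ v : H, ev β (w v) = ev α v}

/-- The coroots that are linear combinations of a given set `J` of coroots. -/
def spanned (J : Set H.root) : Set H.root :=
  {α | ev α ∈ Submodule.span ℂ (ev '' J)}

variable (b : (LieAlgebra.IsKilling.rootSystem H).Base) (i₀ : H.root)

/-- The positive coroots. -/
def posCoroots : Set H.root := {α | b.IsPos α}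

/-- The standard Levi subsystem whose simple coroots are the ones different from `i₀`. -/
def levi : Set H.root := spanned {α | α ∈ b.support ∧ α ≠ i₀}

/-- The Weyl group `W'` of the Levi subsystem. -/
def weyl' : Subgroup (H ≃ₗ[ℂ] H) := reflGroup (levi b i₀)

instance fintype_weyl' : Fintype (weyl' b i₀) := Fintype.ofFinite (reflGroup (levi b i₀))

/-! ### Affine subspaces and pole spaces -/

variable (L : AffineSubspace ℝ H)

/-- The set `P_L` of coroots equal to `1` on `L`. -/
def poleCoroots : Set H.root := {α | ∀ v ∈ L, ev α v = 1}

/-- The set `Z_L` of coroots equal to `0` on `L`. -/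
def zeroCoroots : Set H.root := {α | ∀ v ∈ L, ev α v = 0}

/-- The set of coroots that are constant on `L`. -/
def constCoroots : Set H.root := {α | ∃ z : ℂ, ∀ v ∈ L, ev α v = z}

/-- The poles of `Ω = dλ / (c'(λ) c(-λ))` are among the hyperplanes `α = 1`, and its zeroes among
the hyperplanes `α = 0`, for `α` in this set: the positive coroots and the negative coroots of the
Levi subsystem. -/
def omegaCoroots : Set H.root := posCoroots b ∪ (levi b i₀ \ posCoroots b)

/-- `L ⊆ V` is a pole space for the translated form `ʷΩ`. -/
def IsPoleSpaceFor (w : H ≃ₗ[ℂ] H) : Prop :=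
  (∀ v ∈ L, v ∈ realForm H) ∧
  (zeroCoroots L ∩ act w (omegaCoroots b i₀)).ncard
      + (finrank ℝ (realForm H) - finrank ℝ L.direction)
    ≤ (poleCoroots L ∩ act w (omegaCoroots b i₀)).ncard ∧
  ∀ v ∈ realForm H,
    (∀ α ∈ poleCoroots L ∩ act w (omegaCoroots b i₀), ev α v = 1) → v ∈ L

/-- `L` is a pole space: a pole space for some `ʷΩ`, `w ∈ W`. -/
def IsPoleSpace : Prop := ∃ w ∈ weyl H, IsPoleSpaceFor b i₀ L w

/-- `L` is standard: the coroots constant on `L` form a standard Levi subsystem, whose positive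
members are nonnegative on `L`. -/
def IsStandard : Prop :=
  (∃ J : Set H.root, J ⊆ (b.support : Set H.root) ∧ constCoroots L = spanned J) ∧
  ∀ α ∈ constCoroots L ∩ posCoroots b, ∀ v ∈ L, 0 ≤ (ev α v).re

/-- `L` is regular: no coroot vanishes identically on `L`. -/
def IsRegular : Prop := zeroCoroots L = ∅

/-- The pair `(L, w)` is good. -/
def IsGood (w : H ≃ₗ[ℂ] H) : Prop :=
  act w (poleCoroots L) ⊆ posCoroots b ∪ levi b i₀

/-! ### Complexification, affine functions, centre, positivity -/

/-- The complexification `L_ℂ ⊆ V_ℂ`. -/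
abbrev cplx : AffineSubspace ℂ H := affineSpan ℂ (L : Set H)

instance nonempty_cplx [Nonempty L] : Nonempty (cplx L) :=
  inferInstanceAs (Nonempty (affineSpan ℂ (L : Set H)))

variable [Nonempty L]

/-- The space `Aff(L)` of complex affine linear functions on `L_ℂ`. -/
abbrev Aff := cplx L →ᵃ[ℂ] ℂ

/-- The restriction of a coroot to `L_ℂ`. -/
def res (α : H.root) : Aff L := (ev α).toAffineMap.comp (cplx L).subtype

/-- A constant affine function. -/
abbrev cst (z : ℂ) : Aff L := AffineMap.const ℂ (cplx L) z

/-- The centre `c_L`: the point of `L` that is orthogonal to the direction of `L` (for the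
Weyl group invariant inner product on `V` given by the Killing form). -/
def center : cplx L :=
  Classical.epsilon fun c : cplx L =>
    (c : H) ∈ L ∧ ∀ v ∈ L.direction, killingForm ℂ 𝔤 ((c : H) : 𝔤) ((v : H) : 𝔤) = 0

variable {L} in
/-- The gradient `∇_X`, the affine function vanishing at `c_L` such that `X - ∇_X` is constant. -/
def grad (X : Aff L) : Aff L := X - cst L (X (center L))

variable {L} in
/-- `X` is not constant. -/
def Nonconst (X : Aff L) : Prop := ¬ ∃ z : ℂ, ∀ v : cplx L, X v = z

/-- The positive cone `L⁺ ⊆ L`. -/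
def posCone : Set (cplx L) :=
  {v | (v : H) ∈ L ∧ ∀ α ∈ posCoroots b \ constCoroots L, 0 < (grad (res L α) v).re}

/-- `Aff_+^*(L)`: the nonconstant affine functions whose gradient is (real and) positive on
`L⁺`. -/
def affPos : Set (Aff L) :=
  {X | Nonconst X ∧ ∀ v ∈ posCone b L, ∃ t : ℝ, 0 < t ∧ grad X v = (t : ℂ)}

/-- The set `D_L`. -/
def DL : Set (Aff L) := {Y | Y ∈ affPos b L ∧ ∃ t : ℝ, 1 ≤ t ∧ Y (center L) = (t : ℂ)}

/-- The set `D'_L`. -/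
def DL' : Set (Aff L) := {Y | Y ∈ affPos b L ∧ ∃ t : ℝ, t ≤ 0 ∧ Y (center L) = (t : ℂ)}

/-- Nonconstant affine functions up to `Y ∼ 1 - Y`. -/
def affSetoid : Setoid {X : Aff L // Nonconst X} where
  r X Y := Y.1 = X.1 ∨ Y.1 = cst L 1 - X.1
  iseqv :=
    { refl := fun _ => Or.inl rfl
      symm := by
        rintro X Y (h | h)
        · exact Or.inl h.symm
        · exact Or.inr (by rw [h]; abel)
      trans := by
        rintro X Y Z (h | h) (h' | h')
        · exact Or.inl (h'.trans h)
        · exact Or.inr (by rw [h', h])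
        · exact Or.inr (by rw [h', h])
        · exact Or.inl (by rw [h', h]; abel) }

/-- The set of equivalence classes of nonconstant affine functions on `L`. -/
abbrev AffClass := Quotient (affSetoid L)

/-! ### Denominators -/

/-- Entire functions on `V_ℂ`: the functions that are entire in linear coordinates. -/
def IsEntire (f : H → ℂ) : Prop :=
  ∀ T : (Fin (finrank ℂ H) → ℂ) →ₗ[ℂ] H, Differentiable ℂ fun x => f (T x)

/-- For a meromorphic function `f` on `V_ℂ` (a function given off the zero locus of some
nonzero entire function `D`), the product of `p` with the restriction of `f` to `L_ℂ` is (defined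
and) entire on `L_ℂ`.  Here `f = g / q` with `q` not vanishing identically on `L_ℂ`, so that the
restriction is `g|_{L_ℂ} / q|_{L_ℂ}`; entire functions on `L_ℂ` are the restrictions of entire
functions on `V_ℂ`. -/
def RestrictsEntire (f : H → ℂ) (p : cplx L → ℂ) : Prop :=
  ∃ g q F : H → ℂ, IsEntire g ∧ IsEntire q ∧ IsEntire F ∧
    (∃ D : H → ℂ, IsEntire D ∧ D ≠ 0 ∧ ∀ v, D v ≠ 0 → q v * f v = g v) ∧
    (∃ v : cplx L, q v ≠ 0) ∧
    ∀ v : cplx L, F v * q v = p v * g v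

/-- The values `α(L)`, `1 - α(L)` for the coroots `α ∈ S` that are constant on `L`. -/
def con (S : Set H.root) : Set ℂ :=
  {z | ∃ α ∈ constCoroots L ∩ S, ∃ v ∈ L, z = ev α v ∨ z = 1 - ev α v}

/-- Let `A(ρ; φ)` be a meromorphic function on `V_ℂ` depending on two entire functions `ρ` (on `ℂ`)
and `φ` (on `V_ℂ`), and let `S` be the set of coroots `α` with `m_α ≠ 0`, where `∏ ρ(α)^{m_α}` is
the denominator of `A` on `V_ℂ`.  The finitely supported multiplicity function `n` clears the
denominators of `A` on `L`: for all entire `ρ` with `ρ(z) = ρ(1 - z)` not vanishing on `con L S`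
and all entire `φ`, the function `∏_ν ρ(ν)^{n(ν)} · A(ρ; φ)|_{L_ℂ}` is entire. -/
def Clears (A : (ℂ → ℂ) → (H → ℂ) → H → ℂ) (S : Set H.root) (n : AffClass L →₀ ℕ) : Prop :=
  ∀ ρ : ℂ → ℂ, Differentiable ℂ ρ → (∀ z, ρ z = ρ (1 - z)) → ρ ≠ 0 →
    (∀ z ∈ con L S, ρ z ≠ 0) → ∀ φ : H → ℂ, IsEntire φ →
      RestrictsEntire L (A ρ φ) fun v => n.prod fun ν k => ρ (ν.out.1 v) ^ k

/-- `m` is the multiplicity function `m^A_L` of the denominators of `A` on `L`: the least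
multiplicity function that clears the denominators. -/
def IsDenMult (A : (ℂ → ℂ) → (H → ℂ) → H → ℂ) (S : Set H.root) (m : AffClass L →₀ ℕ) : Prop :=
  IsLeast {n | Clears L A S n} m

variable {L}

open Classical in
/-- The lift of a multiplicity function to all affine functions (zero on constants). -/
def mult (m : AffClass L →₀ ℕ) (Y : Aff L) : ℕ :=
  if h : Nonconst Y then m (Quotient.mk (affSetoid L) ⟨Y, h⟩) else 0

/-- The set of denominators, as a subset of `Aff^*(L)` invariant for `Y ↦ 1 - Y`. -/
def den (m : AffClass L →₀ ℕ) : Set (Aff L) := {Y | mult m Y ≠ 0}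

/-- The denominators with positive gradient. -/
def denPos (m : AffClass L →₀ ℕ) : Set (Aff L) := {Y | Y ∈ den m ∧ Y ∈ affPos b L}

/-- The denominators with negative gradient. -/
def denNeg (m : AffClass L →₀ ℕ) : Set (Aff L) := {Y | Y ∈ den m ∧ -Y ∈ affPos b L}

/-- A set of equivalence classes (given as a set `X` of affine functions stable under
`Y ↦ 1 - Y`) is contained in the set of classes of the elements of `D`. -/
def ClassesIn (X D : Set (Aff L)) : Prop := ∀ Y ∈ X, Y ∈ D ∨ cst L 1 - Y ∈ D

variable (L)

/-! ### The functions `Σ_W`, `Σ_{W,τ}`, `Σ'_{W'x}` -/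

open Classical in
/-- The function `c`. -/
def cFun (v : H) : ℂ := ∏ α : H.root with α ∈ posCoroots b, (ev α v + 1) / ev α v

open Classical in
/-- The function `c'`. -/
def cFun' (v : H) : ℂ :=
  ∏ α : H.root with α ∈ levi b i₀ ∩ posCoroots b, (ev α v + 1) / ev α v

open Classical in
/-- The function `r` attached to `ρ`. -/
def rFun (ρ : ℂ → ℂ) (v : H) : ℂ := ∏ α : H.root with α ∈ posCoroots b, ρ (ev α v)

/-- `Σ_W(φ)(v) = ∑_{w ∈ W} c(-wv) (r(v) / r(wv)) φ(-wv)`. -/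
def sigma (ρ : ℂ → ℂ) (φ : H → ℂ) (v : H) : ℂ :=
  ∑ w : weyl H, cFun b (-(w.1 v)) * (rFun b ρ v / rFun b ρ (w.1 v)) * φ (-(w.1 v))

/-- `Σ_{W,τ}(φ) = Σ_W(φ) ∘ (-id)`. -/
def sigmaTau (ρ : ℂ → ℂ) (φ : H → ℂ) (v : H) : ℂ := sigma b ρ φ (-v)

/-- `Σ'_{W'x}(ψ)(v) = ∑_{u ∈ W'} c'(uxv) (r(uxv) / r(v)) ψ(uxv)`. -/
def sigma' (x : H ≃ₗ[ℂ] H) (ρ : ℂ → ℂ) (ψ : H → ℂ) (v : H) : ℂ :=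
  ∑ u : weyl' b i₀,
    cFun' b i₀ (u.1 (x v)) * (rFun b ρ (u.1 (x v)) / rFun b ρ v) * ψ (u.1 (x v))

/-- `m` is the multiplicity function of `Den_nc(L, Σ)`. The denominator of `Σ_W` on `V_ℂ` is
`r(-v)`, a product over the negative coroots. -/
def IsDenSigma (m : AffClass L →₀ ℕ) : Prop := IsDenMult L (sigma b) (posCoroots b)ᶜ m

/-- `m` is the multiplicity function of `Den_nc(L, Σ_τ)`. The denominator on `V_ℂ` is `r(v)`. -/
def IsDenSigmaTau (m : AffClass L →₀ ℕ) : Prop := IsDenMult L (sigmaTau b) (posCoroots b) m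

/-- `m` is the multiplicity function of `Den_nc(L, x, Σ')`. The denominator on `V_ℂ` is `r(v)`. -/
def IsDenSigma' (x : H ≃ₗ[ℂ] H) (m : AffClass L →₀ ℕ) : Prop :=
  IsDenMult L (sigma' b i₀ x) (posCoroots b) m

/-! ### The `𝔮^L`-modules `𝔲^L` and `𝔲̄^L` -/

/-- The sum of the root spaces of `𝔤` for the roots in `S`. -/
def rootSum (S : Set H.root) : Submodule ℂ 𝔤 :=
  ⨆ α ∈ S, (LieAlgebra.rootSpace H (α.1 : H → ℂ)).toSubmodule

/-- The Levi subalgebra `𝔤^L`, with root system the coroots constant on `L`. -/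
def leviAlg : Submodule ℂ 𝔤 := H.toSubmodule ⊔ rootSum (constCoroots L)

/-- The nilradical `𝔲^L` of the standard parabolic subalgebra with Levi subalgebra `𝔤^L`. -/
def nilrad : Submodule ℂ 𝔤 := rootSum (posCoroots b \ constCoroots L)

/-- The opposite nilradical. -/
def nilradOpp : Submodule ℂ 𝔤 := rootSum ((posCoroots b)ᶜ \ constCoroots L)

/-- `e, f ∈ 𝔤^L` form, together with `h = 2 c_L`, an `𝔰𝔩₂`-triple; for `c_L = 0` it is the zero
triple. Then `𝔮^L = ⟨e, f, h⟩ ⊕ 𝔷^L`, where the direction `𝔷^L` of `L_ℂ` is the centre of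
`𝔤^L`. -/
structure IsTriple (e f : 𝔤) : Prop where
  e_mem : e ∈ leviAlg L
  f_mem : f ∈ leviAlg L
  lie_e_f : ⁅e, f⁆ = (2 : ℂ) • (((center L : cplx L) : H) : 𝔤)
  lie_h_e : ⁅(2 : ℂ) • (((center L : cplx L) : H) : 𝔤), e⁆ = (2 : ℂ) • e
  lie_h_f : ⁅(2 : ℂ) • (((center L : cplx L) : H) : 𝔤), f⁆ = -((2 : ℂ) • f)

variable {L}

/-- The highest weight vectors (and `0`) of weight `μ` in a `𝔮^L`-submodule `U` of `𝔤`: the vectors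
in `U` killed by `e` on which every `v ∈ L_ℂ = h/2 + 𝔷^L` acts by the scalar `μ(v)`. In this way
the weight `(m, χ)` of `ℂh ⊕ 𝔷^L` is regarded as the affine function on `L_ℂ` with gradient `χ`
and value `m/2` at `c_L`. -/
def hwSpace (U : Submodule ℂ 𝔤) (e : 𝔤) (μ : Aff L) : Submodule ℂ 𝔤 :=
  U ⊓ LinearMap.ker (LieAlgebra.ad ℂ 𝔤 e) ⊓
    ⨅ v : cplx L, End.eigenspace (LieAlgebra.ad ℂ 𝔤 ((v : H) : 𝔤)) (μ v)

/-- `μ` is a highest `𝔮^L`-weight of `U`. -/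
def IsHighestWeight (U : Submodule ℂ 𝔤) (e : 𝔤) (μ : Aff L) : Prop := hwSpace U e μ ≠ ⊥

/-- The multiplicity in `U` of the irreducible `𝔮^L`-module of highest weight `μ`: the dimension of
the space of highest weight vectors of weight `μ`. -/
def hwMult (U : Submodule ℂ 𝔤) (e : 𝔤) (μ : Aff L) : ℕ := finrank ℂ (hwSpace U e μ)

end PoleSpaces

end

/-! Each of the three functions is a sum over a reflection group. Its terms share a denominator made
of values of `ρ` at the coroots of one sign, and the factor `r` of each term cancels part of it. The
common numerator is antisymmetric, so the poles of the `c`-functions along root hyperplanes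
disappear and only values of `ρ` remain below. On `L` a term dies when a factor in the numerator of
its `c`-function vanishes identically there.

The least multiplicity function is the supremum, over the surviving terms, of the denominator left
in the single term (`genMult`, `isDenMult_genMult`). It suffices because the terms can be cleared
separately; deforming `ρ` to `ρ + t` keeps the `ρ`-factors apart from the root hyperplanes
(`genMult_clears`). It is necessary because a suitable `φ` suppresses every term that differs on `L`
from a given one, while a quadratic `ρ` isolates a single class of affine functions (`genMult_le`).

It remains to evaluate the supremum. Let `X` be the restriction of a nonconstant coroot of the
relevant sign, and consider the set of coroots that a given term makes negative. What is left at `X`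
is the number of elements of this set restricting to `X` minus the number restricting to `X - 1`,
truncated at zero (`dS_sub_eY`). A surviving term maps `P_L` to positive coroots; for `Σ'` this is
where goodness enters. Regularity yields a triple whose `f` is a combination of root vectors for the
negatives of `P_L` (`exists_isTriple`). Then `ad f` preserves the span of the root vectors of the
set and lowers `X` to `X - 1`, so the difference is at most the dimension of the kernel of `ad f` on
the full weight space of `X` (`card_negSet_le`). Equality holds as soon as all coroots restricting
to `X` become negative; conjugating to a dominant point a vector far away in the direction of `L`
provides such an element (`exists_weyl_sign`). For `Σ'` the inequality is all that is needed.

By `𝔰𝔩₂`-theory the dimension of the kernel is the difference of the numbers of coroots restricting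
to `X` and to `X - 1`, so it does not depend on the triple (`SlTriple.finrank_ker`). For `Σ_τ` it
counts lowest weights of the nilradical, which the reflection symmetry of weights
(`SlTriple.nRes_symm`) or passage to the opposite nilradical converts into highest weights; for `Σ`
the sign change of the variable gives highest weights directly. Highest weights take half-integral
values `≥ 0` at `c_L`, whence the inclusions in `D_L` and `D'_L`. -/

noncomputable section

namespace PoleSpaces

set_option linter.unusedSectionVars false

section

/-! ### Entire functions on finite-dimensional complex vector spaces -/

section Analysis

open MeasureTheory Set Metric

/-- Differentiation of a holomorphic function under an integral over a compact interval. -/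
lemma differentiable_intervalIntegral {E : Type*} [NormedAddCommGroup E] [NormedSpace ℂ E]
    [FiniteDimensional ℂ E] {F : E → ℝ → ℂ} (hc : Continuous (Function.uncurry F))
    (hd : ∀ t, Differentiable ℂ fun x => F x t) (a b : ℝ) :
    Differentiable ℂ fun x => ∫ t in a..b, F x t := by
  intro x₀
  borelize E
  have : ProperSpace E := FiniteDimensional.proper ℂ E
  -- Radius `2` leaves room for a unit ball around every point of the unit ball at `x₀`. Cauchy's
  -- estimate on it turns the bound `C` for `F` into the bound `2 * C` for the derivative.
  obtain ⟨C, hC⟩ := ((isCompact_closedBall x₀ 2).prod (isCompact_uIcc (a := a) (b := b))).exists_bound_of_continuousOn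
    hc.continuousOn
  have hFt : ∀ x, Continuous (F x) := fun x => hc.comp (by fun_prop : Continuous fun t => (x, t))
  have key := intervalIntegral.hasFDerivAt_integral_of_dominated_of_fderiv_le (𝕜 := ℂ) (μ := volume)
    (F := F) (F' := fun x t => fderiv ℂ (fun x => F x t) x) (x₀ := x₀) (a := a) (b := b)
    (s := ball x₀ 1) (bound := fun _ => (2 * C) / 1) (ball_mem_nhds x₀ one_pos)
    (Filter.Eventually.of_forall fun x => (hFt x).aestronglyMeasurable)
    ((hFt x₀).intervalIntegrable a b)
    ?_ ?_ (by simp) ?_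
  · exact key.differentiableAt
  · have h1 : Continuous (Function.uncurry fun (t : ℝ) (x : E) => F x t) :=
      hc.comp continuous_swap
    exact ((measurable_fderiv_with_param ℂ h1).comp
      (measurable_prodMk_right (y := x₀))).aestronglyMeasurable
  · refine Filter.Eventually.of_forall fun t ht x hx => ?_
    have ht' : t ∈ uIcc a b := uIoc_subset_uIcc ht
    have hb : ∀ y ∈ ball x 1, ‖F y t‖ ≤ C := by
      intro y hy
      refine hC (y, t) ⟨?_, ht'⟩
      rw [mem_closedBall]
      rw [mem_ball] at hy hx
      linarith [dist_triangle y x x₀]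
    refine Complex.norm_fderiv_le_div_of_mapsTo_ball ((hd t).differentiableOn) ?_ one_pos
    intro y hy
    rw [mem_closedBall, dist_eq_norm]
    have h1 := hb y hy
    have h2 := hb x (mem_ball_self one_pos)
    linarith [norm_sub_le (F y t) (F x t)]
  · exact Filter.Eventually.of_forall fun t _ x _ => ((hd t) x).hasFDerivAt

variable {M M' : Type*} [AddCommGroup M] [Module ℂ M] [AddCommGroup M'] [Module ℂ M']

/-- Entire functions on a complex vector space: the functions that are entire on the
finite-dimensional subspaces. -/
def Ent (f : M → ℂ) : Prop :=
  ∀ (n : ℕ) (T : (Fin n → ℂ) →ₗ[ℂ] M), Differentiable ℂ fun x => f (T x)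

lemma Ent.comp_lin {f : M → ℂ} (hf : Ent f) {E : Type*} [NormedAddCommGroup E] [NormedSpace ℂ E]
    [FiniteDimensional ℂ E] (T : E →ₗ[ℂ] M) : Differentiable ℂ fun x => f (T x) := by
  let e := (finBasis ℂ E).equivFun
  have h := hf _ (T ∘ₗ e.symm.toLinearMap)
  have he : Differentiable ℂ e := e.toContinuousLinearEquiv.differentiable
  simpa [Function.comp_def] using h.comp he

/-- Adding a homogenizing coordinate makes the map linear: `T'` restricts to `T` on the slice where
that coordinate is `1`. -/
lemma Ent.comp_aff {f : M → ℂ} (hf : Ent f) {E : Type*} [NormedAddCommGroup E] [NormedSpace ℂ E]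
    [FiniteDimensional ℂ E] (T : E →ᵃ[ℂ] M) : Differentiable ℂ fun x => f (T x) := by
  let T' : (E × ℂ) →ₗ[ℂ] M := T.linear.coprod (LinearMap.toSpanSingleton ℂ M (T 0))
  have h := hf.comp_lin T'
  have h2 : Differentiable ℂ fun x : E => (x, (1 : ℂ)) := by fun_prop
  have h3 := h.comp h2
  have h4 : (fun x => f (T x)) = (fun x => f (T' x)) ∘ fun x : E => (x, (1 : ℂ)) := by
    funext x
    simp only [Function.comp_apply, T', LinearMap.coprod_apply, LinearMap.toSpanSingleton_apply,
      one_smul]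
    rw [← vadd_eq_add, ← T.map_vadd]; simp
  rw [h4]
  exact h3

lemma Ent.comp_affine {f : M → ℂ} (hf : Ent f) (A : M' →ᵃ[ℂ] M) : Ent fun v => f (A v) :=
  fun _ T => hf.comp_aff (A.comp T.toAffineMap)

lemma Ent.comp_linear {f : M → ℂ} (hf : Ent f) (A : M' →ₗ[ℂ] M) : Ent fun v => f (A v) :=
  hf.comp_affine A.toAffineMap

lemma ent_const (c : ℂ) : Ent fun _ : M => c := fun _ _ => differentiable_const c

lemma Ent.add {f g : M → ℂ} (hf : Ent f) (hg : Ent g) : Ent fun v => f v + g v :=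
  fun n T => (hf n T).add (hg n T)

lemma Ent.mul {f g : M → ℂ} (hf : Ent f) (hg : Ent g) : Ent fun v => f v * g v :=
  fun n T => (hf n T).mul (hg n T)

lemma Ent.pow {f : M → ℂ} (hf : Ent f) (k : ℕ) : Ent fun v => f v ^ k :=
  fun n T => (hf n T).pow k

lemma Ent.sub {f g : M → ℂ} (hf : Ent f) (hg : Ent g) : Ent fun v => f v - g v :=
  fun n T => (hf n T).sub (hg n T)

lemma ent_sum {ι : Type*} (s : Finset ι) {f : ι → M → ℂ} (hf : ∀ i ∈ s, Ent (f i)) :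
    Ent fun v => ∑ i ∈ s, f i v := by
  intro n T
  exact Differentiable.fun_sum fun i hi => hf i hi n T

lemma ent_prod {ι : Type*} (s : Finset ι) {f : ι → M → ℂ} (hf : ∀ i ∈ s, Ent (f i)) :
    Ent fun v => ∏ i ∈ s, f i v := by
  classical
  induction s using Finset.induction_on with
  | empty => simpa using ent_const 1
  | insert i s hi ih =>
    simp only [Finset.prod_insert hi]
    exact (hf i (Finset.mem_insert_self _ _)).mul
      (ih fun j hj => hf j (Finset.mem_insert_of_mem hj))

lemma Ent.of_differentiable {f : M → ℂ} (hf : Ent f) {ρ : ℂ → ℂ} (hρ : Differentiable ℂ ρ) :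
    Ent fun v => ρ (f v) :=
  fun n T => hρ.comp (hf n T)

lemma ent_id : Ent fun z : ℂ => z := fun _ T =>
  (LinearMap.toContinuousLinearMap T).differentiable

lemma ent_linear (a : M →ₗ[ℂ] ℂ) : Ent fun v => a v := ent_id.comp_linear a

lemma ent_affine (a : M →ᵃ[ℂ] ℂ) : Ent fun v => a v := ent_id.comp_affine a

lemma Ent.line {f : M → ℂ} (hf : Ent f) (v u : M) : Differentiable ℂ fun s : ℂ => f (v + s • u) := by
  have := hf.comp_aff (AffineMap.lineMap v (v + u) : ℂ →ᵃ[ℂ] M)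
  have h : (fun s : ℂ => f (v + s • u)) =
      fun s => f ((AffineMap.lineMap v (v + u) : ℂ →ᵃ[ℂ] M) s) := by
    funext s
    simp [AffineMap.lineMap_apply, add_comm]
  rw [h]
  exact this

/-- Identity principle along the line through `a` and `b`. -/
lemma Ent.eq_zero_of_mul {f g : M → ℂ} (hf : Ent f) (hg : Ent g) {a b : M} (ha : f a ≠ 0)
    (h : ∀ s : ℂ, f (a + s • (b - a)) * g (a + s • (b - a)) = 0) : g b = 0 := by
  have h1 := hf.line a (b - a)
  have h2 := hg.line a (b - a)
  have h3 : AnalyticOnNhd ℂ (fun s : ℂ => f (a + s • (b - a))) univ := fun x _ => h1.analyticAt x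
  have h4 : AnalyticOnNhd ℂ (fun s : ℂ => g (a + s • (b - a))) univ := fun x _ => h2.analyticAt x
  have h5 := h3.eq_zero_or_eq_zero_of_smul_eq_zero h4 (fun z _ => by simpa using h z) isPreconnected_univ
  rcases h5 with h5 | h5
  · exact absurd (by simpa using h5 0 (mem_univ _)) ha
  · simpa using h5 1 (mem_univ _)

/-! ### Division of entire functions by affine functions -/

/-- The derivative of `g` in the direction `u`. -/
def dirDeriv (g : M → ℂ) (u : M) (v : M) : ℂ := deriv (fun s : ℂ => g (v + s • u)) 0

/-- Cauchy's formula on the unit circle replaces the derivative by an integral of values of `g`, so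
that holomorphy in `v` follows by differentiation under the integral sign. -/
lemma dirDeriv_eq {g : M → ℂ} (hg : Ent g) (u v : M) :
    dirDeriv g u v = (2 * Real.pi * Complex.I)⁻¹ *
      ∫ θ in (0:ℝ)..(2 * Real.pi), g (v + circleMap 0 1 θ • u) *
        (deriv (circleMap 0 1) θ * (circleMap 0 1 θ ^ 2)⁻¹) := by
  have h1 := hg.line v u
  have := Complex.two_pi_I_inv_smul_circleIntegral_sub_sq_inv_smul_of_differentiable (E := ℂ)
    (U := univ) isOpen_univ (c := 0) (w₀ := 0) (R := 1) (subset_univ _) h1.differentiableOn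
    (mem_ball_self one_pos)
  rw [dirDeriv, ← this, circleIntegral]
  simp only [smul_eq_mul]
  congr 1
  refine intervalIntegral.integral_congr fun θ _ => ?_
  simp only [sub_zero]
  ring

lemma ent_dirDeriv {g : M → ℂ} (hg : Ent g) (u : M) : Ent (dirDeriv g u) := by
  intro n T
  simp only [dirDeriv_eq hg]
  refine (differentiable_const _).mul (differentiable_intervalIntegral ?_ ?_ _ _)
  · have h1 := hg.comp_lin (T.coprod (LinearMap.toSpanSingleton ℂ M u))
    have h2 : Continuous fun p : (Fin n → ℂ) × ℝ => (p.1, circleMap 0 1 p.2) := by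
      have := continuous_circleMap 0 1
      fun_prop
    have h3 := h1.continuous.comp h2
    refine Continuous.mul (by simpa [Function.comp_def, Function.uncurry_def] using h3) ?_
    have h4 : Continuous fun θ : ℝ => deriv (circleMap 0 1) θ * (circleMap 0 1 θ ^ 2)⁻¹ := by
      simp only [deriv_circleMap]
      have := continuous_circleMap 0 1
      refine (this.mul continuous_const).mul ((this.pow 2).inv₀ fun θ => ?_)
      exact pow_ne_zero _ (circleMap_ne_center one_ne_zero)
    exact h4.comp continuous_snd
  · intro t
    refine Differentiable.mul_const ?_ _
    have := (hg.comp_affine (AffineMap.id ℂ M + AffineMap.const ℂ M (circleMap 0 1 t • u))) n T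
    simpa using this

/-- Division of an entire function by an affine function. -/
lemma Ent.exists_div {g : M → ℂ} (hg : Ent g) (a : M →ᵃ[ℂ] ℂ) (u : M) :
    ∃ h : M → ℂ, Ent h ∧ ∀ v, g v = g (v - a v • u) + a v * h v := by
  have hD := ent_dirDeriv hg u
  -- The fundamental theorem of calculus is applied on the segment from `v - a v • u` to `v`; the
  -- chain rule produces the factor `a v`.
  refine ⟨fun v => ∫ τ in (0:ℝ)..1, dirDeriv g u (v + (((τ : ℂ) - 1) * a v) • u), ?_, ?_⟩
  · intro n T
    have ha := (ent_affine a) n T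
    refine differentiable_intervalIntegral ?_ ?_ _ _
    · have h1 := hD.comp_lin (T.coprod (LinearMap.toSpanSingleton ℂ M u))
      have h2 : Continuous fun p : (Fin n → ℂ) × ℝ => (p.1, ((p.2 : ℂ) - 1) * a (T p.1)) := by
        have := ha.continuous
        have h3 : Continuous fun p : (Fin n → ℂ) × ℝ => a (T p.1) := this.comp continuous_fst
        have h4 : Continuous fun p : (Fin n → ℂ) × ℝ => (p.2 : ℂ) - 1 := by fun_prop
        exact continuous_fst.prodMk (h4.mul h3)
      simpa [Function.comp_def, Function.uncurry_def] using h1.continuous.comp h2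
    · intro t
      have h1 := hD.comp_lin (T.coprod (LinearMap.toSpanSingleton ℂ M u))
      have h2 : Differentiable ℂ fun x : (Fin n → ℂ) => (x, ((t : ℂ) - 1) * a (T x)) :=
        differentiable_id.prodMk ((differentiable_const _).mul ha)
      simpa [Function.comp_def] using h1.comp h2
  · intro v
    have h1 := hg.line v u
    have hder : ∀ s : ℂ, HasDerivAt (fun s : ℂ => g (v + s • u)) (dirDeriv g u (v + s • u)) s := by
      intro s
      have h2 := (hg.line (v + s • u) u 0).hasDerivAt
      rw [← sub_self s] at h2
      have h3 := h2.comp_sub_const s s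
      refine (h3.congr_of_eventuallyEq (Filter.Eventually.of_forall fun x => ?_)).congr_deriv ?_
      · simp only [sub_smul]; congr 1; abel
      · simp [dirDeriv]
    have hreal : ∀ τ ∈ uIcc (0:ℝ) 1, HasDerivAt (fun τ : ℝ => g (v + (((τ : ℂ) - 1) * a v) • u))
        (dirDeriv g u (v + (((τ : ℂ) - 1) * a v) • u) * a v) τ := by
      intro τ _
      have h4 : HasDerivAt (fun τ : ℂ => (τ - 1) * a v) (a v) τ := by
        simpa using ((hasDerivAt_id (τ : ℂ)).sub_const 1).mul_const (a v)
      exact ((hder _).comp (τ : ℂ) h4).comp_ofReal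
    have hcont : Continuous fun τ : ℝ => dirDeriv g u (v + (((τ : ℂ) - 1) * a v) • u) * a v := by
      have h5 := (hD.line v u).continuous
      have h6 : Continuous fun τ : ℝ => ((τ : ℂ) - 1) * a v := by fun_prop
      exact (h5.comp h6).mul continuous_const
    have := intervalIntegral.integral_eq_sub_of_hasDerivAt hreal (hcont.intervalIntegrable _ _)
    rw [intervalIntegral.integral_mul_const] at this
    simp at this
    rw [mul_comm, this, sub_eq_add_neg v]
    ring

/-- A nonconstant affine function that vanishes only where the entire function does divides it. -/
lemma Ent.exists_div_of_vanish {g : M → ℂ} (hg : Ent g) (a : M →ᵃ[ℂ] ℂ) (ha : a.linear ≠ 0)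
    (h0 : ∀ v, a v = 0 → g v = 0) : ∃ h : M → ℂ, Ent h ∧ ∀ v, g v = a v * h v := by
  -- This normalization puts `v - a v • u` on the zero locus of `a`, so the remainder of the
  -- division vanishes.
  obtain ⟨u, hu⟩ : ∃ u, a.linear u = 1 := by
    obtain ⟨w, hw⟩ : ∃ w, a.linear w ≠ 0 := by
      by_contra! h
      exact ha (LinearMap.ext h)
    exact ⟨(a.linear w)⁻¹ • w, by simp [hw]⟩
  obtain ⟨h, hh, hgh⟩ := hg.exists_div a u
  refine ⟨h, hh, fun v => ?_⟩
  rw [hgh v, h0 (v - a v • u), zero_add]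
  have := a.map_vadd v (-(a v • u))
  simp only [vadd_eq_add, map_neg, map_smul, hu] at this
  rw [sub_eq_neg_add, this]
  simp

lemma affine_zero_line (a : M →ᵃ[ℂ] ℂ) {v w : M} (hv : a v = 0) (hw : a w = 0) (s : ℂ) :
    a (v + s • (w - v)) = 0 := by
  have := a.apply_lineMap v w s
  simp only [AffineMap.lineMap_apply, vsub_eq_sub, vadd_eq_add, hv, hw] at this
  rw [add_comm, this]; simp

/-- If `r X` is divisible by a product of nonconstant affine functions and `r` does not vanish
identically on any of their zero loci, then `X` is divisible by the product. -/
lemma exists_div_prod {ι : Type*} (s : Finset ι) (a : ι → M →ᵃ[ℂ] ℂ)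
    (ha : ∀ i ∈ s, (a i).linear ≠ 0) {r : M → ℂ} (hr : Ent r)
    (hra : ∀ i ∈ s, ∃ v, a i v = 0 ∧ r v ≠ 0) {X Y : M → ℂ} (hX : Ent X) (hY : Ent Y)
    (h : ∀ v, r v * X v = (∏ i ∈ s, a i v) * Y v) :
    ∃ Z : M → ℂ, Ent Z ∧ ∀ v, X v = (∏ i ∈ s, a i v) * Z v := by
  classical
  induction s using Finset.induction_on generalizing X with
  | empty => exact ⟨X, hX, by simp⟩
  | insert i s hi ih =>
    -- The zero locus contains the line through any two of its points. On it `r X` vanishes and `r`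
    -- does not vanish identically, so `X` vanishes by the identity principle.
    have hXi : ∀ v, a i v = 0 → X v = 0 := by
      intro v hv
      obtain ⟨w, hw, hrw⟩ := hra i (Finset.mem_insert_self _ _)
      refine hr.eq_zero_of_mul hX hrw fun t => ?_
      rw [h, Finset.prod_insert hi, affine_zero_line _ hw hv]; simp
    obtain ⟨X', hX', hXX'⟩ := hX.exists_div_of_vanish (a i) (ha i (Finset.mem_insert_self _ _)) hXi
    have hnz : ∃ w, a i w ≠ 0 := by
      by_contra! h0
      refine ha i (Finset.mem_insert_self _ _) (LinearMap.ext fun w => ?_)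
      have := (a i).linearMap_vsub w 0
      simpa [h0] using this
    have key : ∀ v, r v * X' v = (∏ i ∈ s, a i v) * Y v := by
      intro v
      obtain ⟨w, hw⟩ := hnz
      rw [← sub_eq_zero]
      refine (ent_affine (a i)).eq_zero_of_mul (g := fun v => r v * X' v - (∏ i ∈ s, a i v) * Y v)
        ((hr.mul hX').sub ((ent_prod s fun j _ => ent_affine (a j)).mul hY)) hw fun t => ?_
      have := h (w + t • (v - w))
      rw [Finset.prod_insert hi, hXX'] at this
      linear_combination this
    obtain ⟨Z, hZ, hZZ⟩ := ih (fun j hj => ha j (Finset.mem_insert_of_mem hj))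
      (fun j hj => hra j (Finset.mem_insert_of_mem hj)) hX' key
    refine ⟨Z, hZ, fun v => ?_⟩
    rw [hXX', hZZ, Finset.prod_insert hi, mul_assoc]

/-- A function vanishing on the zero loci of pairwise independent affine functions is divisible by
their product. -/
lemma exists_div_prod_of_vanish {ι : Type*} (s : Finset ι) (a : ι → M →ᵃ[ℂ] ℂ)
    (ha : ∀ i ∈ s, (a i).linear ≠ 0)
    (hra : ∀ i ∈ s, ∀ j ∈ s, i ≠ j → ∃ v, a i v = 0 ∧ a j v ≠ 0) {X : M → ℂ} (hX : Ent X)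
    (h : ∀ i ∈ s, ∀ v, a i v = 0 → X v = 0) :
    ∃ Z : M → ℂ, Ent Z ∧ ∀ v, X v = (∏ i ∈ s, a i v) * Z v := by
  classical
  induction s using Finset.induction_on generalizing X with
  | empty => exact ⟨X, hX, by simp⟩
  | insert i s hi ih =>
    obtain ⟨X', hX', hXX'⟩ := hX.exists_div_of_vanish (a i) (ha i (Finset.mem_insert_self _ _))
      (h i (Finset.mem_insert_self _ _))
    have key : ∀ j ∈ s, ∀ v, a j v = 0 → X' v = 0 := by
      intro j hj v hv
      obtain ⟨w, hw, hwi⟩ := hra j (Finset.mem_insert_of_mem hj) i (Finset.mem_insert_self _ _)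
        (by rintro rfl; exact hi hj)
      refine (ent_affine (a i)).eq_zero_of_mul hX' hwi fun t => ?_
      rw [← hXX']
      exact h j (Finset.mem_insert_of_mem hj) _ (affine_zero_line _ hw hv t)
    obtain ⟨Z, hZ, hZZ⟩ := ih (fun j hj => ha j (Finset.mem_insert_of_mem hj))
      (fun j hj k hk => hra j (Finset.mem_insert_of_mem hj) k (Finset.mem_insert_of_mem hk)) hX'
      key
    refine ⟨Z, hZ, fun v => ?_⟩
    rw [hXX', hZZ, Finset.prod_insert hi, mul_assoc]

/-- Nonzero entire functions have a common point of nonvanishing on a linear space. -/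
lemma ent_prod_ne_zero {ι : Type*} (s : Finset ι) {f : ι → M → ℂ} (hf : ∀ i ∈ s, Ent (f i))
    (h0 : ∀ i ∈ s, ∃ v, f i v ≠ 0) : ∃ v, ∀ i ∈ s, f i v ≠ 0 := by
  classical
  induction s using Finset.induction_on with
  | empty => exact ⟨0, by simp⟩
  | insert i s hi ih =>
    obtain ⟨w, hw⟩ := ih (fun j hj => hf j (Finset.mem_insert_of_mem hj))
      (fun j hj => h0 j (Finset.mem_insert_of_mem hj))
    obtain ⟨v, hv⟩ := h0 i (Finset.mem_insert_self _ _)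
    by_contra! hc
    refine hv ?_
    refine (ent_prod s (f := f) fun j hj => hf j (Finset.mem_insert_of_mem hj)).eq_zero_of_mul
      (hf i (Finset.mem_insert_self _ _)) (a := w) (Finset.prod_ne_zero_iff.mpr hw) fun t => ?_
    obtain ⟨j, hj, hj0⟩ := hc (w + t • (v - w))
    rcases Finset.mem_insert.mp hj with rfl | hj
    · simp [hj0]
    · rw [Finset.prod_eq_zero (f := fun k => f k (w + t • (v - w))) hj hj0, zero_mul]

end Analysis

end

section

variable {𝔤 : Type*} [LieRing 𝔤] [LieAlgebra ℂ 𝔤] [FiniteDimensional ℂ 𝔤]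
  [LieAlgebra.IsKilling ℂ 𝔤] {H : LieSubalgebra ℂ 𝔤} [H.IsCartanSubalgebra]

/-! ### Coroots, signs and Weyl group elements -/

/-- The coroots are nonzero. -/
lemma ev_ne_zero (α : H.root) : ev α ≠ 0 := (LieAlgebra.IsKilling.rootSystem H).ne_zero α

lemma ev_injective : Function.Injective (ev : H.root → H →ₗ[ℂ] ℂ) :=
  (LieAlgebra.IsKilling.rootSystem H).root.injective

/-- The negative of a coroot. -/
def ng (α : H.root) : H.root := (LieAlgebra.IsKilling.rootSystem H).reflectionPerm α α

@[simp] lemma ev_ng (α : H.root) : ev (ng α) = -ev α := by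
  simp only [ev, ng, RootPairing.root_reflectionPerm]
  exact (LieAlgebra.IsKilling.rootSystem H).reflection_apply_self α

@[simp] lemma ng_ng (α : H.root) : ng (ng α) = α := ev_injective (by simp)

lemma ng_injective : Function.Injective (ng : H.root → H.root) :=
  Function.LeftInverse.injective ng_ng

/-- Inclusion of kernels makes the two functionals proportional, and the root system is reduced. -/
lemma eq_or_eq_ng_of_ker_le {α β : H.root} (h : ∀ v, ev α v = 0 → ev β v = 0) :
    β = α ∨ β = ng α := by
  have h1 : ev β ∈ Submodule.span ℂ (Set.range fun _ : Unit => ev α) := by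
    refine mem_span_of_iInf_ker_le_ker ?_
    intro v hv
    simp only [Submodule.mem_iInf, LinearMap.mem_ker, forall_const] at hv
    exact h v hv
  rw [Set.range_const, Submodule.mem_span_singleton] at h1
  obtain ⟨c, hc⟩ := h1
  rcases RootPairing.IsReduced.eq_or_eq_neg (P := LieAlgebra.IsKilling.rootSystem H) α β (by
    rw [LinearIndependent.pair_iff' ((LieAlgebra.IsKilling.rootSystem H).ne_zero _)]
    push Not
    exact ⟨c, hc⟩) with h2 | h2
  · exact Or.inl (ev_injective h2.symm)
  · refine Or.inr (ev_injective ?_)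
    rw [ev_ng]
    exact (neg_eq_iff_eq_neg.mpr h2).symm

lemma ev_coreflection (α β : H.root) (v : H) :
    ev α ((LieAlgebra.IsKilling.rootSystem H).coreflection β v) =
      ev ((LieAlgebra.IsKilling.rootSystem H).reflectionPerm β α) v := by
  simp only [ev, RootPairing.root_reflectionPerm, RootPairing.coreflection_apply,
    RootPairing.reflection_apply, map_sub, LinearMap.sub_apply, map_smul, LinearMap.smul_apply,
    smul_eq_mul]
  rw [mul_comm]
  rfl

/-- An element of the Weyl group permutes the coroots. -/
lemma exists_perm {w : H ≃ₗ[ℂ] H} (hw : w ∈ weyl H) :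
    ∃ σ : H.root ≃ H.root, ∀ α v, ev α (w v) = ev (σ α) v := by
  induction hw using Subgroup.closure_induction'' with
  | mem x hx =>
    obtain ⟨β, -, rfl⟩ := hx
    exact ⟨(LieAlgebra.IsKilling.rootSystem H).reflectionPerm β, fun α v => ev_coreflection α β v⟩
  | inv_mem x hx =>
    obtain ⟨β, -, rfl⟩ := hx
    rw [RootPairing.coreflection_inv]
    exact ⟨(LieAlgebra.IsKilling.rootSystem H).reflectionPerm β, fun α v => ev_coreflection α β v⟩
  | one => exact ⟨Equiv.refl _, fun α v => rfl⟩
  | mul x y _ _ hx hy =>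
    obtain ⟨σ, hσ⟩ := hx
    obtain ⟨τ, hτ⟩ := hy
    exact ⟨σ.trans τ, fun α v => by rw [LinearEquiv.mul_apply, hσ, hτ]; rfl⟩

variable (b : (LieAlgebra.IsKilling.rootSystem H).Base)

lemma ng_mem_pos (α : H.root) : ng α ∈ posCoroots b ↔ α ∉ posCoroots b :=
  RootPairing.Base.IsPos.neg_iff_not b α

open Classical in
/-- A set of coroots as a `Finset`. -/
def fs (S : Set H.root) : Finset H.root := {α | α ∈ S}

@[simp] lemma mem_fs {S : Set H.root} {α : H.root} : α ∈ fs S ↔ α ∈ S := by simp [fs]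

variable {b}

lemma pos_mem_closure {α : H.root} (hα : α ∈ posCoroots b) :
    ev α ∈ AddSubmonoid.closure (ev '' (b.support : Set H.root)) := by
  refine RootPairing.Base.IsPos.induction_on_add (b := b) (i := α) hα
    (p := fun α => ev α ∈ AddSubmonoid.closure (ev '' (b.support : Set H.root))) ?_ ?_
  · exact fun i hi => AddSubmonoid.subset_closure ⟨i, hi, rfl⟩
  · intro i j k hk hi hj
    have : ev k = ev i + ev j := hk
    rw [this]
    exact add_mem hi (AddSubmonoid.subset_closure ⟨j, hj, rfl⟩)

lemma ev_pairing_real (α β : H.root) :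
    ∃ t : ℝ, ev α ((LieAlgebra.IsKilling.rootSystem H).coroot β) = t := by
  obtain ⟨z, hz⟩ := (inferInstance : (LieAlgebra.IsKilling.rootSystem H).IsCrystallographic).exists_value α β
  refine ⟨z, ?_⟩
  change (LieAlgebra.IsKilling.rootSystem H).pairing α β = _
  rw [← hz]; simp

lemma ev_real (α : H.root) {v : H} (hv : v ∈ realForm H) : ∃ t : ℝ, ev α v = t := by
  induction hv using Submodule.span_induction with
  | mem x hx =>
    obtain ⟨β, rfl⟩ := hx
    exact ev_pairing_real α β
  | zero => exact ⟨0, by simp⟩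
  | add x y _ _ hx hy =>
    obtain ⟨s, hs⟩ := hx
    obtain ⟨t, ht⟩ := hy
    exact ⟨s + t, by simp [hs, ht]⟩
  | smul a x _ hx =>
    obtain ⟨s, hs⟩ := hx
    refine ⟨a * s, ?_⟩
    rw [← Complex.coe_smul, map_smul, hs]
    simp

/-- `V_ℂ = V + iV`. -/
lemma exists_re_im (v : H) : ∃ x ∈ realForm H, ∃ y ∈ realForm H, v = x + Complex.I • y := by
  have hv : v ∈ Submodule.span ℂ (Set.range (LieAlgebra.IsKilling.rootSystem H).coroot) := by
    rw [RootPairing.IsRootSystem.span_coroot_eq_top]; trivial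
  induction hv using Submodule.span_induction with
  | mem x hx => exact ⟨x, Submodule.subset_span hx, 0, zero_mem _, by simp⟩
  | zero => exact ⟨0, zero_mem _, 0, zero_mem _, by simp⟩
  | add x y _ _ hx hy =>
    obtain ⟨a, ha, c, hc, rfl⟩ := hx
    obtain ⟨a', ha', c', hc', rfl⟩ := hy
    exact ⟨a + a', add_mem ha ha', c + c', add_mem hc hc', by module⟩
  | smul z x _ hx =>
    obtain ⟨a, ha, c, hc, rfl⟩ := hx
    refine ⟨z.re • a - z.im • c, sub_mem (Submodule.smul_mem _ _ ha) (Submodule.smul_mem _ _ hc),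
      z.im • a + z.re • c, add_mem (Submodule.smul_mem _ _ ha) (Submodule.smul_mem _ _ hc), ?_⟩
    nth_rewrite 1 [← Complex.re_add_im z]
    simp only [← Complex.coe_smul]
    have : Complex.I * Complex.I = -1 := Complex.I_mul_I
    have h2 : ((z.re : ℂ) + (z.im : ℂ) * Complex.I) * Complex.I = -(z.im : ℂ) + Complex.I * z.re := by
      linear_combination (z.im : ℂ) * this
    simp only [smul_add, add_smul, smul_smul, h2]
    module

lemma eq_zero_of_ev {v : H} (h : ∀ α : H.root, ev α v = 0) : v = 0 := by
  have hv : ∀ f ∈ Submodule.span ℂ (Set.range (LieAlgebra.IsKilling.rootSystem H).root), f v = 0 := by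
    intro f hf
    induction hf using Submodule.span_induction with
    | mem x hx => obtain ⟨α, rfl⟩ := hx; exact h α
    | zero => rfl
    | add x y _ _ hx hy => simp [hx, hy]
    | smul z x _ hx => simp [hx]
  rw [RootPairing.IsRootSystem.span_root_eq_top] at hv
  exact (Module.forall_dual_apply_eq_zero_iff ℂ v).mp fun f => hv f trivial

/-- Coroots are real on the real form and separate points, so they detect the imaginary part of a
vector. -/
lemma mem_realForm {v : H} (h : ∀ α : H.root, ∃ t : ℝ, ev α v = t) : v ∈ realForm H := by
  obtain ⟨x, hx, y, hy, rfl⟩ := exists_re_im v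
  have : y = 0 := by
    refine eq_zero_of_ev fun α => ?_
    obtain ⟨t, ht⟩ := h α
    obtain ⟨p, hp⟩ := ev_real α hx
    obtain ⟨q, hq⟩ := ev_real α hy
    rw [map_add, map_smul, hp, hq] at ht
    have := congrArg Complex.im ht
    simp at this
    rw [hq, this]; simp
  simpa [this] using hx

/-- A standard Levi subsystem is the zero set of a dominant real vector with values in `ℕ`. -/
lemma exists_grading {J : Set H.root} (hJ : J ⊆ b.support) :
    ∃ x ∈ realForm H, (∀ α ∈ spanned J, ev α x = 0) ∧
      ∀ α ∈ posCoroots b, ∃ n : ℕ, ev α x = n ∧ (n = 0 → α ∈ spanned J) := by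
  classical
  -- The simple coroots are linearly independent, so their values can be prescribed; a positive
  -- coroot then counts, with multiplicity, its simple constituents outside `J`.
  obtain ⟨ξ, hξ⟩ : ∃ ξ : Dual ℂ (Dual ℂ H), ∀ i : b.support,
      ξ (ev i) = if (i : H.root) ∈ J then 0 else 1 := by
    have hli : LinearIndependent ℂ (fun i : b.support => ev (i : H.root)) := b.linearIndepOn_root
    let B := Basis.extend hli.linearIndepOn_id
    have hsub := hli.linearIndepOn_id.subset_extend (Set.subset_univ _)
    refine ⟨B.constr ℂ fun f => if ∃ i ∈ J, ev i = f.1 then 0 else 1, fun i => ?_⟩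
    have h1 : B ⟨ev i, hsub ⟨i, rfl⟩⟩ = ev (i : H.root) := Basis.extend_apply_self _ _
    rw [← h1, Basis.constr_basis]
    refine if_congr ?_ rfl rfl
    constructor
    · rintro ⟨j, hj, hij⟩
      rwa [← ev_injective hij]
    · exact fun h => ⟨i, h, rfl⟩
  let x : H := (evalEquiv ℂ H).symm ξ
  have hx : ∀ f : Dual ℂ H, f x = ξ f := fun f => by simp [x]
  have hJx : ∀ α ∈ J, ev α x = 0 := fun α hα => by
    rw [hx]
    simpa [hα] using hξ ⟨α, hJ hα⟩
  have hspan : ∀ f ∈ Submodule.span ℂ (ev '' J), f x = 0 := by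
    intro f hf
    induction hf using Submodule.span_induction with
    | mem g hg => obtain ⟨α, hα, rfl⟩ := hg; exact hJx α hα
    | zero => rfl
    | add g g' _ _ hg hg' => simp [hg, hg']
    | smul z g _ hg => simp [hg]
  have hpos : ∀ α ∈ posCoroots b, ∃ n : ℕ, ev α x = n ∧ (n = 0 → α ∈ spanned J) := by
    intro α hα
    have h := pos_mem_closure hα
    change ∃ n : ℕ, ev α x = n ∧ (n = 0 → ev α ∈ Submodule.span ℂ (ev '' J))
    generalize ev α = f at h ⊢
    induction h using AddSubmonoid.closure_induction with
    | mem f hf =>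
      obtain ⟨i, hi, rfl⟩ := hf
      have := hξ ⟨i, hi⟩
      simp only at this
      rw [hx, this]
      by_cases hiJ : i ∈ J
      · exact ⟨0, by simp [hiJ], fun _ => Submodule.subset_span ⟨i, hiJ, rfl⟩⟩
      · exact ⟨1, by simp [hiJ], by simp⟩
    | zero => exact ⟨0, by simp, fun _ => zero_mem _⟩
    | add f g _ _ hf hg =>
      obtain ⟨n, hn, hn'⟩ := hf
      obtain ⟨m, hm, hm'⟩ := hg
      refine ⟨n + m, by simp [hn, hm], fun h => add_mem (hn' (by omega)) (hm' (by omega))⟩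
  refine ⟨x, mem_realForm fun α => ?_, fun α hα => hspan _ hα, hpos⟩
  by_cases hα : α ∈ posCoroots b
  · obtain ⟨n, hn, -⟩ := hpos α hα
    exact ⟨n, by simp [hn]⟩
  · obtain ⟨n, hn, -⟩ := hpos (ng α) ((ng_mem_pos b α).mpr hα)
    refine ⟨-n, ?_⟩
    rw [ev_ng, LinearMap.neg_apply] at hn
    rw [← neg_eq_iff_eq_neg.mpr hn.symm]; simp

/-! ### Antisymmetry of products of positive coroots -/

/-- A set of coroots closed under its own reflections. -/
def ReflClosed (Q : Set H.root) : Prop :=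
  ∀ β ∈ Q, ∀ α ∈ Q, (LieAlgebra.IsKilling.rootSystem H).reflectionPerm β α ∈ Q

lemma reflClosed_univ : ReflClosed (Set.univ : Set H.root) := fun _ _ _ _ => trivial

lemma reflClosed_spanned (J : Set H.root) : ReflClosed (spanned J) := by
  intro β hβ α hα
  change (LieAlgebra.IsKilling.rootSystem H).root _ ∈ Submodule.span ℂ (ev '' J)
  rw [RootPairing.root_reflectionPerm, RootPairing.reflection_apply]
  exact sub_mem hα (Submodule.smul_mem _ _ hβ)

variable (b) in
/-- The product of the positive coroots in `Q`. -/
def posProd (Q : Set H.root) (v : H) : ℂ := ∏ α ∈ fs (Q ∩ posCoroots b), ev α v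

lemma ent_posProd (Q : Set H.root) : Ent (posProd b Q) := ent_prod _ fun α _ => ent_linear (ev α)

lemma exists_posProd_ne_zero (Q : Set H.root) : ∃ v, posProd b Q v ≠ 0 := by
  obtain ⟨v, hv⟩ := ent_prod_ne_zero (fs (Q ∩ posCoroots b)) (f := fun α v => ev α v)
    (fun α _ => ent_linear (ev α)) (fun α _ => by
      by_contra! h
      exact ev_ne_zero α (LinearMap.ext h))
  exact ⟨v, Finset.prod_ne_zero_iff.mpr hv⟩

lemma exists_zero_ne_zero {α β : H.root} (hα : α ∈ posCoroots b) (hβ : β ∈ posCoroots b)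
    (h : α ≠ β) : ∃ v, ev α v = 0 ∧ ev β v ≠ 0 := by
  by_contra! hc
  rcases eq_or_eq_ng_of_ker_le hc with rfl | rfl
  · exact h rfl
  · exact (ng_mem_pos b α).mp hβ hα

/-- Up to sign, `σ` permutes the positive elements of `Q`: negative images are replaced by their
negatives, each at the cost of a factor `-1`. Injectivity of the corrected map `τ` rests on `σ`
commuting with negation. -/
lemma posProd_perm {Q : Set H.root} {w : H ≃ₗ[ℂ] H} {σ : H.root ≃ H.root}
    (hσ : ∀ α v, ev α (w v) = ev (σ α) v) (hQ : ∀ α ∈ Q, σ α ∈ Q) (hn : ∀ α ∈ Q, ng α ∈ Q) :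
    ∃ s : ℂ, (s = 1 ∨ s = -1) ∧ ∀ v, posProd b Q (w v) = s * posProd b Q v := by
  classical
  have hσn : ∀ α, σ (ng α) = ng (σ α) := fun α => ev_injective (LinearMap.ext fun v => by
    rw [← hσ, ev_ng, ev_ng]; simp [hσ])
  let τ : H.root → H.root := fun α => if σ α ∈ posCoroots b then σ α else ng (σ α)
  let s : H.root → ℂ := fun α => if σ α ∈ posCoroots b then 1 else -1
  have hs : ∀ α v, ev α (w v) = s α * ev (τ α) v := by
    intro α v
    by_cases h : σ α ∈ posCoroots b <;> simp [s, τ, h, hσ]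
  have hmaps : ∀ α ∈ fs (Q ∩ posCoroots b), τ α ∈ fs (Q ∩ posCoroots b) := by
    intro α hα
    simp only [mem_fs, Set.mem_inter_iff] at hα ⊢
    by_cases h : σ α ∈ posCoroots b
    · simp [τ, h, hQ α hα.1]
    · simp [τ, h, hn _ (hQ α hα.1), (ng_mem_pos b (σ α)).mpr h]
  have hinj : ∀ α ∈ fs (Q ∩ posCoroots b), ∀ β ∈ fs (Q ∩ posCoroots b), τ α = τ β → α = β := by
    intro α hα β hβ h
    simp only [mem_fs, Set.mem_inter_iff] at hα hβ
    have key : ∀ γ δ, γ ∈ posCoroots b → δ ∈ posCoroots b → ng (σ γ) ≠ σ δ := by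
      intro γ δ hγ hδ h
      rw [← hσn] at h
      rw [← σ.injective h] at hδ
      exact (ng_mem_pos b γ).mp hδ hγ
    simp only [τ] at h
    split_ifs at h with h1 h2 h2
    · exact σ.injective h
    · exact absurd h.symm (key _ _ hβ.2 hα.2)
    · exact absurd h (key _ _ hα.2 hβ.2)
    · exact σ.injective (ng_injective h)
  refine ⟨∏ α ∈ fs (Q ∩ posCoroots b), s α, ?_, fun v => ?_⟩
  · refine Finset.prod_induction s (fun z => z = 1 ∨ z = -1) ?_ (Or.inl rfl) ?_
    · rintro x y (rfl | rfl) (rfl | rfl) <;> simp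
    · intro α _
      by_cases h : σ α ∈ posCoroots b <;> simp [s, h]
  · simp only [posProd, hs, Finset.prod_mul_distrib]
    congr 1
    exact Finset.prod_bij (fun α _ => τ α) hmaps (fun α hα β hβ h => hinj α hα β hβ h)
      (fun β hβ => by
        obtain ⟨α, hα, h⟩ := Finset.surj_on_of_inj_on_of_card_le (fun α _ => τ α) hmaps
          (fun α β hα hβ h => hinj α hα β hβ h) le_rfl β hβ
        exact ⟨α, hα, h.symm⟩) (fun _ _ => rfl)

lemma ReflClosed.ng_mem {Q : Set H.root} (hQ : ReflClosed Q) {α : H.root} (hα : α ∈ Q) :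
    ng α ∈ Q := hQ α hα α hα

/-- Reflections in `Q` change the sign of the product of the positive coroots in `Q`. -/
lemma posProd_coreflection {Q : Set H.root} (hQ : ReflClosed Q) {β : H.root} (hβ : β ∈ Q) (v : H) :
    posProd b Q ((LieAlgebra.IsKilling.rootSystem H).coreflection β v) = -posProd b Q v := by
  classical
  wlog hp : β ∈ posCoroots b generalizing β
  · have := this (hQ.ng_mem hβ) ((ng_mem_pos b β).mpr hp)
    rw [← this]
    congr 1
    simp only [RootPairing.coreflection_apply]
    have h1 : (LieAlgebra.IsKilling.rootSystem H).coroot (ng β) =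
        -(LieAlgebra.IsKilling.rootSystem H).coroot β := by
      rw [ng, RootPairing.coroot_reflectionPerm, RootPairing.coreflection_apply_self]
    have h2 : (LieAlgebra.IsKilling.rootSystem H).root' (ng β) v =
        -(LieAlgebra.IsKilling.rootSystem H).root' β v := by
      have := LinearMap.congr_fun (ev_ng β) v
      exact this
    rw [h1, h2]; simp
  obtain ⟨s, hs, h⟩ := posProd_perm (b := b) (Q := Q)
    (w := (LieAlgebra.IsKilling.rootSystem H).coreflection β)
    (σ := (LieAlgebra.IsKilling.rootSystem H).reflectionPerm β)
    (fun α v => ev_coreflection α β v) (fun α hα => hQ β hβ α hα) (fun α hα => hQ.ng_mem hα)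
  rcases hs with rfl | rfl
  -- If the sign were `1`, the cofactor `R` of `ev β` would change sign under the reflection and so
  -- vanish on the fixed hyperplane. But `R` is a product of coroots not proportional to `β`, none
  -- of which vanishes identically there.
  · exfalso
    have hmem : β ∈ fs (Q ∩ posCoroots b) := by simp [hβ, hp]
    let R : H → ℂ := fun v => ∏ α ∈ (fs (Q ∩ posCoroots b)).erase β, ev α v
    have hR : Ent R := ent_prod _ fun α _ => ent_linear (ev α)
    have hsplit : ∀ v, posProd b Q v = ev β v * R v := fun v =>
      (Finset.mul_prod_erase _ (fun α => ev α v) hmem).symm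
    have hself : ∀ v, ev β ((LieAlgebra.IsKilling.rootSystem H).coreflection β v) = -ev β v := by
      intro v
      rw [ev_coreflection]
      exact LinearMap.congr_fun (ev_ng β) v
    have hev : ∃ v, ev β v ≠ 0 := by
      by_contra! h
      exact ev_ne_zero β (LinearMap.ext h)
    obtain ⟨u, hu⟩ := hev
    have hRs : ∀ v, R ((LieAlgebra.IsKilling.rootSystem H).coreflection β v) + R v = 0 := by
      intro v
      refine (ent_linear (ev β)).eq_zero_of_mul (g := fun v =>
        R ((LieAlgebra.IsKilling.rootSystem H).coreflection β v) + R v)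
        ((hR.comp_linear ((LieAlgebra.IsKilling.rootSystem H).coreflection β).toLinearMap).add hR)
        hu fun t => ?_
      have h3 := h (u + t • (v - u))
      rw [hsplit, hsplit, hself] at h3
      linear_combination -h3
    have hker : ∀ v : LinearMap.ker (ev β), R v = 0 := by
      intro v
      have h4 := hRs v
      have h5 : (LieAlgebra.IsKilling.rootSystem H).coreflection β (v : H) = v := by
        rw [RootPairing.coreflection_apply]
        have : (LieAlgebra.IsKilling.rootSystem H).root' β (v : H) = 0 := v.2
        rw [this]; simp
      rw [h5] at h4
      linear_combination h4 / 2
    obtain ⟨v, hv⟩ := ent_prod_ne_zero ((fs (Q ∩ posCoroots b)).erase β)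
      (f := fun α (v : LinearMap.ker (ev β)) => ev α v)
      (fun α _ => ent_linear (ev α ∘ₗ (LinearMap.ker (ev β)).subtype)) (fun α hα => by
        simp only [Finset.mem_erase, mem_fs, Set.mem_inter_iff] at hα
        obtain ⟨v, hv, hv'⟩ := exists_zero_ne_zero hp hα.2.2 (Ne.symm hα.1)
        exact ⟨⟨v, hv⟩, hv'⟩)
    exact Finset.prod_ne_zero_iff.mpr hv (hker v)
  · rw [h]; ring

/-- The sign character. -/
lemma exists_sign {Q : Set H.root} (hQ : ReflClosed Q) (z : reflGroup Q) :
    ∃ s : ℂ, (s = 1 ∨ s = -1) ∧ ∀ v, posProd b Q (z.1 v) = s * posProd b Q v := by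
  obtain ⟨z, hz⟩ := z
  simp only
  induction hz using Subgroup.closure_induction'' with
  | mem x hx =>
    obtain ⟨β, hβ, rfl⟩ := hx
    exact ⟨-1, Or.inr rfl, fun v => by rw [posProd_coreflection hQ hβ]; ring⟩
  | inv_mem x hx =>
    obtain ⟨β, hβ, rfl⟩ := hx
    rw [RootPairing.coreflection_inv]
    exact ⟨-1, Or.inr rfl, fun v => by rw [posProd_coreflection hQ hβ]; ring⟩
  | one => exact ⟨1, Or.inl rfl, fun v => by simp⟩
  | mul x y _ _ hx hy =>
    obtain ⟨s, hs, hs'⟩ := hx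
    obtain ⟨t, ht, ht'⟩ := hy
    refine ⟨s * t, ?_, fun v => by rw [LinearEquiv.mul_apply, hs', ht']; ring⟩
    rcases hs with rfl | rfl <;> rcases ht with rfl | rfl <;> simp

variable (b) in
open Classical in
/-- The sign of an element of `reflGroup Q`. -/
def sgn (Q : Set H.root) (z : reflGroup Q) : ℂ :=
  if hQ : ReflClosed Q then (exists_sign (b := b) hQ z).choose else 1

lemma sgn_eq (Q : Set H.root) (z : reflGroup Q) : sgn b Q z = 1 ∨ sgn b Q z = -1 := by
  unfold sgn
  split_ifs with hQ
  · exact (exists_sign (b := b) hQ z).choose_spec.1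
  · exact Or.inl rfl

lemma posProd_sgn {Q : Set H.root} (hQ : ReflClosed Q) (z : reflGroup Q) (v : H) :
    posProd b Q (z.1 v) = sgn b Q z * posProd b Q v := by
  unfold sgn
  rw [dif_pos hQ]
  exact (exists_sign (b := b) hQ z).choose_spec.2 v

end

section

variable {𝔤 : Type*} [LieRing 𝔤] [LieAlgebra ℂ 𝔤] [FiniteDimensional ℂ 𝔤]
  [LieAlgebra.IsKilling ℂ 𝔤] {H : LieSubalgebra ℂ 𝔤} [H.IsCartanSubalgebra]

/-! ### Multiplicity functions of products on `L` -/

lemma isEntire_iff {f : H → ℂ} : IsEntire f ↔ Ent f := by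
  refine ⟨fun h n T => ?_, fun h T => h _ T⟩
  let e := (finBasis ℂ H).equivFun
  have h1 := h e.symm.toLinearMap
  have h2 : Differentiable ℂ (e.toLinearMap ∘ₗ T) :=
    (LinearMap.toContinuousLinearMap (e.toLinearMap ∘ₗ T)).differentiable
  simpa [Function.comp_def] using h1.comp h2

section Affine

variable (L : AffineSubspace ℝ H) [Nonempty L]

/-- The restriction of a linear functional to `L_ℂ`. -/
def rl (f : H →ₗ[ℂ] ℂ) : Aff L := f.toAffineMap.comp (cplx L).subtype

@[simp] lemma rl_apply (f : H →ₗ[ℂ] ℂ) (v : cplx L) : rl L f v = f v := rfl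

@[simp] lemma res_apply (α : H.root) (v : cplx L) : res L α v = ev α v := rfl

/-- An affine retraction onto `L_ℂ`. -/
lemma exists_retraction : ∃ π : H →ᵃ[ℂ] cplx L, ∀ v : cplx L, π v = v := by
  obtain ⟨g, hg⟩ := (cplx L).direction.subtype.exists_leftInverse_of_injective
    (Submodule.ker_subtype _)
  let p : cplx L := Classical.arbitrary _
  refine ⟨(AffineEquiv.vaddConst ℂ p).toAffineMap.comp
    (g.toAffineMap.comp (AffineMap.id ℂ H - AffineMap.const ℂ H (p : H))), fun v => ?_⟩
  have h1 : (v : H) - p = (cplx L).direction.subtype (v -ᵥ p) := rfl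
  have h2 : g ((v : H) - p) = v -ᵥ p := by
    rw [h1]; exact LinearMap.congr_fun hg _
  rw [map_sub] at h2
  simp [h2]

variable {L}

open Classical in
/-- The multiplicity function with value `1` at the class of `X` (zero if `X` is constant). -/
def clsF (X : Aff L) : AffClass L →₀ ℕ :=
  if h : Nonconst X then Finsupp.single (Quotient.mk (affSetoid L) ⟨X, h⟩) 1 else 0

/-- The product `∏_ν ρ(ν)^{n(ν)}`. -/
def pw (ρ : ℂ → ℂ) (n : AffClass L →₀ ℕ) (v : cplx L) : ℂ := n.prod fun ν k => ρ (ν.out.1 v) ^ k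

lemma pw_add (ρ : ℂ → ℂ) (m n : AffClass L →₀ ℕ) (v : cplx L) :
    pw ρ (m + n) v = pw ρ m v * pw ρ n v :=
  Finsupp.prod_add_index' (fun _ => pow_zero _) fun _ _ _ => pow_add _ _ _

@[simp] lemma pw_zero (ρ : ℂ → ℂ) (v : cplx L) : pw ρ 0 v = 1 := Finsupp.prod_zero_index

lemma out_eq (X : {X : Aff L // Nonconst X}) :
    X.1 = (Quotient.mk (affSetoid L) X).out.1 ∨ X.1 = cst L 1 - (Quotient.mk (affSetoid L) X).out.1 :=
  Quotient.mk_out (s := affSetoid L) X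

lemma pw_clsF {ρ : ℂ → ℂ} (hρ : ∀ z, ρ z = ρ (1 - z)) {X : Aff L} (hX : Nonconst X) (v : cplx L) :
    pw ρ (clsF X) v = ρ (X v) := by
  rw [clsF, dif_pos hX, pw, Finsupp.prod_single_index (by simp), pow_one]
  rcases out_eq ⟨X, hX⟩ with h | h
  · rw [← h]
  · have h1 : X v = 1 - ((Quotient.mk (affSetoid L) ⟨X, hX⟩).out.1 v) := by
      conv_lhs => rw [show X = _ from h]
      simp
    rw [h1, ← hρ]

-- Constant affine functions have no class, so their values under `ρ` have to be carried along as a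
-- separate factor.
open Classical in
lemma pw_sum {ι : Type*} (s : Finset ι) (X : ι → Aff L) {ρ : ℂ → ℂ} (hρ : ∀ z, ρ z = ρ (1 - z))
    (v : cplx L) :
    pw ρ (∑ i ∈ s, clsF (X i)) v * ∏ i ∈ s with ¬ Nonconst (X i), ρ (X i v) =
      ∏ i ∈ s, ρ (X i v) := by
  induction s using Finset.induction_on with
  | empty => simp
  | insert i s hi ih =>
    rw [Finset.sum_insert hi, pw_add, Finset.prod_insert hi, ← ih, Finset.filter_insert]
    by_cases h : Nonconst (X i)
    · rw [pw_clsF hρ h]; simp [h]; ring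
    · rw [if_pos h, Finset.prod_insert (by simp [hi])]
      rw [clsF, dif_neg h, pw_zero]; ring

/-- The coordinate `p.1` is a deformation parameter replacing `ρ` by `ρ + t`. It keeps the symmetry
of `ρ` and, for generic `t`, removes accidental zeros of `ρ` at any finitely many prescribed values.
-/
lemma ent_pw {ρ : ℂ → ℂ} (hρ : Differentiable ℂ ρ) (π : H →ᵃ[ℂ] cplx L) (n : AffClass L →₀ ℕ) :
    Ent fun p : ℂ × H => pw (fun z => ρ z + p.1) n (π p.2) := by
  refine ent_prod _ fun ν _ => Ent.pow (Ent.add ?_ (ent_linear (LinearMap.fst ℂ ℂ H))) _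
  exact (ent_affine ((ν.out.1.comp π).comp (LinearMap.snd ℂ ℂ H).toAffineMap)).of_differentiable hρ

lemma nonconst_linear {X : Aff L} (hX : Nonconst X) : ∃ u, X.linear u = 1 := by
  by_contra! h
  have h0 : X.linear = 0 := by
    ext w
    by_contra hw
    exact h ((X.linear w)⁻¹ • w) (by simpa using inv_mul_cancel₀ hw)
  exact hX ⟨X (Classical.arbitrary _), fun v => by
    have := X.linearMap_vsub v (Classical.arbitrary _)
    rw [h0] at this
    simpa [sub_eq_zero] using this.symm⟩

lemma nonconst_surj {X : Aff L} (hX : Nonconst X) (z : ℂ) : ∃ v, X v = z := by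
  obtain ⟨u, hu⟩ := nonconst_linear hX
  let p : cplx L := Classical.arbitrary _
  exact ⟨((z - X p) • u) +ᵥ p, by rw [X.map_vadd]; simp [hu]⟩

/-- A point of `L_ℂ` outside of the zero loci of finitely many nonzero affine functions. -/
lemma exists_generic (A : Finset (Aff L)) : ∃ v : cplx L, ∀ a ∈ A, a ≠ 0 → a v ≠ 0 := by
  classical
  obtain ⟨π, hπ⟩ := exists_retraction L
  obtain ⟨v, hv⟩ := ent_prod_ne_zero (A.filter (· ≠ 0)) (f := fun a v => a (π v))
    (fun a _ => ent_affine (a.comp π)) (fun a ha => by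
      by_contra! h
      refine (Finset.mem_filter.mp ha).2 (AffineMap.ext fun v => ?_)
      have := h v
      rwa [hπ] at this)
  exact ⟨π v, fun a ha h => hv a (Finset.mem_filter.mpr ⟨ha, h⟩)⟩

end Affine

/-! ### Sums over reflection groups -/

variable (b : (LieAlgebra.IsKilling.rootSystem H).Base) (Q : Set H.root)

/-- The common numerator of a sum of `c`-functions over a reflection group. -/
def numer (ρ : ℂ → ℂ) (φ : H → ℂ) (u : H) : ℂ :=
  ∑ z : reflGroup Q, sgn b Q z * (∏ α ∈ fs (Q ∩ posCoroots b), (ev α (z.1 u) + 1)) *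
    (∏ α ∈ fs (posCoroots b), ρ (ev α (z.1 u))) * φ (z.1 u)

variable {b Q}

lemma ent_numer {ρ : ℂ → ℂ} (hρ : Differentiable ℂ ρ) {φ : H → ℂ} (hφ : Ent φ) :
    Ent fun p : ℂ × H => numer b Q (fun z => ρ z + p.1) φ p.2 := by
  refine ent_sum _ fun z _ => Ent.mul (Ent.mul (Ent.mul (ent_const _) (ent_prod _ fun α _ => ?_))
    (ent_prod _ fun α _ => ?_)) ?_
  · exact (ent_linear (ev α ∘ₗ z.1.toLinearMap ∘ₗ LinearMap.snd ℂ ℂ H)).add (ent_const _)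
  · exact ((ent_linear (ev α ∘ₗ z.1.toLinearMap ∘ₗ LinearMap.snd ℂ ℂ H)).of_differentiable hρ).add
      (ent_linear (LinearMap.fst ℂ ℂ H))
  · exact hφ.comp_linear (z.1.toLinearMap ∘ₗ LinearMap.snd ℂ ℂ H)

lemma ent_numer' {ρ : ℂ → ℂ} (hρ : Differentiable ℂ ρ) {φ : H → ℂ} (hφ : Ent φ) :
    Ent (numer b Q ρ φ) := by
  have := (ent_numer (b := b) (Q := Q) hρ hφ).comp_linear (LinearMap.inr ℂ ℂ H)
  simpa using this

/-- Right translation by the reflection permutes the summands and flips their signs. Antisymmetry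
forces zeros on the root hyperplanes, which is what `exists_numer_div` needs. -/
lemma numer_coreflection (hQ : ReflClosed Q) {β : H.root} (hβ : β ∈ Q) (ρ : ℂ → ℂ) (φ : H → ℂ)
    (u : H) :
    numer b Q ρ φ ((LieAlgebra.IsKilling.rootSystem H).coreflection β u) = -numer b Q ρ φ u := by
  let s : reflGroup Q := ⟨(LieAlgebra.IsKilling.rootSystem H).coreflection β,
    Subgroup.subset_closure ⟨β, hβ, rfl⟩⟩
  have hs : ∀ z : reflGroup Q, sgn b Q (z * s) = -sgn b Q z := by
    intro z
    obtain ⟨v, hv⟩ := exists_posProd_ne_zero (b := b) Q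
    have h1 := posProd_sgn (b := b) hQ (z * s) v
    have h2 : posProd b Q ((z * s).1 v) = posProd b Q (z.1 (s.1 v)) := rfl
    rw [h2, posProd_sgn hQ, posProd_coreflection hQ hβ] at h1
    have h3 : (sgn b Q (z * s) + sgn b Q z) * posProd b Q v = 0 := by linear_combination -h1
    rcases mul_eq_zero.mp h3 with h | h
    · linear_combination h
    · exact absurd h hv
  unfold numer
  rw [← Finset.sum_neg_distrib]
  refine Fintype.sum_equiv (Equiv.mulRight s) _ _ fun z => ?_
  simp only [Equiv.coe_mulRight, hs]
  have h4 : (z * s).1 u = z.1 ((LieAlgebra.IsKilling.rootSystem H).coreflection β u) := rfl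
  rw [h4]; ring

/-- The poles of a `c`-function along the root hyperplanes cancel in the sum over the reflection
group. -/
lemma exists_numer_div (hQ : ReflClosed Q) {ρ : ℂ → ℂ} (hρ : Differentiable ℂ ρ) {φ : H → ℂ}
    (hφ : Ent φ) : ∃ B : ℂ × H → ℂ, Ent B ∧
      ∀ p : ℂ × H, numer b Q (fun z => ρ z + p.1) φ p.2 = posProd b Q p.2 * B p := by
  refine exists_div_prod_of_vanish (fs (Q ∩ posCoroots b))
    (fun α => (ev α ∘ₗ LinearMap.snd ℂ ℂ H).toAffineMap) ?_ ?_ (ent_numer hρ hφ) ?_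
  · intro α _ h
    refine ev_ne_zero α (LinearMap.ext fun v => ?_)
    exact LinearMap.congr_fun h ((0 : ℂ), v)
  · intro α hα β hβ h
    simp only [mem_fs, Set.mem_inter_iff] at hα hβ
    obtain ⟨v, hv, hv'⟩ := exists_zero_ne_zero hα.2 hβ.2 h
    exact ⟨((0 : ℂ), v), hv, hv'⟩
  · rintro α hα ⟨t, v⟩ hv
    simp only [mem_fs, Set.mem_inter_iff] at hα
    have h1 := numer_coreflection (b := b) hQ hα.1 (fun z => ρ z + t) φ v
    have h5 : (LieAlgebra.IsKilling.rootSystem H).coreflection α v = v := by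
      rw [RootPairing.coreflection_apply]
      have : (LieAlgebra.IsKilling.rootSystem H).root' α v = 0 := hv
      rw [this]; simp
    rw [h5] at h1
    change numer b Q (fun z => ρ z + t) φ v = 0
    linear_combination h1 / 2

/-! ### Denominators of sums over reflection groups: the candidate multiplicity function and its
sufficiency -/

/-- `A` is the sum over `reflGroup Q` of the translates of `c_Q · r · φ`, composed with `x` and
divided by the product of the `ρ(γ)` with `γ ∈ S`. -/
def IsReflSum (b : (LieAlgebra.IsKilling.rootSystem H).Base) (Q : Set H.root) (S : Set H.root)
    (x : H ≃ₗ[ℂ] H) (A : (ℂ → ℂ) → (H → ℂ) → H → ℂ) : Prop :=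
  ∀ ρ : ℂ → ℂ, Differentiable ℂ ρ → (∀ z, ρ z = ρ (1 - z)) → ρ ≠ 0 → ∀ φ : H → ℂ, Ent φ →
    ∃ D : H → ℂ, Ent D ∧ D ≠ 0 ∧ ∀ v, D v ≠ 0 →
      (∏ γ ∈ fs S, ρ (ev γ v)) * posProd b Q (x v) * A ρ φ v = numer b Q ρ φ (x v)

variable (L : AffineSubspace ℝ H) [Nonempty L]

/-- The multiplicity function of `∏_{γ ∈ S} ρ(γ)` on `L`. -/
def dS (S : Set H.root) : AffClass L →₀ ℕ := ∑ γ ∈ fs S, clsF (res L γ)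

variable (b) in
/-- The multiplicity function of `r ∘ y` on `L`. -/
def eY (y : H ≃ₗ[ℂ] H) : AffClass L →₀ ℕ :=
  ∑ α ∈ fs (posCoroots b), clsF (rl L (ev α ∘ₗ y.toLinearMap))

variable (b Q) in
/-- `c_Q ∘ y` does not vanish identically on `L`. -/
def Surv (y : H ≃ₗ[ℂ] H) : Prop := ∀ α ∈ Q ∩ posCoroots b, ∃ v : cplx L, ev α (y v) ≠ -1

variable (b Q) in
open Classical in
/-- The multiplicity function of the denominators of a sum over `reflGroup Q`. -/
def genMult (S : Set H.root) (x : H ≃ₗ[ℂ] H) : AffClass L →₀ ℕ :=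
  (Finset.univ.filter fun z : reflGroup Q => Surv b Q L (z.1 * x)).sup
    fun z => dS L S - eY b L (z.1 * x)

variable {L}

lemma ent_and_ne_zero {M : Type*} [AddCommGroup M] [Module ℂ M] {f g : M → ℂ} (hf : Ent f)
    (hg : Ent g) (hf0 : ∃ v, f v ≠ 0) (hg0 : ∃ v, g v ≠ 0) : ∃ v, f v ≠ 0 ∧ g v ≠ 0 := by
  obtain ⟨v, hv⟩ := ent_prod_ne_zero (Finset.univ : Finset Bool) (f := fun i => if i then f else g)
    (fun i _ => by cases i <;> simp [hf, hg]) (fun i _ => by cases i <;> simpa)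
  exact ⟨v, by simpa using hv true (Finset.mem_univ _), by simpa using hv false (Finset.mem_univ _)⟩

open Classical in
/-- Clearing the denominators of a sum over a reflection group. -/
theorem genMult_clears {A : (ℂ → ℂ) → (H → ℂ) → H → ℂ} {S : Set H.root} {x : H ≃ₗ[ℂ] H}
    (hQ : ReflClosed Q) (hA : IsReflSum b Q S x A)
    (hx : ∀ α ∈ Q ∩ posCoroots b, ∃ v : cplx L, ev α (x v) ≠ 0) :
    Clears L A S (genMult b Q L S x) := by
  intro ρ hρd hρs hρ0 hcon φ hφ
  rw [isEntire_iff] at hφ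
  set m := genMult b Q L S x with hm
  obtain ⟨π, hπ⟩ := exists_retraction L
  have hts : ∀ t z, (fun z => ρ z + t) z = (fun z => ρ z + t) (1 - z) := fun t z => by
    simp only; rw [hρs]
  obtain ⟨B, hB, hNB⟩ := exists_numer_div (b := b) hQ hρd hφ
  let K := fs (Q ∩ posCoroots b)
  let κ : reflGroup Q → ℂ × H → ℂ := fun z p =>
    ∏ α ∈ fs (posCoroots b) with ¬ Nonconst (rl L (ev α ∘ₗ (z.1 * x).toLinearMap)),
      (ρ (ev α (z.1 (x (π p.2)))) + p.1)
  -- This is the cleared numerator divided by the `ρ`-part of the denominator, term by term. For a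
  -- surviving term `m + eY` dominates `dS`, so the truncated subtraction is exact; the other terms
  -- vanish on `L`.
  let X : ℂ × H → ℂ := fun p => ∑ z : reflGroup Q with Surv b Q L (z.1 * x),
    sgn b Q z * (∏ α ∈ K, (ev α (z.1 (x (π p.2))) + 1)) *
      (pw (fun w => ρ w + p.1) (m + eY b L (z.1 * x) - dS L S) (π p.2) * κ z p) *
      φ (z.1 (x (π p.2)))
  have hlin : ∀ (f : H →ₗ[ℂ] ℂ), Ent fun p : ℂ × H => f (π p.2) := fun f =>
    ent_affine ((f.toAffineMap.comp (cplx L).subtype).comp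
      (π.comp (LinearMap.snd ℂ ℂ H).toAffineMap))
  have hX : Ent X := by
    refine ent_sum _ fun z _ => Ent.mul (Ent.mul (Ent.mul (ent_const _)
      (ent_prod _ fun α _ => ?_)) (Ent.mul (ent_pw hρd π _) (ent_prod _ fun α _ => ?_))) ?_
    · exact (hlin (ev α ∘ₗ z.1.toLinearMap ∘ₗ x.toLinearMap)).add (ent_const _)
    · exact ((hlin (ev α ∘ₗ z.1.toLinearMap ∘ₗ x.toLinearMap)).of_differentiable hρd).add
        (ent_linear (LinearMap.fst ℂ ℂ H))
    · exact hφ.comp_affine ((z.1 * x).toLinearMap.toAffineMap.comp ((cplx L).subtype.comp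
        (π.comp (LinearMap.snd ℂ ℂ H).toAffineMap)))
  have hkey : ∀ p : ℂ × H, pw (fun w => ρ w + p.1) (dS L S) (π p.2) * X p =
      pw (fun w => ρ w + p.1) m (π p.2) * numer b Q (fun w => ρ w + p.1) φ (x (π p.2)) := by
    intro p
    simp only [X, numer]
    rw [Finset.mul_sum, Finset.mul_sum, Finset.sum_filter]
    refine Finset.sum_congr rfl fun z _ => ?_
    split_ifs with hz
    · have h1 : dS L S ≤ m + eY b L (z.1 * x) := by
        rw [← tsub_le_iff_right]
        exact Finset.le_sup (f := fun z : reflGroup Q => dS L S - eY b L (z.1 * x))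
          (Finset.mem_filter.mpr ⟨Finset.mem_univ z, hz⟩)
      have h2 := pw_add (fun w => ρ w + p.1) (dS L S) (m + eY b L (z.1 * x) - dS L S) (π p.2)
      rw [add_tsub_cancel_of_le h1, pw_add] at h2
      have h3 := pw_sum (fs (posCoroots b)) (fun α => rl L (ev α ∘ₗ (z.1 * x).toLinearMap))
        (hts p.1) (π p.2)
      have h4 : pw (fun w => ρ w + p.1) (eY b L (z.1 * x)) (π p.2) * κ z p =
          ∏ α ∈ fs (posCoroots b), (ρ (ev α (z.1 (x (π p.2)))) + p.1) := h3
      rw [← h4]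
      linear_combination (-sgn b Q z * (∏ α ∈ K, (ev α (z.1 (x (π p.2))) + 1)) * κ z p *
        φ (z.1 (x (π p.2)))) * h2
    · unfold Surv at hz
      push Not at hz
      obtain ⟨α, hα, hα'⟩ := hz
      have h5 : ev α (z.1 (x (π p.2))) + 1 = 0 := by
        have := hα' (π p.2)
        rw [LinearEquiv.mul_apply] at this
        rw [this]; ring
      rw [Finset.prod_eq_zero (i := α) (by simpa using hα) h5]
      ring
  let a : H.root → (ℂ × H) →ᵃ[ℂ] ℂ := fun α => ((rl L (ev α ∘ₗ x.toLinearMap)).comp π).comp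
    (LinearMap.snd ℂ ℂ H).toAffineMap
  have ha : ∀ α p, a α p = ev α (x (π p.2)) := fun α p => rfl
  have hconst : ∀ α, (a α).linear = 0 → ∀ p q, a α p = a α q := by
    intro α h p q
    have := (a α).linearMap_vsub p q
    rw [h] at this
    simpa [sub_eq_zero] using this.symm
  have hYEnt : Ent fun p : ℂ × H => (∏ α ∈ K with (a α).linear = 0, a α p) *
      (pw (fun w => ρ w + p.1) m (π p.2) * B (p.1, x (π p.2))) := by
    refine Ent.mul (ent_prod _ fun α _ => ent_affine (a α)) (Ent.mul (ent_pw hρd π m) ?_)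
    exact hB.comp_affine (AffineMap.prod (LinearMap.fst ℂ ℂ H).toAffineMap
      (x.toLinearMap.toAffineMap.comp ((cplx L).subtype.comp
        (π.comp (LinearMap.snd ℂ ℂ H).toAffineMap))))
  have hsplit : ∀ p, posProd b Q (x (π p.2)) =
      (∏ α ∈ K with (a α).linear ≠ 0, a α p) * ∏ α ∈ K with (a α).linear = 0, a α p := by
    intro p
    have := Finset.prod_filter_mul_prod_filter_not K (fun α => (a α).linear = 0) (fun α => a α p)
    rw [mul_comm] at this
    exact this.symm
  -- Next come the poles along root hyperplanes that meet `L` properly. The `ρ`-part may vanish on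
  -- such a hyperplane if `ρ` has a zero at a constant value taken there; a generic deformation
  -- parameter `t` avoids this.
  obtain ⟨Z, hZ, hXZ⟩ := exists_div_prod (K.filter fun α => (a α).linear ≠ 0) a
    (fun α hα => (Finset.mem_filter.mp hα).2) (ent_pw hρd π (dS L S)) (by
      intro α hα
      have hα2 := (Finset.mem_filter.mp hα).2
      obtain ⟨u, hu⟩ : ∃ u, (a α).linear u ≠ 0 := by
        by_contra! h
        exact hα2 (LinearMap.ext h)
      let p : ℂ × H := -(a α 0 / (a α).linear u) • u
      have hp : a α p = 0 := by
        have := (a α).map_vadd 0 p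
        simp only [vadd_eq_add, add_zero] at this
        rw [this]
        simp only [p, neg_smul, map_neg, map_smul, smul_eq_mul]
        field_simp
        ring
      obtain ⟨t, ht⟩ := Infinite.exists_notMem_finset
        ((dS L S).support.image fun ν => -ρ (ν.out.1 (π p.2)))
      refine ⟨(t, p.2), hp, ?_⟩
      refine Finset.prod_ne_zero_iff.mpr fun ν hν => pow_ne_zero _ fun h => ht ?_
      exact Finset.mem_image.mpr ⟨ν, hν, by simp only at h; linear_combination -h⟩)
    hX hYEnt (fun p => by
      rw [hkey, hNB (p.1, x (π p.2))]
      change _ * (posProd b Q (x (π p.2)) * _) = _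
      rw [hsplit p]
      ring)
  let v₀ : L := Classical.arbitrary L
  have hv₀ : (v₀ : H) ∈ cplx L := subset_affineSpan ℂ _ v₀.2
  let w₀ : cplx L := ⟨v₀, hv₀⟩
  -- The condition on the values in `con L S` enters only here: it keeps the constant part of the
  -- denominator nonzero.
  have hSc : ∀ γ ∈ S, ¬ Nonconst (res L γ) → ρ (ev γ v₀) ≠ 0 := by
    intro γ hγ h
    unfold Nonconst at h
    push Not at h
    obtain ⟨z, hz⟩ := h
    refine hcon _ ⟨γ, ⟨⟨z, fun v hv => hz ⟨v, subset_affineSpan ℂ _ hv⟩⟩, hγ⟩, v₀, v₀.2, Or.inl rfl⟩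
  have hSv : ∀ γ, ¬ Nonconst (res L γ) → ∀ v : cplx L, ev γ v = ev γ v₀ := by
    intro γ h v
    unfold Nonconst at h
    push Not at h
    obtain ⟨z, hz⟩ := h
    exact (hz v).trans (hz w₀).symm
  let c₁ : ℂ := ∏ γ ∈ fs S with ¬ Nonconst (res L γ), ρ (ev γ v₀)
  have hc₁ : c₁ ≠ 0 := Finset.prod_ne_zero_iff.mpr fun γ hγ => by
    simp only [Finset.mem_filter, mem_fs] at hγ
    exact hSc γ hγ.1 hγ.2
  let c₂ : ℂ := ∏ α ∈ K with (a α).linear = 0, a α 0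
  have hc₂ : c₂ ≠ 0 := Finset.prod_ne_zero_iff.mpr fun α hα => by
    simp only [Finset.mem_filter, K, mem_fs] at hα
    obtain ⟨v, hv⟩ := hx α hα.1
    rw [hconst α hα.2 0 (0, (v : H)), ha]
    simpa [hπ] using hv
  have hrS : ∀ v : cplx L, ∏ γ ∈ fs S, ρ (ev γ v) = pw ρ (dS L S) v * c₁ := by
    intro v
    refine (pw_sum (fs S) (fun γ => res L γ) hρs v).symm.trans ?_
    rw [dS]
    congr 1
    refine Finset.prod_congr rfl fun γ hγ => ?_
    rw [res_apply, hSv γ (Finset.mem_filter.mp hγ).2]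
  obtain ⟨D, hD, hD0, hDA⟩ := hA ρ hρd hρs hρ0 φ hφ
  have hrEnt : Ent fun v : H => ∏ γ ∈ fs S, ρ (ev γ v) :=
    ent_prod _ fun γ _ => (ent_linear (ev γ)).of_differentiable hρd
  have hpEnt : Ent fun v : H => posProd b Q (x v) := (ent_posProd Q).comp_linear x.toLinearMap
  -- The deformation parameter is specialized to `0`. The constants `c₁` and `c₂` are the factors of
  -- the denominator that do not vary on `L`.
  refine ⟨fun v => numer b Q ρ φ (x v), fun v => (∏ γ ∈ fs S, ρ (ev γ v)) * posProd b Q (x v),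
    fun v => Z (0, v) * (c₁ * c₂)⁻¹, ?_, ?_, ?_, ⟨D, ?_, hD0, hDA⟩, ?_, ?_⟩
  · exact isEntire_iff.mpr ((ent_numer' hρd hφ).comp_linear x.toLinearMap)
  · exact isEntire_iff.mpr (hrEnt.mul hpEnt)
  · refine isEntire_iff.mpr ((?_ : Ent _).mul (ent_const _))
    exact hZ.comp_linear (LinearMap.inr ℂ ℂ H)
  · exact isEntire_iff.mpr hD
  · have hr0 : ∃ v : H, (∏ γ ∈ fs S, ρ (ev γ (π v))) ≠ 0 := by
      obtain ⟨v, hv⟩ := ent_prod_ne_zero (fs S) (f := fun γ v => ρ (ev γ (π v)))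
        (fun γ _ => (ent_affine ((res L γ).comp π)).of_differentiable hρd) (fun γ hγ => by
          by_cases h : Nonconst (res L γ)
          · obtain ⟨z, hz⟩ : ∃ z, ρ z ≠ 0 := by
              by_contra! h0
              exact hρ0 (funext h0)
            obtain ⟨v, hv⟩ := nonconst_surj h z
            refine ⟨v, ?_⟩
            rw [hπ, ← res_apply, hv]
            exact hz
          · refine ⟨v₀, ?_⟩
            rw [hSv γ h]
            exact hSc γ (by simpa using hγ) h)
      exact ⟨v, Finset.prod_ne_zero_iff.mpr hv⟩
    have hp0 : ∃ v : H, posProd b Q (x (π v)) ≠ 0 := by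
      obtain ⟨v, hv⟩ := ent_prod_ne_zero K (f := fun α v => ev α (x (π v)))
        (fun α _ => ent_affine ((rl L (ev α ∘ₗ x.toLinearMap)).comp π)) (fun α hα => by
          obtain ⟨v, hv⟩ := hx α (by simpa [K] using hα)
          exact ⟨v, by rwa [hπ]⟩)
      exact ⟨v, Finset.prod_ne_zero_iff.mpr hv⟩
    obtain ⟨v, hv, hv'⟩ := ent_and_ne_zero (hrEnt.comp_affine ((cplx L).subtype.comp π))
      (hpEnt.comp_affine ((cplx L).subtype.comp π)) hr0 hp0
    exact ⟨π v, mul_ne_zero hv hv'⟩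
  · intro v
    have h1 := hkey (0, v)
    have h2 := hXZ (0, v)
    have h3 := hsplit (0, v)
    have h4 : ∏ α ∈ K with (a α).linear = 0, a α ((0 : ℂ), (v : H)) = c₂ :=
      Finset.prod_congr rfl fun α hα => hconst α (Finset.mem_filter.mp hα).2 _ _
    rw [h4] at h3
    simp only [hπ, add_zero] at h1 h3
    change _ = pw ρ m v * _
    rw [← h1, h2]
    simp only [hrS, h3]
    field_simp

end

section

variable {𝔤 : Type*} [LieRing 𝔤] [LieAlgebra ℂ 𝔤] [FiniteDimensional ℂ 𝔤]
  [LieAlgebra.IsKilling ℂ 𝔤] {H : LieSubalgebra ℂ 𝔤} [H.IsCartanSubalgebra]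

/-! ### Orders of vanishing along a line -/

/-- `f(s) = s^k h(s)` with `h` continuous and `h(0) ≠ 0`. -/
def HasOrd (f : ℂ → ℂ) (k : ℕ) : Prop :=
  ∃ h : ℂ → ℂ, Continuous h ∧ h 0 ≠ 0 ∧ ∀ s, f s = s ^ k * h s

lemma HasOrd.mul {f g : ℂ → ℂ} {k l : ℕ} (hf : HasOrd f k) (hg : HasOrd g l) :
    HasOrd (fun s => f s * g s) (k + l) := by
  obtain ⟨h, hc, h0, he⟩ := hf
  obtain ⟨h', hc', h0', he'⟩ := hg
  exact ⟨fun s => h s * h' s, hc.mul hc', mul_ne_zero h0 h0', fun s => by simp only [he, he']; ring⟩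

lemma HasOrd.pow {f : ℂ → ℂ} {k : ℕ} (hf : HasOrd f k) (n : ℕ) :
    HasOrd (fun s => f s ^ n) (k * n) := by
  obtain ⟨h, hc, h0, he⟩ := hf
  exact ⟨fun s => h s ^ n, hc.pow n, pow_ne_zero _ h0, fun s => by simp only [he]; ring⟩

lemma hasOrd_zero {f : ℂ → ℂ} (hf : Continuous f) (h : f 0 ≠ 0) : HasOrd f 0 :=
  ⟨f, hf, h, fun s => by simp⟩

lemma hasOrd_prod {ι : Type*} (t : Finset ι) {f : ι → ℂ → ℂ} {k : ι → ℕ}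
    (h : ∀ i ∈ t, HasOrd (f i) (k i)) : HasOrd (fun s => ∏ i ∈ t, f i s) (∑ i ∈ t, k i) := by
  classical
  induction t using Finset.induction_on with
  | empty => simpa using hasOrd_zero (f := fun _ => 1) continuous_const one_ne_zero
  | insert i t hi ih =>
    simp only [Finset.prod_insert hi, Finset.sum_insert hi]
    exact (h i (Finset.mem_insert_self _ _)).mul (ih fun j hj => h j (Finset.mem_insert_of_mem hj))

lemma HasOrd.le {f : ℂ → ℂ} {k d : ℕ} (hf : HasOrd f k) {c : ℂ → ℂ} (hc : Continuous c)
    (h : ∀ s, f s = s ^ d * c s) : d ≤ k := by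
  obtain ⟨g, hg, hg0, he⟩ := hf
  by_contra! hlt
  obtain ⟨j, rfl⟩ := Nat.exists_eq_add_of_lt hlt
  have h1 : ∀ s, s ≠ 0 → g s = s ^ (j + 1) * c s := by
    intro s hs
    have := he s
    rw [h] at this
    have h2 : s ^ k * (g s - s ^ (j + 1) * c s) = 0 := by
      linear_combination -this
    rcases mul_eq_zero.mp h2 with h3 | h3
    · exact absurd h3 (pow_ne_zero _ hs)
    · linear_combination h3
  have h4 : g = fun s => s ^ (j + 1) * c s :=
    Continuous.ext_on (dense_compl_singleton (0 : ℂ)) hg (by fun_prop) fun s hs => h1 s hs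
  exact hg0 (by rw [h4]; simp)

variable {L : AffineSubspace ℝ H} [Nonempty L]

lemma clsF_apply {X : Aff L} (hX : Nonconst X) {ν : AffClass L} :
    clsF X ν = 1 ∧ (X = ν.out.1 ∨ X = cst L 1 - ν.out.1) ∨
    clsF X ν = 0 ∧ ¬ (X = ν.out.1 ∨ X = cst L 1 - ν.out.1) := by
  classical
  have key : Quotient.mk (affSetoid L) ⟨X, hX⟩ = ν ↔ (X = ν.out.1 ∨ X = cst L 1 - ν.out.1) := by
    constructor
    · rintro rfl
      exact out_eq ⟨X, hX⟩
    · intro h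
      rw [← Quotient.out_eq ν]
      exact (Quotient.sound (s := affSetoid L) (a := ν.out) (b := ⟨X, hX⟩) h).symm
  rw [clsF, dif_pos hX]
  by_cases h : Quotient.mk (affSetoid L) ⟨X, hX⟩ = ν
  · exact Or.inl ⟨by rw [h, Finsupp.single_eq_same], key.mp h⟩
  · refine Or.inr ⟨?_, fun h' => h (key.mpr h')⟩
    rw [Finsupp.single_apply, if_neg h]

variable {b : (LieAlgebra.IsKilling.rootSystem H).Base} {Q : Set H.root}

/-! ### Necessity: isolating one term and one class of affine functions -/

open Classical in
/-- The multiplicity function `genMult` is a lower bound for the functions that clear the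
denominators. -/
theorem genMult_le {A : (ℂ → ℂ) → (H → ℂ) → H → ℂ} {S : Set H.root} {x : H ≃ₗ[ℂ] H}
    (hQ : ReflClosed Q) (hA : IsReflSum b Q S x A)
    (hx : ∀ α ∈ Q ∩ posCoroots b, ∃ v : cplx L, ev α (x v) ≠ 0)
    {n : AffClass L →₀ ℕ} (hn : Clears L A S n) : genMult b Q L S x ≤ n := by
  refine Finset.sup_le fun z hz => ?_
  rw [tsub_le_iff_right]
  intro ν
  have hsurv : Surv b Q L (z.1 * x) := (Finset.mem_filter.mp hz).2
  obtain ⟨π, hπ⟩ := exists_retraction L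
  set Y := ν.out.1 with hYdef
  have hY : Nonconst Y := ν.out.2
  -- The terms of these elements will be suppressed by `φ`. All other elements act on `L` as `z`
  -- does and contribute equal terms, so they cannot cancel each other.
  let bad : Finset (reflGroup Q) := Finset.univ.filter fun z' => ∃ v : cplx L, z'.1 (x v) ≠ z.1 (x v)
  have hf : ∀ z' : reflGroup Q, ∃ f : Dual ℂ H, z' ∈ bad →
      ∃ v : cplx L, f (z'.1 (x v)) ≠ f (z.1 (x v)) := by
    intro z'
    by_cases h : z' ∈ bad
    · obtain ⟨v, hv⟩ := (Finset.mem_filter.mp h).2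
      by_contra! hc
      refine hv (sub_eq_zero.mp ((Module.forall_dual_apply_eq_zero_iff ℂ _).mp fun f => ?_))
      rw [map_sub, (hc f).2 v, sub_self]
    · exact ⟨0, fun h' => absurd h' h⟩
  choose f hf using hf
  let 𝒳 : Finset (Aff L) := (fs S).image (fun γ => res L γ) ∪
    ((fs (posCoroots b)).image (fun α => rl L (ev α ∘ₗ (z.1 * x).toLinearMap)) ∪
      n.support.image fun ν => ν.out.1)
  -- Genericity of `p` means: only members of the class of `Y` take the value `Y p` or `1 - Y p`,
  -- these two values differ, the numerator of the surviving `c`-function is nonzero, and the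
  -- functionals `f z'` separate the translates.
  obtain ⟨p, hp⟩ := exists_generic (L := L)
    (𝒳.image (fun X => X - Y) ∪ 𝒳.image (fun X => X - (cst L 1 - Y)) ∪ {Y - (cst L 1 - Y)} ∪
      (fs (Q ∩ posCoroots b)).image (fun α => rl L (ev α ∘ₗ (z.1 * x).toLinearMap) + cst L 1) ∪
      bad.image fun z' => rl L (f z' ∘ₗ (z'.1 * x).toLinearMap) -
        rl L (f z' ∘ₗ (z.1 * x).toLinearMap))
  simp only [Finset.mem_union, Finset.mem_singleton] at hp
  have hp1 : ∀ X ∈ 𝒳, X ≠ Y → X p ≠ Y p := fun X hX h => by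
    have := hp (X - Y) (Or.inl (Or.inl (Or.inl (Or.inl (Finset.mem_image.mpr ⟨X, hX, rfl⟩)))))
      (sub_ne_zero.mpr h)
    simpa [sub_eq_zero] using this
  have hp2 : ∀ X ∈ 𝒳, X ≠ cst L 1 - Y → X p ≠ 1 - Y p := fun X hX h => by
    have := hp (X - (cst L 1 - Y)) (Or.inl (Or.inl (Or.inl (Or.inr (Finset.mem_image.mpr ⟨X, hX, rfl⟩)))))
      (sub_ne_zero.mpr h)
    intro h'
    apply this
    simp [h']
  have hp3 : Y p ≠ 1 - Y p := by
    have := hp _ (Or.inl (Or.inl (Or.inr rfl))) (fun h => hY ⟨1 / 2, fun v => by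
      have := congrArg (fun X : Aff L => X v) h
      simp at this
      linear_combination this / 2⟩)
    intro h'
    apply this
    simp [← h']
  have hp4 : ∀ α ∈ Q ∩ posCoroots b, ev α (z.1 (x p)) + 1 ≠ 0 := by
    intro α hα
    refine hp _ (Or.inl (Or.inr (Finset.mem_image.mpr ⟨α, by simpa using hα, rfl⟩))) fun h => ?_
    obtain ⟨v, hv⟩ := hsurv α hα
    apply hv
    have := congrArg (fun X : Aff L => X v) h
    simp at this
    exact eq_neg_of_add_eq_zero_left this
  have hp5 : ∀ z' ∈ bad, f z' (z'.1 (x p)) ≠ f z' (z.1 (x p)) := by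
    intro z' hz'
    obtain ⟨v, hv⟩ := hf z' hz'
    have := hp _ (Or.inr (Finset.mem_image.mpr ⟨z', hz', rfl⟩)) fun h => by
      have := congrArg (fun X : Aff L => X v) h
      simp [sub_eq_zero] at this
      exact hv this
    simpa [sub_eq_zero] using this
  obtain ⟨u, hu⟩ := nonconst_linear hY
  set z₀ := Y p with hz₀
  -- This quadratic is the simplest symmetric function vanishing at `Y p`. Its two zeros are
  -- distinct, so among the affine functions in play exactly those in the class `ν` produce a zero
  -- at `p`, and it is simple along the line in direction `u`.
  let ρ : ℂ → ℂ := fun w => (w - z₀) * (1 - z₀ - w)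
  have hρd : Differentiable ℂ ρ := by fun_prop
  have hρs : ∀ w, ρ w = ρ (1 - w) := fun w => by simp only [ρ]; ring
  have hρne : ∀ w, w ≠ z₀ → w ≠ 1 - z₀ → ρ w ≠ 0 := fun w h1 h2 =>
    mul_ne_zero (sub_ne_zero.mpr h1) (sub_ne_zero.mpr (Ne.symm h2))
  have hρ0 : ρ ≠ 0 := by
    obtain ⟨w, hw⟩ := Infinite.exists_notMem_finset ({z₀, 1 - z₀} : Finset ℂ)
    simp only [Finset.mem_insert, Finset.mem_singleton, not_or] at hw
    exact fun h => hρne w hw.1 hw.2 (congrFun h w)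
  -- The exponent is the full order of the denominator at `ν`: near `p` the bad terms become
  -- divisible by `s ^ dS L S ν`, while `φ` stays nonzero at the translate by `z`.
  let φ : H → ℂ := fun w => ∏ z' ∈ bad, (f z' w - f z' (z'.1 (x p))) ^ (dS L S ν)
  have hφ : Ent φ := ent_prod _ fun z' _ => ((ent_linear (f z')).sub (ent_const _)).pow _
  have hρcon : ∀ w ∈ con L S, ρ w ≠ 0 := by
    rintro w ⟨γ, ⟨⟨t, ht⟩, hγS⟩, v, hv, hw⟩
    have hρv : ρ (ev γ v) ≠ 0 := by
      have hle : (cplx L : Set H) ⊆ {v : H | ev γ v = t} := by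
        intro u hu
        have h1 : affineSpan ℂ (L : Set H) ≤
            (AffineSubspace.comap (ev γ).toAffineMap (AffineSubspace.mk' t ⊥)) := by
          rw [affineSpan_le]
          intro v hv
          simp [ht v hv]
        have h2 := h1 hu
        simpa [sub_eq_zero] using h2
      have hc : ¬ Nonconst (res L γ) := fun h => h ⟨t, fun v => hle v.2⟩
      have hX : res L γ ∈ 𝒳 := by
        refine Finset.mem_union_left _ (Finset.mem_image.mpr ⟨γ, by simpa using hγS, rfl⟩)
      have hvp : ev γ v = res L γ p := by
        rw [ht v hv, res_apply]
        exact (hle p.2).symm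
      rw [hvp]
      refine hρne _ (hp1 _ hX fun h => hc (h ▸ hY)) (hp2 _ hX fun h => hc ?_)
      rintro ⟨s, hs⟩
      refine hY ⟨1 - s, fun v => ?_⟩
      have := hs v
      rw [h] at this
      simp at this
      linear_combination -this
    rcases hw with rfl | rfl
    · exact hρv
    · rwa [← hρs]
  obtain ⟨g, q, F, hg, hq, hF, ⟨D, hD, hD0, hDq⟩, ⟨v₁, hv₁⟩, hFq⟩ :=
    hn ρ hρd hρs hρ0 hρcon φ (isEntire_iff.mpr hφ)
  rw [isEntire_iff] at hg hq hF hD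
  obtain ⟨D', hD', hD'0, hDA⟩ := hA ρ hρd hρs hρ0 φ hφ
  have hrEnt : Ent fun v : H => ∏ γ ∈ fs S, ρ (ev γ v) :=
    ent_prod _ fun γ _ => (ent_linear (ev γ)).of_differentiable hρd
  have hpEnt : Ent fun v : H => posProd b Q (x v) := (ent_posProd Q).comp_linear x.toLinearMap
  have hNEnt : Ent fun v : H => numer b Q ρ φ (x v) := (ent_numer' hρd hφ).comp_linear x.toLinearMap
  -- Two presentations of the meromorphic function `A ρ φ` are compared off the zeros of `D` and
  -- `D'`; the identity principle removes the exception.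
  have hid : ∀ v : H, q v * numer b Q ρ φ (x v) -
      (∏ γ ∈ fs S, ρ (ev γ v)) * posProd b Q (x v) * g v = 0 := by
    intro v
    obtain ⟨w, hw, hw'⟩ := ent_and_ne_zero hD hD' (Function.ne_iff.mp hD0) (Function.ne_iff.mp hD'0)
    refine (hD.mul hD').eq_zero_of_mul (g := fun v => q v * numer b Q ρ φ (x v) -
      (∏ γ ∈ fs S, ρ (ev γ v)) * posProd b Q (x v) * g v) ((hq.mul hNEnt).sub
        ((hrEnt.mul hpEnt).mul hg)) (mul_ne_zero hw hw') fun s => ?_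
    set y := w + s • (v - w)
    by_cases h : D y = 0
    · simp [h]
    by_cases h' : D' y = 0
    · simp [h']
    rw [← hDq y h, ← hDA y h']; ring
  -- On `L` the factor `q` does not vanish identically and is cancelled by the same principle.
  have hidL : ∀ v : cplx L, pw ρ n v * numer b Q ρ φ (x v) =
      (∏ γ ∈ fs S, ρ (ev γ v)) * posProd b Q (x v) * F v := by
    intro v
    have hpw : Ent fun v => pw ρ n (π v) := by
      simpa using (ent_pw hρd π n).comp_linear (LinearMap.inr ℂ ℂ H)
    have := (hq.comp_affine ((cplx L).subtype.comp π)).eq_zero_of_mul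
      (g := fun v => pw ρ n (π v) * numer b Q ρ φ (x (π v)) -
        (∏ γ ∈ fs S, ρ (ev γ (π v))) * posProd b Q (x (π v)) * F (π v))
      ((hpw.mul (hNEnt.comp_affine ((cplx L).subtype.comp π))).sub
        (((hrEnt.mul hpEnt).mul hF).comp_affine ((cplx L).subtype.comp π)))
      (a := (v₁ : H)) (b := (v : H)) (by simpa [hπ] using hv₁) (fun s => by
        set y := π ((v₁ : H) + s • ((v : H) - v₁))
        change q y * _ = 0
        have h1 := hid y
        have h2 := hFq y
        change F y * q y = pw ρ n y * g y at h2
        linear_combination (pw ρ n y) * h1 -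
          (∏ γ ∈ fs S, ρ (ev γ y)) * posProd b Q (x y) * h2)
    simp only [hπ] at this
    exact sub_eq_zero.mp this
  let l : ℂ → cplx L := fun s => (s • u) +ᵥ p
  have hl : ∀ s, ((l s : cplx L) : H) = (p : H) + s • (u : H) := fun s => by
    simp [l, add_comm]
  have hl0 : l 0 = p := by simp [l]
  have hXl : ∀ (X : Aff L) s, X (l s) = X p + s * X.linear u := fun X s => by
    simp only [l, AffineMap.map_vadd, map_smul, smul_eq_mul, vadd_eq_add]; ring
  have hord : ∀ X ∈ 𝒳, HasOrd (fun s => ρ (X (l s))) (clsF X ν) := by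
    intro X hX
    have hYord : HasOrd (fun s => ρ (Y (l s))) 1 := by
      refine ⟨fun s => 1 - 2 * z₀ - s, by fun_prop, fun h => hp3 ?_, fun s => ?_⟩
      · simp only at h; linear_combination -h
      · simp only [hXl, hu, ρ]; rw [← hz₀]; ring
    have hcont : Continuous fun s => ρ (X (l s)) := by
      simp only [hXl, ρ]; fun_prop
    by_cases hXn : Nonconst X
    · rcases clsF_apply hXn (ν := ν) with ⟨h1, h2 | h2⟩ | ⟨h1, h2⟩
      · rw [h1, h2]; exact hYord
      · rw [h1]
        have : (fun s => ρ (X (l s))) = fun s => ρ (Y (l s)) := by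
          funext s
          rw [hρs (Y (l s)), h2]
          simp [Y]
        rw [this]; exact hYord
      · rw [h1]
        push Not at h2
        refine hasOrd_zero hcont ?_
        rw [hl0]
        exact hρne _ (hp1 X hX h2.1) (hp2 X hX h2.2)
    · rw [clsF, dif_neg hXn]
      refine hasOrd_zero hcont ?_
      rw [hl0]
      refine hρne _ (hp1 _ hX fun h => hXn (h ▸ hY)) (hp2 _ hX fun h => hXn ?_)
      rintro ⟨s, hs⟩
      refine hY ⟨1 - s, fun v => ?_⟩
      have := hs v
      rw [h] at this
      simp at this
      linear_combination -this
  have hordS : HasOrd (fun s => ∏ γ ∈ fs S, ρ (ev γ (l s))) (dS L S ν) := by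
    rw [dS, Finsupp.finsetSum_apply]
    exact hasOrd_prod _ fun γ hγ => hord (res L γ)
      (Finset.mem_union_left _ (Finset.mem_image_of_mem _ hγ))
  have horde : HasOrd (fun s => ∏ α ∈ fs (posCoroots b), ρ (ev α (z.1 (x (l s)))))
      (eY b L (z.1 * x) ν) := by
    rw [eY, Finsupp.finsetSum_apply]
    exact hasOrd_prod _ fun α hα => hord (rl L (ev α ∘ₗ (z.1 * x).toLinearMap))
      (Finset.mem_union_right _ (Finset.mem_union_left _
        (Finset.mem_image_of_mem (fun α => rl L (ev α ∘ₗ (z.1 * x).toLinearMap)) hα)))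
  have hordn : HasOrd (fun s => pw ρ n (l s)) (n ν) := by
    have h1 : n ν = ∑ ν' ∈ n.support, clsF ν'.out.1 ν * n ν' := by
      have h2 : ∀ ν' : AffClass L, clsF ν'.out.1 = Finsupp.single ν' 1 := fun ν' => by
        rw [clsF, dif_pos ν'.out.2]
        congr 1
        exact Quotient.out_eq ν'
      simp only [h2, Finsupp.single_apply, ite_mul, one_mul, zero_mul]
      rw [Finset.sum_ite_eq']
      split_ifs with h
      · rfl
      · simpa using h
    rw [h1]
    exact hasOrd_prod _ fun ν' hν' => (hord ν'.out.1 (Finset.mem_union_right _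
      (Finset.mem_union_right _ (Finset.mem_image.mpr ⟨ν', hν', rfl⟩)))).pow _
  have hcl : ∀ {G : H → ℂ}, Ent G → Continuous fun s => G (l s) := fun {G} hG => by
    simp only [hl]
    exact (hG.line (p : H) u).continuous
  let term : reflGroup Q → ℂ → ℂ := fun z' s =>
    sgn b Q z' * (∏ α ∈ fs (Q ∩ posCoroots b), (ev α (z'.1 (x (l s))) + 1)) *
      (∏ α ∈ fs (posCoroots b), ρ (ev α (z'.1 (x (l s))))) * φ (z'.1 (x (l s)))
  have hterm : HasOrd (term z) (eY b L (z.1 * x) ν) := by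
    have h1 : HasOrd (fun s => sgn b Q z * ∏ α ∈ fs (Q ∩ posCoroots b), (ev α (z.1 (x (l s))) + 1)) 0 := by
      refine hasOrd_zero ?_ ?_
      · exact hcl ((ent_const (sgn b Q z)).mul (ent_prod (fs (Q ∩ posCoroots b)) fun α _ =>
          (ent_linear (ev α ∘ₗ z.1.toLinearMap ∘ₗ x.toLinearMap)).add (ent_const 1)))
      · refine mul_ne_zero ?_ (Finset.prod_ne_zero_iff.mpr fun α hα => ?_)
        · rcases sgn_eq (b := b) Q z with h | h <;> rw [h] <;> norm_num
        · rw [hl0]; exact hp4 α (by simpa using hα)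
    have h2 : HasOrd (fun s => φ (z.1 (x (l s)))) 0 := by
      refine hasOrd_zero ?_ ?_
      · exact hcl (hφ.comp_linear (z.1.toLinearMap ∘ₗ x.toLinearMap))
      · rw [hl0]
        exact Finset.prod_ne_zero_iff.mpr fun z' hz' =>
          pow_ne_zero _ (sub_ne_zero.mpr (hp5 z' hz').symm)
    simpa using (h1.mul horde).mul h2
  have hgood : ∀ z' ∉ bad, ∀ s, term z' s = term z s := by
    intro z' hz'
    have heq : ∀ v : cplx L, z'.1 (x v) = z.1 (x v) := by
      intro v
      by_contra hv
      exact hz' (Finset.mem_filter.mpr ⟨Finset.mem_univ _, v, hv⟩)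
    -- The sign is read off from `posProd`, which does not vanish identically on the image of `L`
    -- under `x`. Equality of signs excludes cancellation between the good terms.
    have hsg : sgn b Q z' = sgn b Q z := by
      obtain ⟨v, hv⟩ := ent_prod_ne_zero (fs (Q ∩ posCoroots b)) (f := fun α v => ev α (x (π v)))
        (fun α _ => ent_affine ((rl L (ev α ∘ₗ x.toLinearMap)).comp π)) (fun α hα => by
          obtain ⟨v, hv⟩ := hx α (by simpa using hα)
          exact ⟨v, by rwa [hπ]⟩)
      have h0 : posProd b Q (x (π v)) ≠ 0 := Finset.prod_ne_zero_iff.mpr hv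
      have h1 := posProd_sgn (b := b) hQ z' (x (π v))
      rw [heq, posProd_sgn hQ] at h1
      exact (mul_right_cancel₀ h0 h1).symm
    intro s
    simp only [term, heq, hsg]
  have hbad : ∀ z', ∃ c : ℂ → ℂ, Continuous c ∧ (z' ∈ bad → ∀ s, term z' s = s ^ dS L S ν * c s) := by
    intro z'
    by_cases hz' : z' ∈ bad
    swap
    · exact ⟨0, continuous_const, fun h => absurd h hz'⟩
    refine ⟨fun s => (sgn b Q z' * (∏ α ∈ fs (Q ∩ posCoroots b), (ev α (z'.1 (x (l s))) + 1)) *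
      (∏ α ∈ fs (posCoroots b), ρ (ev α (z'.1 (x (l s)))))) * (f z' (z'.1 (x u)) ^ dS L S ν *
        ∏ w ∈ bad.erase z', (f w (z'.1 (x (l s))) - f w (w.1 (x p))) ^ (dS L S ν)),
        hcl (G := fun v => (sgn b Q z' * (∏ α ∈ fs (Q ∩ posCoroots b), (ev α (z'.1 (x v)) + 1)) *
      (∏ α ∈ fs (posCoroots b), ρ (ev α (z'.1 (x v))))) * (f z' (z'.1 (x u)) ^ dS L S ν *
        ∏ w ∈ bad.erase z', (f w (z'.1 (x v)) - f w (w.1 (x p))) ^ (dS L S ν))) ?_, fun _ s => ?_⟩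
    · refine Ent.mul (Ent.mul (Ent.mul (ent_const _) (ent_prod _ fun α _ => ?_))
        (ent_prod _ fun α _ => ?_)) (Ent.mul (ent_const _) (ent_prod _ fun w _ => ?_))
      · exact (ent_linear (ev α ∘ₗ z'.1.toLinearMap ∘ₗ x.toLinearMap)).add (ent_const 1)
      · exact (ent_linear (ev α ∘ₗ z'.1.toLinearMap ∘ₗ x.toLinearMap)).of_differentiable hρd
      · exact ((ent_linear (f w ∘ₗ z'.1.toLinearMap ∘ₗ x.toLinearMap)).sub (ent_const _)).pow _
    · have h1 : φ (z'.1 (x (l s))) = (s * f z' (z'.1 (x u))) ^ dS L S ν *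
          ∏ w ∈ bad.erase z', (f w (z'.1 (x (l s))) - f w (w.1 (x p))) ^ (dS L S ν) := by
        simp only [φ]
        rw [← Finset.mul_prod_erase _ _ hz']
        congr 2
        rw [hl]; simp
      simp only [term]
      rw [h1, mul_pow]; ring
  choose c hc hbad using hbad
  have hcard : ((Finset.univ \ bad : Finset (reflGroup Q)).card : ℂ) ≠ 0 := by
    rw [Nat.cast_ne_zero, Finset.card_ne_zero]
    exact ⟨z, by simp [bad]⟩
  have hnum : ∀ s, numer b Q ρ φ (x (l s)) =
      ((Finset.univ \ bad : Finset (reflGroup Q)).card : ℂ) * term z s +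
        s ^ dS L S ν * ∑ z' ∈ bad, c z' s := by
    intro s
    change ∑ z', term z' s = _
    rw [← Finset.sum_sdiff (Finset.subset_univ bad), Finset.sum_congr rfl (fun z' hz' =>
      hgood z' (Finset.mem_sdiff.mp hz').2 s), Finset.sum_const, nsmul_eq_mul,
      Finset.sum_congr rfl (fun z' hz' => hbad z' hz' s), Finset.mul_sum]
  obtain ⟨hS, hSc, -, hSe⟩ := hordS
  have hfin : HasOrd (fun s => pw ρ n (l s) *
      (((Finset.univ \ bad : Finset (reflGroup Q)).card : ℂ) * term z s))
      (n ν + (0 + eY b L (z.1 * x) ν)) :=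
    hordn.mul ((hasOrd_zero continuous_const hcard).mul hterm)
  obtain ⟨hn', hnc, -, hne⟩ := hordn
  have hpwc : Continuous fun s => pw ρ n (l s) := by
    simp only [hne]; fun_prop
  rw [Finsupp.add_apply, ← zero_add (eY b L (z.1 * x) ν)]
  -- The good terms have exact order `n ν + eY ν` at `s = 0`, while everything else in the identity
  -- is divisible by `s ^ dS ν`; comparing orders gives the bound.
  refine hfin.le (c := fun s => hS s * posProd b Q (x (l s)) * F (l s) -
    pw ρ n (l s) * ∑ z' ∈ bad, c z' s) ?_ fun s => ?_
  · exact ((hSc.mul (hcl hpEnt)).mul (hcl hF)).sub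
      (hpwc.mul (continuous_finsetSum _ fun z' _ => hc z'))
  · have h1 := hidL (l s)
    have h2 := hSe s
    simp only at h2
    rw [hnum, h2] at h1
    linear_combination h1

/-- The multiplicity function of the denominators of a sum over a reflection group. -/
theorem isDenMult_genMult {A : (ℂ → ℂ) → (H → ℂ) → H → ℂ} {S : Set H.root} {x : H ≃ₗ[ℂ] H}
    (hQ : ReflClosed Q) (hA : IsReflSum b Q S x A)
    (hx : ∀ α ∈ Q ∩ posCoroots b, ∃ v : cplx L, ev α (x v) ≠ 0) :
    IsDenMult L A S (genMult b Q L S x) :=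
  ⟨genMult_clears hQ hA hx, fun _ hn => genMult_le hQ hA hx hn⟩

end

section

variable {𝔤 : Type*} [LieRing 𝔤] [LieAlgebra ℂ 𝔤] [FiniteDimensional ℂ 𝔤]
  [LieAlgebra.IsKilling ℂ 𝔤] {H : LieSubalgebra ℂ 𝔤} [H.IsCartanSubalgebra]

/-! ### The centre of `L` -/

/-- The trace runs over one-dimensional root spaces. On the real form it becomes a sum of squares
for `x = y`, which gives the positive definiteness behind the existence of the centre. -/
lemma killing_eq_sum (x y : H) :
    killingForm ℂ 𝔤 (x : 𝔤) (y : 𝔤) = ∑ α : H.root, ev α x * ev α y := by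
  have h := LieAlgebra.IsKilling.restrict_killingForm_eq_sum (K := ℂ) (L := 𝔤) (H := H)
  have h2 := LinearMap.congr_fun (LinearMap.congr_fun h x) y
  have h3 : ((killingForm ℂ 𝔤).restrict H) x y = killingForm ℂ 𝔤 (x : 𝔤) (y : 𝔤) := rfl
  rw [← h3, h2, ← Finset.sum_coe_sort H.root]
  simp only [LinearMap.sum_apply, LinearMap.smulRight_apply, LinearMap.smul_apply, smul_eq_mul]
  rfl

variable {L : AffineSubspace ℝ H} [Nonempty L]

lemma direction_le (hL : ∀ v ∈ L, v ∈ realForm H) {v : H} (hv : v ∈ L.direction) :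
    v ∈ realForm H := by
  obtain ⟨p, hp⟩ : ∃ p, p ∈ L := ⟨_, (Classical.arbitrary L).2⟩
  have h1 : v +ᵥ p ∈ L := AffineSubspace.vadd_mem_of_mem_direction hv hp
  have := sub_mem (hL _ h1) (hL p hp)
  simpa using this

/-- The centre exists. -/
lemma center_spec (hL : ∀ v ∈ L, v ∈ realForm H) :
    ((center L : cplx L) : H) ∈ L ∧
      ∀ v ∈ L.direction, killingForm ℂ 𝔤 (((center L : cplx L) : H) : 𝔤) ((v : H) : 𝔤) = 0 := by
  refine Classical.epsilon_spec (p := fun c : cplx L =>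
    (c : H) ∈ L ∧ ∀ v ∈ L.direction, killingForm ℂ 𝔤 ((c : H) : 𝔤) ((v : H) : 𝔤) = 0) ?_
  obtain ⟨p, hp⟩ : ∃ p, p ∈ L := ⟨_, (Classical.arbitrary L).2⟩
  let D := L.direction
  have hDfin : FiniteDimensional ℝ D := by
    have h1 : FiniteDimensional ℝ (realForm H) :=
      FiniteDimensional.span_of_finite ℝ (Set.finite_range _)
    have h2 : D ≤ realForm H := fun v hv => direction_le hL hv
    exact Submodule.finiteDimensional_of_le h2
  let κ (v : H) : D →ₗ[ℝ] ℝ :=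
    { toFun := fun d => ∑ α : H.root, (ev α v).re * (ev α (d : H)).re
      map_add' := by
        intro d d'
        rw [← Finset.sum_add_distrib]
        refine Finset.sum_congr rfl fun α _ => ?_
        rw [Submodule.coe_add, map_add, Complex.add_re]; ring
      map_smul' := by
        intro t d
        rw [RingHom.id_apply, smul_eq_mul, Finset.mul_sum]
        refine Finset.sum_congr rfl fun α _ => ?_
        rw [Submodule.coe_smul, ← Complex.coe_smul, map_smul, smul_eq_mul, Complex.re_ofReal_mul]
        ring }
  have hreal : ∀ v ∈ realForm H, ∀ α, ((ev α v).re : ℂ) = ev α v := by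
    intro v hv α
    obtain ⟨t, ht⟩ := ev_real α hv
    rw [ht]; simp
  have hκ : ∀ v ∈ realForm H, ∀ d : D, killingForm ℂ 𝔤 (v : 𝔤) ((d : H) : 𝔤) = (κ v d : ℂ) := by
    intro v hv d
    rw [killing_eq_sum]
    simp only [κ, LinearMap.coe_mk, AddHom.coe_mk]
    push_cast
    refine Finset.sum_congr rfl fun α _ => ?_
    rw [hreal v hv, hreal d (direction_le hL d.2)]
  -- Positive definiteness makes `Φ` bijective. The vector `d` representing the pairing with `p` is
  -- the orthogonal projection of `p` to the direction, and `p - d` is the centre.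
  let Φ : D →ₗ[ℝ] Dual ℝ D :=
    { toFun := fun d => κ d
      map_add' := by
        intro d d'
        ext x
        simp only [κ, LinearMap.coe_mk, AddHom.coe_mk, LinearMap.add_apply]
        rw [← Finset.sum_add_distrib]
        refine Finset.sum_congr rfl fun α _ => ?_
        rw [Submodule.coe_add, map_add, Complex.add_re]; ring
      map_smul' := by
        intro t d
        ext x
        simp only [κ, LinearMap.coe_mk, AddHom.coe_mk, LinearMap.smul_apply, RingHom.id_apply,
          smul_eq_mul, Finset.mul_sum]
        refine Finset.sum_congr rfl fun α _ => ?_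
        rw [Submodule.coe_smul, ← Complex.coe_smul, map_smul, smul_eq_mul, Complex.re_ofReal_mul]
        ring }
  have hinj : Function.Injective Φ := by
    rw [injective_iff_map_eq_zero]
    intro d hd
    have h1 : ∑ α : H.root, (ev α (d : H)).re * (ev α (d : H)).re = 0 :=
      LinearMap.congr_fun hd d
    rw [Finset.sum_eq_zero_iff_of_nonneg (fun α _ => mul_self_nonneg _)] at h1
    refine Subtype.ext (eq_zero_of_ev fun α => ?_)
    rw [← hreal _ (direction_le hL d.2), mul_self_eq_zero.mp (h1 α (Finset.mem_univ _))]
    simp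
  have hsurj : Function.Surjective Φ :=
    (LinearMap.injective_iff_surjective_of_finrank_eq_finrank
      (Subspace.dual_finrank_eq (K := ℝ) (V := D)).symm).mp hinj
  obtain ⟨d, hd⟩ := hsurj (κ p)
  have hmem : p - (d : H) ∈ L := by
    have := AffineSubspace.vadd_mem_of_mem_direction (neg_mem d.2) hp
    simpa [sub_eq_neg_add] using this
  refine ⟨⟨p - d, subset_affineSpan ℂ _ hmem⟩, hmem, fun v hv => ?_⟩
  have h1 := hκ p (hL p hp) ⟨v, hv⟩
  have h2 := hκ d (direction_le hL d.2) ⟨v, hv⟩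
  have h3 : κ p ⟨v, hv⟩ = κ d ⟨v, hv⟩ := (LinearMap.congr_fun hd ⟨v, hv⟩).symm
  simp only at h1 h2
  have h4 : (((p - (d : H) : H)) : 𝔤) = (p : 𝔤) - ((d : H) : 𝔤) := rfl
  simp only [h4, map_sub, LinearMap.sub_apply, h1, h2, h3, sub_self]

lemma ev_center_real (hL : ∀ v ∈ L, v ∈ realForm H) (α : H.root) :
    ∃ t : ℝ, ev α (center L : cplx L) = t := ev_real α (hL _ (center_spec hL).1)

variable {b : (LieAlgebra.IsKilling.rootSystem H).Base} {i₀ : H.root}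

/-- A pole space contains every real solution of its equations `α = 1`, so a real vector killed by
`P_L` may be added to any of its points. -/
lemma mem_direction_of_pole (hpole : IsPoleSpace b i₀ L) {v : H} (hv : v ∈ realForm H)
    (h : ∀ α ∈ poleCoroots L, ev α v = 0) : v ∈ L.direction := by
  obtain ⟨w, -, hL, -, hw⟩ := hpole
  obtain ⟨p, hp⟩ : ∃ p, p ∈ L := ⟨_, (Classical.arbitrary L).2⟩
  have h1 : v + p ∈ L := hw _ (add_mem hv (hL p hp)) fun α hα => by
    rw [map_add, h α hα.1, hα.1 p hp, zero_add]
  have := AffineSubspace.vsub_mem_direction h1 hp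
  simpa using this

/-- The center is a combination of the coroots of the elements of `P_L`. -/
lemma center_mem_span (hpole : IsPoleSpace b i₀ L) :
    ((center L : cplx L) : H) ∈
      Submodule.span ℂ ((LieAlgebra.IsKilling.rootSystem H).coroot '' poleCoroots L) := by
  have hL : ∀ v ∈ L, v ∈ realForm H := hpole.choose_spec.2.1
  have hL' := center_spec hL
  set c : H := ((center L : cplx L) : H)
  let Θ := LieAlgebra.IsKilling.cartanEquivDual H (K := ℂ) (L := 𝔤)
  have hΘ : ∀ x y : H, Θ x y = killingForm ℂ 𝔤 (x : 𝔤) (y : 𝔤) := fun x y => rfl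
  -- The common kernel of `P_L` is spanned by directions of `L`, to which `c` is orthogonal; hence
  -- the functional `Θ c` is a combination of `P_L`. Under `Θ` coroot vectors correspond to
  -- multiples of the functionals.
  have h1 : Θ c ∈ Submodule.span ℂ (Set.range fun α : poleCoroots L => ev (α : H.root)) := by
    refine mem_span_of_iInf_ker_le_ker fun v hv => ?_
    simp only [Submodule.mem_iInf, LinearMap.mem_ker] at hv ⊢
    obtain ⟨x, hx, y, hy, rfl⟩ := exists_re_im v
    have hxy : ∀ α ∈ poleCoroots L, ev α x = 0 ∧ ev α y = 0 := by
      intro α hα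
      have h2 := hv ⟨α, hα⟩
      obtain ⟨s, hs⟩ := ev_real α hx
      obtain ⟨t, ht⟩ := ev_real α hy
      simp only [map_add, map_smul, hs, ht] at h2
      have h3 := congrArg Complex.re h2
      have h4 := congrArg Complex.im h2
      simp at h3 h4
      simp [h3, h4, hs, ht]
    have h5 := hL'.2 x (mem_direction_of_pole hpole hx fun α hα => (hxy α hα).1)
    have h6 := hL'.2 y (mem_direction_of_pole hpole hy fun α hα => (hxy α hα).2)
    rw [map_add, map_smul, hΘ, hΘ, h5, h6]
    simp
  have h2 : c = Θ.symm (Θ c) := by simp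
  rw [h2]
  have h3 : ∀ f ∈ Submodule.span ℂ (Set.range fun α : poleCoroots L => ev (α : H.root)),
      Θ.symm f ∈ Submodule.span ℂ ((LieAlgebra.IsKilling.rootSystem H).coroot '' poleCoroots L) := by
    intro f hf
    induction hf using Submodule.span_induction with
    | mem g hg =>
      obtain ⟨α, rfl⟩ := hg
      have h4 : (LieAlgebra.IsKilling.rootSystem H).coroot (α : H.root) =
          2 • ((α : H.root).1 (Θ.symm (ev (α : H.root))))⁻¹ • Θ.symm (ev (α : H.root)) := rfl
      have h5 : (α : H.root).1 (Θ.symm (ev (α : H.root))) ≠ 0 :=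
        LieAlgebra.IsKilling.root_apply_cartanEquivDual_symm_ne_zero (H.isNonZero_coe_root α)
      have h6 : Θ.symm (ev (α : H.root)) =
          ((α : H.root).1 (Θ.symm (ev (α : H.root))) / 2) •
            (LieAlgebra.IsKilling.rootSystem H).coroot (α : H.root) := by
        rw [h4, ← Nat.cast_smul_eq_nsmul ℂ, smul_smul, smul_smul]
        rw [show ((α : H.root).1 (Θ.symm (ev (α : H.root))) / 2) * ((2 : ℕ) : ℂ) *
          ((α : H.root).1 (Θ.symm (ev (α : H.root))))⁻¹ = 1 by push_cast; field_simp, one_smul]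
      change Θ.symm (ev (α : H.root)) ∈ _
      rw [h6]
      exact Submodule.smul_mem _ _ (Submodule.subset_span ⟨α, α.2, rfl⟩)
    | zero => simp
    | add f g _ _ hf hg => rw [map_add]; exact add_mem hf hg
    | smul z f _ hf => rw [map_smul]; exact Submodule.smul_mem _ _ hf
  exact h3 _ h1

/-! ### Root vectors -/

/-- The root space of a coroot. -/
abbrev rsp (α : H.root) : Submodule ℂ 𝔤 :=
  (LieAlgebra.rootSpace H (α.1 : H → ℂ)).toSubmodule

lemma lie_rsp {α : H.root} {x : 𝔤} (hx : x ∈ rsp α) (v : H) : ⁅(v : 𝔤), x⁆ = ev α v • x :=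
  LieAlgebra.IsKilling.lie_eq_smul_of_mem_rootSpace hx v

lemma lie_cartan (v w : H) : ⁅(v : 𝔤), (w : 𝔤)⁆ = 0 := by
  have : ⁅v, w⁆ = 0 := trivial_lie_zero H H v w
  have h := congrArg (fun x : H => (x : 𝔤)) this
  simpa using h

/-- The bracket of two root vectors. -/
lemma lie_rsp_rsp {α β : H.root} {x y : 𝔤} (hx : x ∈ rsp α) (hy : y ∈ rsp β)
    (h0 : ev α + ev β ≠ 0) :
    ⁅x, y⁆ = 0 ∨ ∃ γ : H.root, ev γ = ev α + ev β ∧ ⁅x, y⁆ ∈ rsp γ := by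
  have h1 : ⁅x, y⁆ ∈ LieAlgebra.rootSpace H ((α.1 : H → ℂ) + (β.1 : H → ℂ)) :=
    LieAlgebra.lie_mem_genWeightSpace_of_mem_genWeightSpace hx hy
  by_cases h : LieAlgebra.rootSpace H ((α.1 : H → ℂ) + (β.1 : H → ℂ)) = ⊥
  · rw [h] at h1
    exact Or.inl (by simpa using h1)
  · refine Or.inr ⟨⟨⟨(α.1 : H → ℂ) + (β.1 : H → ℂ), h⟩, ?_⟩, ?_, h1⟩
    · simp only [Finset.mem_filter, Finset.mem_univ, true_and]
      intro hz
      apply h0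
      ext v
      exact congrFun hz v
    · ext v
      rfl

variable (H) in
/-- A choice of `𝔰𝔩₂`-triples for the coroots. -/
lemma exists_root_triples : ∃ E F : H.root → 𝔤, (∀ α, E α ≠ 0) ∧ (∀ α, E α ∈ rsp α) ∧
    (∀ α, F α ∈ rsp (ng α)) ∧
    ∀ α, ⁅E α, F α⁆ = ((LieAlgebra.IsKilling.rootSystem H).coroot α : H) := by
  have : ∀ α : H.root, ∃ e f : 𝔤, e ≠ 0 ∧ e ∈ rsp α ∧ f ∈ rsp (ng α) ∧
      ⁅e, f⁆ = ((LieAlgebra.IsKilling.rootSystem H).coroot α : H) := by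
    intro α
    obtain ⟨h, e, f, ht, he, hf⟩ :=
      LieAlgebra.IsKilling.exists_isSl2Triple_of_weight_isNonZero (H.isNonZero_coe_root α)
    refine ⟨e, f, ht.e_ne_zero, he, ?_, ?_⟩
    · have h1 : ((ng α).1 : H → ℂ) = -(α.1 : H → ℂ) := by
        funext v
        have := LinearMap.congr_fun (ev_ng α) v
        exact this
      change f ∈ LieAlgebra.rootSpace H ((ng α).1 : H → ℂ)
      rw [h1]
      exact hf
    · rw [ht.lie_e_f, ht.h_eq_coroot (H.isNonZero_coe_root α) he hf]
      rfl
  choose E F h using this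
  exact ⟨E, F, fun α => (h α).1, fun α => (h α).2.1, fun α => (h α).2.2.1, fun α => (h α).2.2.2⟩

variable (H) in
/-- A choice of root vectors. -/
def rvec : H.root → 𝔤 := (exists_root_triples H).choose

lemma rvec_ne_zero (α : H.root) : rvec H α ≠ 0 := (exists_root_triples H).choose_spec.choose_spec.1 α

lemma rvec_mem (α : H.root) : rvec H α ∈ rsp α := (exists_root_triples H).choose_spec.choose_spec.2.1 α

lemma rsp_eq_span (α : H.root) : rsp α = Submodule.span ℂ {rvec H α} := by
  have h1 : finrank ℂ (rsp α) = 1 :=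
    LieAlgebra.IsKilling.finrank_rootSpace_eq_one α.1 (H.isNonZero_coe_root α)
  refine le_antisymm (fun x hx => ?_) (by
    rw [Submodule.span_singleton_le_iff_mem]; exact rvec_mem α)
  obtain ⟨c, hc⟩ := (finrank_eq_one_iff_of_nonzero' (⟨rvec H α, rvec_mem α⟩ : rsp α)
    (by simpa [Subtype.ext_iff] using rvec_ne_zero α)).mp h1 ⟨x, hx⟩
  rw [Submodule.mem_span_singleton]
  exact ⟨c, congrArg Subtype.val hc⟩

variable (H) in
lemma rvec_linearIndependent : LinearIndependent ℂ (rvec H) := by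
  have h1 := LieModule.iSupIndep_genWeightSpace ℂ H 𝔤
  have h2 : iSupIndep fun α : H.root => rsp α := by
    have h3 := (LieSubmodule.iSupIndep_toSubmodule.mpr h1)
    refine h3.comp (f := fun α : H.root => (α.1 : H → ℂ)) ?_
    intro α β h
    refine ev_injective (LinearMap.ext fun v => congrFun h v)
  exact h2.linearIndependent _ rvec_mem rvec_ne_zero

lemma rootSum_eq_span (S : Set H.root) : rootSum S = Submodule.span ℂ (rvec H '' S) := by
  rw [rootSum]
  have h : ∀ α : H.root, (LieAlgebra.rootSpace H (α.1 : H → ℂ)).toSubmodule =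
    Submodule.span ℂ {rvec H α} := rsp_eq_span
  simp only [h]
  rw [← Set.biUnion_of_singleton (rvec H '' S), Set.biUnion_image]
  simp only [Submodule.span_iUnion]

variable (H) in
lemma cartan_sup_rootSum : H.toSubmodule ⊔ rootSum (Set.univ : Set H.root) = ⊤ := by
  rw [eq_top_iff]
  have h1 := LieModule.iSup_genWeightSpace_eq_top' ℂ H 𝔤
  have h2 : (⊤ : Submodule ℂ 𝔤) = ⨆ χ : LieModule.Weight ℂ H 𝔤,
      (LieModule.genWeightSpace 𝔤 (χ : H → ℂ)).toSubmodule := by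
    rw [← LieSubmodule.iSup_toSubmodule, h1, LieSubmodule.top_toSubmodule]
  rw [h2]
  refine iSup_le fun χ => ?_
  by_cases hχ : χ.IsNonZero
  · refine le_sup_of_le_right ?_
    exact le_iSup₂_of_le (f := fun (α : H.root) (_ : α ∈ (Set.univ : Set H.root)) =>
      (LieAlgebra.rootSpace H (α.1 : H → ℂ)).toSubmodule) ⟨χ, by simpa using hχ⟩ trivial le_rfl
  · refine le_sup_of_le_left ?_
    have hz : (χ : H → ℂ) = 0 := by
      by_contra h
      exact hχ h
    rw [hz]
    have := LieAlgebra.rootSpace_zero_eq ℂ 𝔤 H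
    intro x hx
    have hx' : x ∈ LieAlgebra.rootSpace H (0 : H → ℂ) := hx
    rw [this] at hx'
    exact hx'

/-! ### The `𝔰𝔩₂`-triples attached to a regular pole space -/

lemma pole_subset_const : poleCoroots L ⊆ constCoroots L := fun _ hα => ⟨1, hα⟩

lemma ev_eq_of_const {α : H.root} (hα : α ∈ constCoroots L) {z : ℂ} (hz : ∀ v ∈ L, ev α v = z)
    (v : cplx L) : ev α v = z := by
  have h1 : affineSpan ℂ (L : Set H) ≤
      (AffineSubspace.comap (ev α).toAffineMap (AffineSubspace.mk' z ⊥)) := by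
    rw [affineSpan_le]
    intro v hv
    simp [hz v hv]
  have h2 := h1 v.2
  simpa [sub_eq_zero] using h2

lemma ev_const {α : H.root} (hα : α ∈ constCoroots L) (v w : cplx L) : ev α v = ev α w := by
  obtain ⟨z, hz⟩ := hα
  rw [ev_eq_of_const ⟨z, hz⟩ hz v, ev_eq_of_const ⟨z, hz⟩ hz w]

lemma const_iff {α : H.root} : α ∈ constCoroots L ↔ ¬ Nonconst (res L α) := by
  constructor
  · rintro ⟨z, hz⟩ h
    exact h ⟨z, fun v => ev_eq_of_const ⟨z, hz⟩ hz v⟩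
  · intro h
    unfold Nonconst at h
    push Not at h
    obtain ⟨z, hz⟩ := h
    exact ⟨z, fun v hv => hz ⟨v, subset_affineSpan ℂ _ hv⟩⟩

lemma mem_rootSum {S : Set H.root} {α : H.root} (hα : α ∈ S) {x : 𝔤} (hx : x ∈ rsp α) :
    x ∈ rootSum S :=
  (le_iSup₂_of_le (f := fun (α : H.root) (_ : α ∈ S) =>
      (LieAlgebra.rootSpace H (α.1 : H → ℂ)).toSubmodule) α hα le_rfl) hx

lemma rootSum_induction {S : Set H.root} {x : 𝔤} (hx : x ∈ rootSum S) {p : 𝔤 → Prop}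
    (mem : ∀ α ∈ S, ∀ y ∈ rsp α, p y) (zero : p 0) (add : ∀ y z, p y → p z → p (y + z)) : p x := by
  rw [rootSum] at hx
  refine Submodule.iSup_induction _ (motive := p) hx (fun α y hy => ?_) zero add
  refine Submodule.iSup_induction _ (motive := p) hy (fun hα y hy => mem α hα y hy) zero add

/-- All points of `L_ℂ` act on `𝔤^L` as the center does. -/
lemma lie_leviAlg {x : 𝔤} (hx : x ∈ leviAlg L) (v w : cplx L) :
    ⁅((v : H) : 𝔤), x⁆ = ⁅((w : H) : 𝔤), x⁆ := by
  obtain ⟨h, hh, y, hy, rfl⟩ := Submodule.mem_sup.mp hx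
  have h1 : ⁅((v : H) : 𝔤), h⁆ = ⁅((w : H) : 𝔤), h⁆ := by
    rw [lie_cartan v ⟨h, hh⟩, lie_cartan w ⟨h, hh⟩]
  rw [lie_add, lie_add, h1]
  congr 1
  refine rootSum_induction (p := fun y => ⁅((v : H) : 𝔤), y⁆ = ⁅((w : H) : 𝔤), y⁆) hy
    (fun α hα y hy => ?_) (by simp) (fun y z hy hz => by
    rw [lie_add, lie_add, hy, hz])
  rw [lie_rsp hy, lie_rsp hy, ev_const hα v w]

lemma IsTriple.lie_e {e f : 𝔤} (h : IsTriple L e f) (v : cplx L) : ⁅((v : H) : 𝔤), e⁆ = e := by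
  rw [lie_leviAlg h.e_mem v (center L)]
  have := h.lie_h_e
  rw [smul_lie] at this
  exact smul_right_injective 𝔤 (two_ne_zero' ℂ) this

lemma IsTriple.lie_f {e f : 𝔤} (h : IsTriple L e f) (v : cplx L) : ⁅((v : H) : 𝔤), f⁆ = -f := by
  rw [lie_leviAlg h.f_mem v (center L)]
  have := h.lie_h_f
  rw [smul_lie, ← smul_neg] at this
  exact smul_right_injective 𝔤 (two_ne_zero' ℂ) this

/-- Existence of triples; `f` is a combination of root vectors for the negatives of the elements of
`P_L`. -/
lemma exists_isTriple (hpole : IsPoleSpace b i₀ L) (hreg : IsRegular L) :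
    ∃ e f : 𝔤, IsTriple L e f ∧ f ∈ rootSum (ng '' poleCoroots L) := by
  classical
  obtain ⟨E, F, -, hE, hF, hEF⟩ := exists_root_triples H
  have h1 : (2 : ℂ) • ((center L : cplx L) : H) ∈
      Submodule.span ℂ ((LieAlgebra.IsKilling.rootSystem H).coroot '' poleCoroots L) :=
    Submodule.smul_mem _ _ (center_mem_span hpole)
  have hfs : (LieAlgebra.IsKilling.rootSystem H).coroot '' poleCoroots L =
      (LieAlgebra.IsKilling.rootSystem H).coroot '' (fs (poleCoroots L) : Set H.root) := by
    congr 1; ext α; simp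
  rw [hfs, Submodule.mem_span_image_finset_iff_exists_fun] at h1
  obtain ⟨q₀, hq₀⟩ := h1
  obtain ⟨q, rfl⟩ : ∃ q : H.root → ℂ, q₀ = fun α => q α.1 :=
    ⟨fun α => if h : α ∈ fs (poleCoroots L) then q₀ ⟨α, h⟩ else 0, by funext α; simp⟩
  have hq := (Finset.sum_coe_sort (fs (poleCoroots L))
    fun α => q α • (LieAlgebra.IsKilling.rootSystem H).coroot α).symm.trans hq₀
  let P := fs (poleCoroots L)
  have hP : ∀ α ∈ P, ∀ v : cplx L, ev α v = 1 := fun α hα v => by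
    have : α ∈ poleCoroots L := by simpa [P] using hα
    exact ev_eq_of_const ⟨1, this⟩ this v
  have hq' : (2 : ℂ) • (((center L : cplx L) : H) : 𝔤) =
      ∑ α ∈ P, q α • (((LieAlgebra.IsKilling.rootSystem H).coroot α : H) : 𝔤) := by
    have := congrArg H.subtype hq
    simp only [map_sum, map_smul] at this
    exact this.symm
  -- The difference of two elements of `P_L` vanishes on `L`, so regularity forbids it to be a
  -- coroot and the mixed brackets vanish.
  have hcross : ∀ α ∈ P, ∀ β ∈ P, α ≠ β → ⁅E α, F β⁆ = 0 := by
    intro α hα β hβ hne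
    rcases lie_rsp_rsp (hE α) (hF β) (by
      rw [ev_ng, ← sub_eq_add_neg, sub_ne_zero]
      exact fun h => hne (ev_injective h)) with h | ⟨γ, hγ, -⟩
    · exact h
    · exfalso
      have h2 : γ ∈ zeroCoroots L := by
        intro v hv
        have h3 := hP α hα ⟨v, subset_affineSpan ℂ _ hv⟩
        have h4 := hP β hβ ⟨v, subset_affineSpan ℂ _ hv⟩
        simp only at h3 h4
        rw [hγ, ev_ng, LinearMap.add_apply, LinearMap.neg_apply, h3, h4]
        ring
      rw [hreg] at h2
      exact h2
  have hf : ∑ α ∈ P, q α • F α ∈ rootSum (ng '' poleCoroots L) :=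
    Submodule.sum_mem _ fun α hα => Submodule.smul_mem _ _
      (mem_rootSum (Set.mem_image_of_mem _ (by simpa [P] using hα)) (hF α))
  -- The coefficients `q` are those of `2 c_L` in terms of the coroot vectors, so the diagonal
  -- brackets alone add up to the semisimple element.
  refine ⟨∑ α ∈ P, E α, ∑ α ∈ P, q α • F α, ⟨?_, ?_, ?_, ?_, ?_⟩, hf⟩
  · refine Submodule.mem_sup_right (Submodule.sum_mem _ fun α hα => mem_rootSum ?_ (hE α))
    exact pole_subset_const (by simpa [P] using hα)
  · refine Submodule.mem_sup_right (Submodule.sum_mem _ fun α hα => Submodule.smul_mem _ _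
      (mem_rootSum ?_ (hF α)))
    obtain ⟨z, hz⟩ := pole_subset_const (L := L) (show α ∈ poleCoroots L by simpa [P] using hα)
    exact ⟨-z, fun v hv => by rw [ev_ng, LinearMap.neg_apply, hz v hv]⟩
  · rw [sum_lie_sum, hq']
    refine Finset.sum_congr rfl fun α hα => ?_
    rw [Finset.sum_eq_single α (fun β hβ hne => by
      rw [lie_smul, hcross α hα β hβ hne.symm, smul_zero]) (fun h => absurd hα h),
      lie_smul, hEF]
  · rw [lie_sum, Finset.smul_sum]
    refine Finset.sum_congr rfl fun α hα => ?_
    rw [smul_lie, lie_rsp (hE α), hP α hα, one_smul]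
  · rw [lie_sum, Finset.smul_sum, ← Finset.sum_neg_distrib]
    refine Finset.sum_congr rfl fun α hα => ?_
    rw [smul_lie, lie_smul, lie_rsp (hF α), ev_ng, LinearMap.neg_apply, hP α hα]
    module

end

section

/-! ### Elementary representation theory of `𝔰𝔩₂` -/

section sl2

variable {M : Type*} [AddCommGroup M] [Module ℂ M] {h e f : M →ₗ[ℂ] M}

lemma sl2_weight_pow (hhf : ∀ x, h (f x) = f (h x) - (2 : ℂ) • f x) {x : M} {k : ℂ}
    (hx : h x = k • x) (n : ℕ) : h ((f ^ n) x) = (k - 2 * n) • (f ^ n) x := by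
  induction n with
  | zero => simp [hx]
  | succ n ih =>
    rw [pow_succ', Module.End.mul_apply, hhf, ih, map_smul]
    push_cast
    module

/-- The usual commutation formula is kept without the assumption `e x = 0`, since `sl2_injective`
applies it to vectors that are not primitive. -/
lemma sl2_e_f_pow (hef : ∀ x, e (f x) = f (e x) + h x)
    (hhf : ∀ x, h (f x) = f (h x) - (2 : ℂ) • f x) {x : M} {k : ℂ} (hx : h x = k • x) (n : ℕ) :
    e ((f ^ (n + 1)) x) = (f ^ (n + 1)) (e x) + ((n + 1 : ℂ) * (k - n)) • (f ^ n) x := by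
  induction n with
  | zero => simp [hef, hx]
  | succ n ih =>
    rw [pow_succ', Module.End.mul_apply, hef, ih, map_add, map_smul, sl2_weight_pow hhf hx,
      ← Module.End.mul_apply f, ← pow_succ', ← Module.End.mul_apply f, ← pow_succ', add_assoc,
      ← add_smul]
    congr 2
    push_cast
    ring

/-- The weight of a primitive vector is a natural number. -/
lemma sl2_primitive (hef : ∀ x, e (f x) = f (e x) + h x)
    (hhf : ∀ x, h (f x) = f (h x) - (2 : ℂ) • f x) {x : M} {k : ℂ} (hx : h x = k • x)
    (hx0 : x ≠ 0) (he : e x = 0) {N : ℕ} (hN : (f ^ N) x = 0) : ∃ n : ℕ, k = n ∧ n < N := by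
  classical
  have hex : ∃ N, (f ^ N) x = 0 := ⟨N, hN⟩
  have h1 := Nat.find_spec hex
  have h2 := Nat.find_min' hex hN
  obtain ⟨i, hi⟩ : ∃ i, Nat.find hex = i + 1 := by
    refine Nat.exists_eq_succ_of_ne_zero fun h0 => ?_
    rw [h0] at h1
    exact hx0 (by simpa using h1)
  have h3 : (f ^ i) x ≠ 0 := Nat.find_min hex (by omega)
  rw [hi] at h1 h2
  -- As `i + 1` is the first exponent that kills `x`, the coefficient `(i + 1) * (k - i)` must
  -- vanish.
  have h4 := sl2_e_f_pow hef hhf hx i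
  rw [h1, he, map_zero, map_zero, zero_add] at h4
  rcases smul_eq_zero.mp h4.symm with h5 | h5
  · rcases mul_eq_zero.mp h5 with h6 | h6
    · exact absurd h6 (by exact_mod_cast Nat.succ_ne_zero i)
    · exact ⟨i, by linear_combination h6, by omega⟩
  · exact absurd h5 h3

/-- `f ^ j` is injective on vectors of weight at least `j`. -/
lemma sl2_injective (hef : ∀ x, e (f x) = f (e x) + h x)
    (hhf : ∀ x, h (f x) = f (h x) - (2 : ℂ) • f x) (hhe : ∀ x, h (e x) = e (h x) + (2 : ℂ) • e x)
    {x : M} {k j : ℕ} (hx : h x = (k : ℂ) • x) (hj : j ≤ k) (hf : (f ^ j) x = 0)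
    {m : ℕ} (he : (e ^ m) x = 0) : x = 0 := by
  induction m generalizing x k j with
  | zero => simpa using he
  | succ m ih =>
    have h1 : e x = 0 := by
      -- The induction is on the nilpotency order of `e` on `x`. By the commutation formula `e x`,
      -- of weight `k + 2`, is killed by `f ^ (j + 1)`, and the inequality `j ≤ k` is preserved.
      refine ih (k := k + 2) (j := j + 1) ?_ (by omega) ?_ ?_
      · rw [hhe, hx, map_smul]; push_cast; module
      · have h2 := sl2_e_f_pow hef hhf hx j
        rw [hf, smul_zero, add_zero, pow_succ', Module.End.mul_apply, hf, map_zero, map_zero] at h2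
        rw [pow_succ', Module.End.mul_apply]
        exact h2.symm
      · rw [← Module.End.mul_apply, ← pow_succ, he]
    by_contra h0
    obtain ⟨n, hn, hlt⟩ := sl2_primitive hef hhf hx h0 h1 hf
    have : k = n := by exact_mod_cast hn
    omega

end sl2

variable {𝔤 : Type*} [LieRing 𝔤] [LieAlgebra ℂ 𝔤] [FiniteDimensional ℂ 𝔤]
  [LieAlgebra.IsKilling ℂ 𝔤] {H : LieSubalgebra ℂ 𝔤} [H.IsCartanSubalgebra]
  {L : AffineSubspace ℝ H} [Nonempty L]

/-! ### Weight spaces of `L_ℂ` -/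

/-- The coroots with a given restriction to `L`. -/
def resFib (X : Aff L) : Set H.root := {γ | res L γ = X}

/-- The number of coroots with a given restriction to `L`. -/
def nRes (X : Aff L) : ℕ := (fs (resFib X)).card

lemma finrank_rootSum (S : Set H.root) : finrank ℂ (rootSum S) = (fs S).card := by
  have h1 : rvec H '' S = Set.range fun α : fs S => rvec H (α : H.root) := by
    ext x; simp
  have h2 := finrank_span_eq_card ((rvec_linearIndependent H).comp
    (fun α : fs S => (α : H.root)) Subtype.val_injective)
  rw [rootSum_eq_span, h1]
  simpa [Function.comp_def] using h2

lemma mem_rootSum_iff {S : Set H.root} {y : 𝔤} :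
    y ∈ rootSum S ↔ ∃ c : H.root → ℂ, (∀ γ, c γ ≠ 0 → γ ∈ S) ∧ y = ∑ γ, c γ • rvec H γ := by
  constructor
  · intro hy
    refine rootSum_induction (p := fun y => ∃ c : H.root → ℂ, (∀ γ, c γ ≠ 0 → γ ∈ S) ∧
      y = ∑ γ, c γ • rvec H γ) hy ?_ ⟨0, by simp, by simp⟩ ?_
    · classical
      intro α hα y hy
      rw [rsp_eq_span, Submodule.mem_span_singleton] at hy
      obtain ⟨t, rfl⟩ := hy
      refine ⟨Pi.single α t, fun γ hγ => ?_, ?_⟩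
      · by_cases h : γ = α
        · exact h ▸ hα
        · exact absurd (Pi.single_eq_of_ne (M := fun _ => ℂ) h t) hγ
      · rw [Finset.sum_eq_single α (fun γ _ h => by rw [Pi.single_eq_of_ne h, zero_smul])
          (by simp), Pi.single_eq_same]
    · rintro y z ⟨c, hc, rfl⟩ ⟨d, hd, rfl⟩
      refine ⟨c + d, fun γ hγ => ?_, by simp [add_smul, Finset.sum_add_distrib]⟩
      by_cases h : c γ = 0
      · exact hd γ fun h' => hγ (by simp [h, h'])
      · exact hc γ h
  · rintro ⟨c, hc, rfl⟩
    refine Submodule.sum_mem _ fun γ _ => ?_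
    by_cases h : c γ = 0
    · simp [h]
    · exact Submodule.smul_mem _ _ (mem_rootSum (hc γ h) (rvec_mem γ))

lemma rootSum_mono {S T : Set H.root} (h : S ⊆ T) : rootSum S ≤ rootSum T :=
  biSup_mono fun _ hi => h hi

lemma lie_resFib {X : Aff L} {y : 𝔤} (hy : y ∈ rootSum (resFib X)) (v : cplx L) :
    ⁅((v : H) : 𝔤), y⁆ = X v • y := by
  refine rootSum_induction (p := fun y => ⁅((v : H) : 𝔤), y⁆ = X v • y) hy
    (fun α hα y hy => ?_) (by simp) (fun y z hy hz => by rw [lie_add, hy, hz, smul_add])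
  rw [lie_rsp hy, ← show res L α = X from hα, res_apply]

/-- Root vectors are linearly independent eigenvectors, so the eigenvalue equation can be compared
coordinate by coordinate. -/
lemma mem_resFib_inter {S : Set H.root} {X : Aff L} {y : 𝔤} (hy : y ∈ rootSum S)
    (h : ∀ v : cplx L, ⁅((v : H) : 𝔤), y⁆ = X v • y) : y ∈ rootSum (S ∩ resFib X) := by
  obtain ⟨c, hc, rfl⟩ := mem_rootSum_iff.mp hy
  refine mem_rootSum_iff.mpr ⟨c, fun γ hγ => ⟨hc γ hγ, ?_⟩, rfl⟩
  ext v
  have h1 := h v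
  rw [lie_sum, Finset.smul_sum, ← sub_eq_zero, ← Finset.sum_sub_distrib] at h1
  have h2 : ∑ γ : H.root, (c γ * (ev γ v - X v)) • rvec H γ = 0 := by
    rw [← h1]
    refine Finset.sum_congr rfl fun γ _ => ?_
    rw [lie_smul, lie_rsp (rvec_mem γ)]
    module
  have h3 := Fintype.linearIndependent_iff.mp (rvec_linearIndependent H) _ h2 γ
  rw [res_apply]
  exact sub_eq_zero.mp ((mul_eq_zero.mp h3).resolve_left hγ)

lemma lie_mem_rootSum_univ (v : H) (y : 𝔤) : ⁅(v : 𝔤), y⁆ ∈ rootSum (Set.univ : Set H.root) := by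
  have hy : y ∈ H.toSubmodule ⊔ rootSum (Set.univ : Set H.root) := by
    rw [cartan_sup_rootSum]; trivial
  obtain ⟨a, ha, z, hz, rfl⟩ := Submodule.mem_sup.mp hy
  rw [lie_add, lie_cartan v ⟨a, ha⟩, zero_add]
  refine rootSum_induction (p := fun y => ⁅(v : 𝔤), y⁆ ∈ rootSum (Set.univ : Set H.root)) hz
    (fun α hα y hy => ?_) (by simp) (fun y z hy hz => by rw [lie_add]; exact add_mem hy hz)
  rw [lie_rsp hy]
  exact Submodule.smul_mem _ _ (mem_rootSum hα hy)

/-- At a point where `X` takes the value `1` the vector equals its own bracket with an element of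
the Cartan subalgebra, and so has no Cartan component. -/
lemma mem_resFib {X : Aff L} (hX : Nonconst X) {y : 𝔤}
    (h : ∀ v : cplx L, ⁅((v : H) : 𝔤), y⁆ = X v • y) : y ∈ rootSum (resFib X) := by
  obtain ⟨v, hv⟩ := nonconst_surj hX 1
  have h1 : y ∈ rootSum (Set.univ : Set H.root) := by
    have := lie_mem_rootSum_univ (v : H) y
    rwa [h v, hv, one_smul] at this
  have := mem_resFib_inter h1 h
  rwa [Set.univ_inter] at this

lemma Nonconst.add_cst {X : Aff L} (hX : Nonconst X) (z : ℂ) : Nonconst (X + cst L z) := by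
  rintro ⟨t, ht⟩
  refine hX ⟨t - z, fun v => ?_⟩
  have := ht v
  simp only [AffineMap.coe_add, Pi.add_apply, AffineMap.const_apply] at this
  linear_combination this

lemma Nonconst.neg {X : Aff L} (hX : Nonconst X) : Nonconst (-X) := by
  rintro ⟨t, ht⟩
  refine hX ⟨-t, fun v => ?_⟩
  have := ht v
  simp only [AffineMap.coe_neg, Pi.neg_apply] at this
  linear_combination -this

/-! ### Triples acting on the weight spaces -/

/-- An `𝔰𝔩₂`-triple with `h = 2εc_L`, normalized by `L_ℂ`. -/
structure SlTriple (L : AffineSubspace ℝ H) [Nonempty L] (ε : ℂ) (e f : 𝔤) : Prop where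
  sq : ε * ε = 1
  lie_e : ∀ v : cplx L, ⁅((v : H) : 𝔤), e⁆ = ε • e
  lie_f : ∀ v : cplx L, ⁅((v : H) : 𝔤), f⁆ = -(ε • f)
  lie_e_f : ⁅e, f⁆ = (2 * ε) • (((center L : cplx L) : H) : 𝔤)

lemma IsTriple.slTriple {e f : 𝔤} (h : IsTriple L e f) : SlTriple L 1 e f where
  sq := one_mul 1
  lie_e v := by rw [h.lie_e v, one_smul]
  lie_f v := by rw [h.lie_f v, one_smul]
  lie_e_f := by rw [h.lie_e_f, mul_one]

variable {ε : ℂ} {e f : 𝔤}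

/-- The sign `ε` makes the notion symmetric in raising and lowering: every statement about `e` below
applies to `f` as well. -/
lemma SlTriple.swap (h : SlTriple L ε e f) : SlTriple L (-ε) f e where
  sq := by rw [neg_mul_neg, h.sq]
  lie_e v := by rw [h.lie_f v, neg_smul]
  lie_f v := by rw [h.lie_e v, neg_smul, neg_neg]
  lie_e_f := by rw [← lie_skew, h.lie_e_f, mul_neg, neg_smul]

lemma SlTriple.lie_mem (h : SlTriple L ε e f) {X : Aff L} (hX : Nonconst X) {y : 𝔤}
    (hy : y ∈ rootSum (resFib X)) : ⁅e, y⁆ ∈ rootSum (resFib (X + cst L ε)) := by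
  refine mem_resFib (hX.add_cst ε) fun v => ?_
  rw [leibniz_lie, h.lie_e, lie_resFib hy, lie_smul, smul_lie, ← add_smul]
  congr 1
  simp only [AffineMap.coe_add, Pi.add_apply, AffineMap.const_apply]
  ring

lemma SlTriple.pow_mem (h : SlTriple L ε e f) {X : Aff L} (hX : Nonconst X) {y : 𝔤}
    (hy : y ∈ rootSum (resFib X)) (n : ℕ) :
    ((LieAlgebra.ad ℂ 𝔤 e) ^ n) y ∈ rootSum (resFib (X + cst L (n * ε))) := by
  induction n with
  | zero =>
    have : X + cst L ((0 : ℕ) * ε) = X := by ext v; simp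
    rw [this]; simpa using hy
  | succ n ih =>
    rw [pow_succ', Module.End.mul_apply, LieAlgebra.ad_apply]
    have := h.lie_mem (hX.add_cst _) ih
    have h2 : X + cst L (n * ε) + cst L ε = X + cst L ((n + 1 : ℕ) * ε) := by
      ext v
      simp only [AffineMap.coe_add, Pi.add_apply, AffineMap.const_apply]
      push_cast; ring
    rwa [h2] at this

/-- The shifted weights `X + nε` are pairwise distinct, and there are only finitely many coroots to
realize them. -/
lemma SlTriple.exists_pow_eq_zero (h : SlTriple L ε e f) {X : Aff L} (hX : Nonconst X) {y : 𝔤}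
    (hy : y ∈ rootSum (resFib X)) : ∃ n, ((LieAlgebra.ad ℂ 𝔤 e) ^ n) y = 0 := by
  by_contra! hc
  have h1 : ∀ n : ℕ, ∃ γ : H.root, res L γ = X + cst L (n * ε) := by
    intro n
    by_contra! h2
    have h3 : resFib (X + cst L (n * ε)) = ∅ := by
      ext γ; simpa [resFib] using h2 γ
    have h4 := h.pow_mem hX hy n
    rw [h3, rootSum_eq_span, Set.image_empty, Submodule.span_empty] at h4
    exact hc n h4
  choose g hg using h1
  refine not_injective_infinite_finite g fun m n hmn => ?_
  have h2 := congrArg (fun Y : Aff L => Y (center L)) ((hg m).symm.trans (by rw [hmn, hg n]))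
  simp only [AffineMap.coe_add, Pi.add_apply, AffineMap.const_apply] at h2
  have h3 : ε ≠ 0 := fun h0 => by simpa [h0] using h.sq
  have h4 : (m : ℂ) * ε = n * ε := by linear_combination h2
  exact_mod_cast mul_right_cancel₀ h3 h4

/-- The semisimple element of the triple. -/
abbrev hEl (L : AffineSubspace ℝ H) [Nonempty L] (ε : ℂ) : 𝔤 :=
  (2 * ε) • (((center L : cplx L) : H) : 𝔤)

lemma SlTriple.ad_ef (h : SlTriple L ε e f) (x : 𝔤) : LieAlgebra.ad ℂ 𝔤 e (LieAlgebra.ad ℂ 𝔤 f x) =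
    LieAlgebra.ad ℂ 𝔤 f (LieAlgebra.ad ℂ 𝔤 e x) + LieAlgebra.ad ℂ 𝔤 (hEl L ε) x := by
  simp only [LieAlgebra.ad_apply]
  rw [leibniz_lie, h.lie_e_f, add_comm]

lemma SlTriple.ad_he (h : SlTriple L ε e f) (x : 𝔤) :
    LieAlgebra.ad ℂ 𝔤 (hEl L ε) (LieAlgebra.ad ℂ 𝔤 e x) =
    LieAlgebra.ad ℂ 𝔤 e (LieAlgebra.ad ℂ 𝔤 (hEl L ε) x) + (2 : ℂ) • LieAlgebra.ad ℂ 𝔤 e x := by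
  simp only [LieAlgebra.ad_apply]
  rw [leibniz_lie, smul_lie, h.lie_e, smul_smul, mul_assoc, h.sq, mul_one, smul_lie, add_comm]

lemma SlTriple.ad_hf (h : SlTriple L ε e f) (x : 𝔤) :
    LieAlgebra.ad ℂ 𝔤 (hEl L ε) (LieAlgebra.ad ℂ 𝔤 f x) =
    LieAlgebra.ad ℂ 𝔤 f (LieAlgebra.ad ℂ 𝔤 (hEl L ε) x) - (2 : ℂ) • LieAlgebra.ad ℂ 𝔤 f x := by
  simp only [LieAlgebra.ad_apply]
  rw [leibniz_lie, smul_lie, h.lie_f, smul_neg, smul_smul, mul_assoc, h.sq, mul_one, neg_lie,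
    smul_lie]
  abel

lemma ad_hEl {X : Aff L} {y : 𝔤} (hy : y ∈ rootSum (resFib X)) :
    LieAlgebra.ad ℂ 𝔤 (hEl L ε) y = (2 * ε * X (center L)) • y := by
  rw [LieAlgebra.ad_apply, smul_lie, lie_resFib hy, smul_smul]

lemma SlTriple.primitive (h : SlTriple L ε e f) {X : Aff L} (hX : Nonconst X) {y : 𝔤}
    (hy : y ∈ rootSum (resFib X)) (hy0 : y ≠ 0) (he : ⁅e, y⁆ = 0) :
    ∃ n : ℕ, 2 * ε * X (center L) = n := by
  obtain ⟨N, hN⟩ := h.swap.exists_pow_eq_zero hX hy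
  obtain ⟨n, hn, -⟩ := sl2_primitive h.ad_ef h.ad_hf (ad_hEl hy) hy0 he hN
  exact ⟨n, hn⟩

/-- The last nonzero image of `y` under powers of `e` is primitive, so its weight is a natural
number; each power of `e` changed the weight by `2`. -/
lemma SlTriple.integral (h : SlTriple L ε e f) {X : Aff L} (hX : Nonconst X) {y : 𝔤}
    (hy : y ∈ rootSum (resFib X)) (hy0 : y ≠ 0) : ∃ n : ℤ, 2 * ε * X (center L) = n := by
  classical
  have hex := h.exists_pow_eq_zero hX hy
  have h1 := Nat.find_spec hex
  obtain ⟨i, hi⟩ : ∃ i, Nat.find hex = i + 1 := by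
    refine Nat.exists_eq_succ_of_ne_zero fun h0 => ?_
    rw [h0] at h1
    exact hy0 (by simpa using h1)
  have h3 := Nat.find_min hex (show i < Nat.find hex by omega)
  rw [hi, pow_succ', Module.End.mul_apply] at h1
  obtain ⟨n, hn⟩ := h.primitive (hX.add_cst _) (h.pow_mem hX hy i) h3 h1
  simp only [AffineMap.coe_add, Pi.add_apply, AffineMap.const_apply] at hn
  refine ⟨n - 2 * i, ?_⟩
  push_cast
  linear_combination hn - 2 * (i : ℂ) * h.sq

/-- In the swapped triple `e` is the lowering operator and `y` has weight `k`, so `sl2_injective`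
applies. -/
lemma SlTriple.pow_injective (h : SlTriple L ε e f) {X : Aff L} (hX : Nonconst X) {k : ℕ}
    (hk : 2 * ε * X (center L) = -k) {y : 𝔤} (hy : y ∈ rootSum (resFib X))
    (h0 : ((LieAlgebra.ad ℂ 𝔤 e) ^ k) y = 0) : y = 0 := by
  obtain ⟨m, hm⟩ := h.swap.exists_pow_eq_zero hX hy
  refine sl2_injective h.swap.ad_ef h.swap.ad_hf h.swap.ad_he (k := k) ?_ le_rfl h0 hm
  rw [ad_hEl hy]
  congr 1
  linear_combination -hk

lemma SlTriple.exists_of_pos (h : SlTriple L ε e f) {X : Aff L} (hX : Nonconst X)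
    (hpos : nRes X ≠ 0) : ∃ n : ℤ, 2 * ε * X (center L) = n := by
  obtain ⟨γ, hγ⟩ := Finset.card_ne_zero.mp hpos
  exact h.integral hX (mem_rootSum (mem_fs.mp hγ) (rvec_mem γ)) (rvec_ne_zero γ)

/-- The restriction of a power of `ad e` to a weight space. -/
def SlTriple.powMap (h : SlTriple L ε e f) {X : Aff L} (hX : Nonconst X) (n : ℕ) :
    rootSum (resFib X) →ₗ[ℂ] rootSum (resFib (X + cst L (n * ε))) :=
  ((LieAlgebra.ad ℂ 𝔤 e) ^ n).restrict fun _ hy => h.pow_mem hX hy n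

lemma SlTriple.powMap_injective (h : SlTriple L ε e f) {X : Aff L} (hX : Nonconst X) {k : ℕ}
    (hk : 2 * ε * X (center L) = -k) : Function.Injective (h.powMap hX k) := by
  rw [injective_iff_map_eq_zero]
  intro y hy
  exact Subtype.ext (h.pow_injective hX hk y.2 (congrArg Subtype.val hy))

lemma SlTriple.nRes_le (h : SlTriple L ε e f) {X : Aff L} (hX : Nonconst X) {k : ℕ}
    (hk : 2 * ε * X (center L) = -k) : nRes X ≤ nRes (X + cst L (k * ε)) := by
  have := LinearMap.finrank_le_finrank_of_injective (h.powMap_injective hX hk)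
  rwa [finrank_rootSum, finrank_rootSum] at this

lemma SlTriple.nRes_eq (h : SlTriple L ε e f) {X : Aff L} (hX : Nonconst X) {k : ℕ}
    (hk : 2 * ε * X (center L) = -k) : nRes X = nRes (X + cst L (k * ε)) := by
  refine le_antisymm (h.nRes_le hX hk) ?_
  have h1 := h.swap.nRes_le (hX.add_cst (k * ε)) (k := k) (by
    simp only [AffineMap.coe_add, Pi.add_apply, AffineMap.const_apply]
    linear_combination -hk - 2 * (k : ℂ) * h.sq)
  have h2 : X + cst L (k * ε) + cst L (k * -ε) = X := by
    ext v
    simp only [AffineMap.coe_add, Pi.add_apply, AffineMap.const_apply]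
    ring
  rwa [h2] at h1

/-- The weight of `y` is `k + 2`, so `e ^ (k + 2)` maps the opposite weight space onto that of `y`
by injectivity and equality of dimensions. Stopping one power earlier gives the preimage under `e`.
-/
lemma SlTriple.surjective (h : SlTriple L ε e f) {X : Aff L} (hX : Nonconst X) {k : ℕ}
    (hk : 2 * ε * X (center L) = k) {y : 𝔤} (hy : y ∈ rootSum (resFib (X + cst L ε))) :
    ∃ x ∈ rootSum (resFib X), ⁅e, x⁆ = y := by
  set Z := X + cst L (-((k + 1 : ℕ) * ε)) with hZ
  have hZn : Nonconst Z := hX.add_cst _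
  have hZc : 2 * ε * Z (center L) = -(k + 2 : ℕ) := by
    simp only [hZ, AffineMap.coe_add, Pi.add_apply, AffineMap.const_apply]
    push_cast
    linear_combination hk - 2 * ((k : ℂ) + 1) * h.sq
  have h1 : Z + cst L ((k + 1 : ℕ) * ε) = X := by
    ext v
    simp only [hZ, AffineMap.coe_add, Pi.add_apply, AffineMap.const_apply]
    ring
  have h2 : Z + cst L ((k + 2 : ℕ) * ε) = X + cst L ε := by
    ext v
    simp only [hZ, AffineMap.coe_add, Pi.add_apply, AffineMap.const_apply]
    push_cast; ring
  have hsurj : Function.Surjective (h.powMap hZn (k + 2)) := by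
    refine (LinearMap.injective_iff_surjective_of_finrank_eq_finrank ?_).mp
      (h.powMap_injective hZn hZc)
    rw [finrank_rootSum, finrank_rootSum]
    exact h.nRes_eq hZn hZc
  obtain ⟨z, hz⟩ := hsurj ⟨y, by rwa [h2]⟩
  refine ⟨((LieAlgebra.ad ℂ 𝔤 e) ^ (k + 1)) z, ?_, ?_⟩
  · have := h.pow_mem hZn z.2 (k + 1)
    rwa [h1] at this
  · have := congrArg Subtype.val hz
    change ((LieAlgebra.ad ℂ 𝔤 e) ^ (k + 1 + 1)) z = y at this
    rwa [pow_succ', Module.End.mul_apply, LieAlgebra.ad_apply] at this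

/-- The dimension of the space of primitive vectors of a given weight. -/
lemma SlTriple.finrank_ker (h : SlTriple L ε e f) {X : Aff L} (hX : Nonconst X) :
    finrank ℂ (rootSum (resFib X) ⊓ LinearMap.ker (LieAlgebra.ad ℂ 𝔤 e) : Submodule ℂ 𝔤) =
      nRes X - nRes (X + cst L ε) := by
  let T : rootSum (resFib X) →ₗ[ℂ] rootSum (resFib (X + cst L ε)) :=
    (LieAlgebra.ad ℂ 𝔤 e).restrict fun _ hy => h.lie_mem hX hy
  have hT : finrank ℂ (LinearMap.ker T) =
      finrank ℂ (rootSum (resFib X) ⊓ LinearMap.ker (LieAlgebra.ad ℂ 𝔤 e) : Submodule ℂ 𝔤) := by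
    have h1 : LinearMap.ker T = (LinearMap.ker (LieAlgebra.ad ℂ 𝔤 e)).comap
        (rootSum (resFib X)).subtype := by
      ext y
      rw [LinearMap.mem_ker, Submodule.mem_comap, LinearMap.mem_ker]
      exact ⟨fun h => congrArg Subtype.val h, fun h => Subtype.ext h⟩
    rw [h1, ← Submodule.finrank_map_subtype_eq, Submodule.map_comap_subtype]
  have hrn := LinearMap.finrank_range_add_finrank_ker T
  rw [finrank_rootSum] at hrn
  change _ = nRes X at hrn
  rw [← hT]
  by_cases hpos : nRes X = 0
  · omega
  obtain ⟨n, hn⟩ := h.exists_of_pos hX hpos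
  -- In negative weight there are no primitive vectors, `e` is injective, and the truncated
  -- difference is `0`. In weight `≥ 0` the map is surjective, and rank-nullity gives the
  -- difference.
  rcases lt_or_ge n 0 with hneg | hnn
  · have hker : LinearMap.ker T = ⊥ := by
      rw [LinearMap.ker_eq_bot']
      intro y hy
      by_contra h0
      obtain ⟨m, hm⟩ := h.primitive hX y.2 (fun h' => h0 (Subtype.ext h'))
        (congrArg Subtype.val hy)
      rw [hn] at hm
      have : n = m := by exact_mod_cast hm
      omega
    have h2 := LinearMap.finrank_le_finrank_of_injective (LinearMap.ker_eq_bot.mp hker)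
    rw [finrank_rootSum, finrank_rootSum] at h2
    change nRes X ≤ nRes (X + cst L ε) at h2
    rw [hker, finrank_bot]
    omega
  · obtain ⟨k, rfl⟩ := Int.eq_ofNat_of_zero_le hnn
    have hr : LinearMap.range T = ⊤ := by
      rw [LinearMap.range_eq_top]
      intro y
      obtain ⟨x, hx, hxy⟩ := h.surjective hX (k := k) (by simpa using hn) y.2
      exact ⟨⟨x, hx⟩, Subtype.ext hxy⟩
    rw [hr, finrank_top, finrank_rootSum] at hrn
    change nRes (X + cst L ε) + _ = _ at hrn
    omega

/-- The reflection symmetry of the weights. -/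
lemma SlTriple.nRes_symm (h : SlTriple L ε e f) {X : Aff L} (hX : Nonconst X) :
    nRes X = nRes (X - cst L (2 * X (center L))) := by
  wlog h1 : ∃ n : ℤ, 2 * ε * X (center L) = n generalizing X
  · have h2 : nRes X = 0 := by
      by_contra h2
      exact h1 (h.exists_of_pos hX h2)
    have hX' : Nonconst (X - cst L (2 * X (center L))) := by
      have := hX.add_cst (-(2 * X (center L)))
      convert this using 1
      ext v
      simp [sub_eq_add_neg]
    have h3 : nRes (X - cst L (2 * X (center L))) = 0 := by
      by_contra h3
      obtain ⟨n, hn⟩ := h.exists_of_pos hX' h3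
      apply h1
      refine ⟨-n, ?_⟩
      simp only [AffineMap.coe_sub, Pi.sub_apply, AffineMap.const_apply] at hn
      push_cast
      linear_combination -hn
    rw [h2, h3]
  obtain ⟨n, hn⟩ := h1
  rcases le_total n 0 with hneg | hnn
  · obtain ⟨k, hk⟩ := Int.exists_eq_neg_ofNat hneg
    subst hk
    push_cast at hn
    rw [h.nRes_eq hX hn]
    congr 1
    ext v
    simp only [AffineMap.coe_add, AffineMap.coe_sub, Pi.add_apply, Pi.sub_apply,
      AffineMap.const_apply]
    linear_combination ε * hn - 2 * X (center L) * h.sq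
  · obtain ⟨k, rfl⟩ := Int.eq_ofNat_of_zero_le hnn
    rw [Int.cast_natCast] at hn
    rw [h.swap.nRes_eq hX (k := k) (by linear_combination -hn)]
    congr 1
    ext v
    simp only [AffineMap.coe_add, AffineMap.coe_sub, Pi.add_apply, Pi.sub_apply,
      AffineMap.const_apply]
    linear_combination ε * hn - 2 * X (center L) * h.sq

end

section

variable {𝔤 : Type*} [LieRing 𝔤] [LieAlgebra ℂ 𝔤] [FiniteDimensional ℂ 𝔤]
  [LieAlgebra.IsKilling ℂ 𝔤] {H : LieSubalgebra ℂ 𝔤} [H.IsCartanSubalgebra]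

variable (b : (LieAlgebra.IsKilling.rootSystem H).Base) (i₀ : H.root)

/-! ### Dominance -/

/-- The grading with empty `J` takes the height as value on positive coroots, so it vanishes on none
of them. -/
lemma exists_dominant : ∃ δ ∈ realForm H, ∀ α, α ∈ posCoroots b ↔ 0 < (ev α δ).re := by
  obtain ⟨δ, hδ, -, h⟩ := exists_grading (b := b) (J := ∅) (Set.empty_subset _)
  have hpos : ∀ α ∈ posCoroots b, 0 < (ev α δ).re := by
    intro α hα
    obtain ⟨n, hn, h0⟩ := h α hα
    rw [hn, Complex.natCast_re, Nat.cast_pos, Nat.pos_iff_ne_zero]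
    intro hn0
    have h1 : ev α ∈ Submodule.span ℂ (ev '' (∅ : Set H.root)) := h0 hn0
    rw [Set.image_empty, Submodule.span_empty, Submodule.mem_bot] at h1
    exact ev_ne_zero α h1
  refine ⟨δ, hδ, fun α => ⟨hpos α, fun h1 => ?_⟩⟩
  by_contra h2
  have h3 := hpos _ ((ng_mem_pos b α).mpr h2)
  rw [ev_ng, LinearMap.neg_apply, Complex.neg_re] at h3
  linarith

lemma pos_add {α β γ : H.root} (hα : α ∈ posCoroots b) (hβ : β ∈ posCoroots b)
    (h : ev γ = ev α + ev β) : γ ∈ posCoroots b := by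
  obtain ⟨δ, -, hδ⟩ := exists_dominant b
  rw [hδ] at hα hβ ⊢
  rw [h, LinearMap.add_apply, Complex.add_re]
  exact add_pos hα hβ

/-- The Weyl group invariant inner product on the real form. -/
def ip (x y : H) : ℝ := ∑ α : H.root, (ev α x).re * (ev α y).re

lemma ip_weyl {w : H ≃ₗ[ℂ] H} (hw : w ∈ weyl H) (x y : H) : ip (w x) (w y) = ip x y := by
  obtain ⟨σ, hσ⟩ := exists_perm hw
  rw [ip, ip, ← Equiv.sum_comp σ fun α => (ev α x).re * (ev α y).re]
  exact Finset.sum_congr rfl fun α _ => by rw [hσ, hσ]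

lemma ip_sub_smul (x y z : H) (t : ℝ) : ip (x - (t : ℂ) • y) z = ip x z - t * ip y z := by
  unfold ip
  rw [Finset.mul_sum, ← Finset.sum_sub_distrib]
  refine Finset.sum_congr rfl fun α _ => ?_
  rw [map_sub, map_smul, smul_eq_mul, Complex.sub_re, Complex.re_ofReal_mul]
  ring

lemma ip_comm (x y : H) : ip x y = ip y x :=
  Finset.sum_congr rfl fun _ _ => mul_comm _ _

lemma coreflection_apply' (β : H.root) (x : H) :
    (LieAlgebra.IsKilling.rootSystem H).coreflection β x =
      x - ev β x • (LieAlgebra.IsKilling.rootSystem H).coroot β :=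
  RootPairing.coreflection_apply _ _ _

lemma coreflection_mem_weyl (β : H.root) :
    (LieAlgebra.IsKilling.rootSystem H).coreflection β ∈ weyl H :=
  Subgroup.subset_closure ⟨β, trivial, rfl⟩

/-- Invariance under the reflection in `β`, which sends `q` to `-q`, gives `2 ⟨q, y⟩ = β(y) ⟨q, q⟩`.
-/
lemma ip_coroot {β : H.root} {y : H} (hy : y ∈ realForm H) (h : 0 < (ev β y).re) :
    0 < ip ((LieAlgebra.IsKilling.rootSystem H).coroot β) y := by
  set q : H := (LieAlgebra.IsKilling.rootSystem H).coroot β with hq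
  obtain ⟨t, ht⟩ := ev_real β hy
  have hβq : ev β q = 2 := (LieAlgebra.IsKilling.rootSystem H).root_coroot_two β
  have h1 := ip_weyl (coreflection_mem_weyl β) q y
  rw [coreflection_apply', coreflection_apply', hβq, ht, ← hq,
    show (2 : ℂ) = ((2 : ℝ) : ℂ) by norm_num, ip_sub_smul, ip_comm, ip_sub_smul, ip_comm y q] at h1
  have h2 : 0 < ip q q := by
    refine Finset.sum_pos' (fun α _ => mul_self_nonneg _) ⟨β, Finset.mem_univ _, ?_⟩
    rw [hβq]; norm_num
  rw [ht, Complex.ofReal_re] at h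
  have := mul_pos h h2
  linarith

/-- Every point of the real form is conjugate to a dominant one. -/
lemma exists_weyl_dominant {v : H} (hv : v ∈ realForm H) :
    ∃ w ∈ weyl H, ∀ α ∈ posCoroots b, 0 ≤ (ev α (w v)).re := by
  obtain ⟨δ, hδ, hpos⟩ := exists_dominant b
  -- A translate with maximal inner product against a strictly dominant vector is dominant:
  -- reflecting in a positive coroot with negative value would increase the product.
  obtain ⟨w, hw⟩ := Finite.exists_max fun w : weyl H => ip (w.1 v) δ
  refine ⟨w.1, w.2, fun β hβ => ?_⟩
  by_contra! hneg
  have hwv : w.1 v ∈ realForm H := by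
    obtain ⟨σ, hσ⟩ := exists_perm w.2
    exact mem_realForm fun α => by rw [hσ]; exact ev_real _ hv
  obtain ⟨t, ht⟩ := ev_real β hwv
  have h1 := hw (⟨_, coreflection_mem_weyl β⟩ * w)
  have h2 : ((⟨_, coreflection_mem_weyl β⟩ * w : weyl H) : H ≃ₗ[ℂ] H) v =
    w.1 v - (t : ℂ) • (LieAlgebra.IsKilling.rootSystem H).coroot β := by
    rw [← ht]; exact coreflection_apply' β (w.1 v)
  rw [h2, ip_sub_smul] at h1
  rw [ht, Complex.ofReal_re] at hneg
  have := mul_pos_of_neg_of_neg hneg (neg_lt_zero.mpr (ip_coroot hδ ((hpos β).mp hβ)))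
  linarith

/-! ### Signs of the coroots on a standard pole space -/

variable {b i₀} {L : AffineSubspace ℝ H} [Nonempty L]

lemma realForm_of_pole (hpole : IsPoleSpace b i₀ L) : ∀ v ∈ L, v ∈ realForm H := by
  obtain ⟨w, -, hL, -⟩ := hpole
  exact hL

/-- A direction of `L` on which all nonconstant positive coroots are positive. -/
lemma exists_direction (hpole : IsPoleSpace b i₀ L) (hstd : IsStandard b L) :
    ∃ u ∈ realForm H, u ∈ L.direction ∧ (∀ α ∈ constCoroots L, ev α u = 0) ∧
      ∀ α ∈ posCoroots b \ constCoroots L, 1 ≤ (ev α u).re := by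
  obtain ⟨⟨J, hJ, hconst⟩, -⟩ := hstd
  obtain ⟨u, hu, h0, hpos⟩ := exists_grading hJ
  rw [← hconst] at h0
  refine ⟨u, hu, mem_direction_of_pole hpole hu fun α hα => h0 α (pole_subset_const hα), h0,
    fun α hα => ?_⟩
  obtain ⟨n, hn, hn0⟩ := hpos α hα.1
  rw [hn, Complex.natCast_re, Nat.one_le_cast, Nat.one_le_iff_ne_zero]
  exact fun h => hα.2 (hconst ▸ hn0 h)

lemma ng_mem_const {α : H.root} : ng α ∈ constCoroots L ↔ α ∈ constCoroots L := by
  have h : ∀ β : H.root, β ∈ constCoroots L → ng β ∈ constCoroots L := by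
    rintro β ⟨z, hz⟩
    exact ⟨-z, fun v hv => by rw [ev_ng, LinearMap.neg_apply, hz v hv]⟩
  exact ⟨fun h1 => by simpa using h _ h1, h α⟩

/-- A point of the positive cone, relative to which the signs of the gradients can be read off. -/
lemma exists_posCone (hpole : IsPoleSpace b i₀ L) (hstd : IsStandard b L) :
    ∃ p ∈ posCone b L, ∀ α : H.root, α ∉ constCoroots L →
      (α ∈ posCoroots b ↔ 0 < (grad (res L α) p).re) := by
  obtain ⟨u, hu, hdir, h0, hpos⟩ := exists_direction hpole hstd
  have hc := (center_spec (realForm_of_pole hpole)).1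
  have hmem : u + ((center L : cplx L) : H) ∈ L := AffineSubspace.vadd_mem_of_mem_direction hdir hc
  have hgr : ∀ α, grad (res L α) ⟨_, subset_affineSpan ℂ _ hmem⟩ = ev α u := by
    intro α
    simp [grad]
  have hp : ∀ α ∈ posCoroots b \ constCoroots L, 0 < (ev α u).re := fun α hα =>
    lt_of_lt_of_le one_pos (hpos α hα)
  refine ⟨⟨_, subset_affineSpan ℂ _ hmem⟩, ⟨hmem, fun α hα => by rw [hgr]; exact hp α hα⟩,
    fun α hα => ?_⟩
  rw [hgr]
  refine ⟨fun h => hp α ⟨h, hα⟩, fun h => ?_⟩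
  by_contra h1
  have := hp (ng α) ⟨(ng_mem_pos b α).mpr h1, fun h2 => hα (ng_mem_const.mp h2)⟩
  rw [ev_ng, LinearMap.neg_apply, Complex.neg_re] at this
  linarith

/-- The sign of a coroot that is not constant on `L` only depends on the gradient of its
restriction. -/
lemma pos_of_res (hpole : IsPoleSpace b i₀ L) (hstd : IsStandard b L) {α β : H.root}
    (hα : α ∈ posCoroots b \ constCoroots L) {z : ℂ} (h : res L β = res L α + cst L z) :
    β ∈ posCoroots b \ constCoroots L := by
  have hβ : β ∉ constCoroots L := by
    rw [const_iff, not_not, h]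
    exact (not_not.mp (const_iff.not.mp hα.2)).add_cst z
  obtain ⟨p, hp, hs⟩ := exists_posCone hpole hstd
  refine ⟨(hs β hβ).mpr ?_, hβ⟩
  have h1 := (hs α hα.2).mp hα.1
  have h2 : grad (res L β) p = grad (res L α) p := by
    rw [h]
    simp only [grad, AffineMap.coe_sub, AffineMap.coe_add, Pi.sub_apply, Pi.add_apply,
      AffineMap.const_apply]
    ring
  rwa [h2]

lemma neg_of_res (hpole : IsPoleSpace b i₀ L) (hstd : IsStandard b L) {α β : H.root}
    (hα : α ∈ posCoroots b \ constCoroots L) {z : ℂ} (h : res L β = -res L α + cst L z) :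
    β ∈ (posCoroots b)ᶜ \ constCoroots L := by
  have h1 : res L (ng β) = res L α + cst L (-z) := by
    ext v
    have := congrArg (fun Y : Aff L => Y v) h
    simp only [AffineMap.coe_add, AffineMap.coe_neg, Pi.add_apply, Pi.neg_apply,
      AffineMap.const_apply, res_apply, ev_ng, LinearMap.neg_apply] at this ⊢
    linear_combination -this
  have h2 := pos_of_res hpole hstd hα h1
  exact ⟨(ng_mem_pos b β).mp h2.1, fun h => h2.2 (ng_mem_const.mpr h)⟩

lemma nonconst_of_not_mem {α : H.root} (hα : α ∉ constCoroots L) : Nonconst (res L α) := by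
  by_contra h
  exact hα (const_iff.mpr h)

lemma res_ng (α : H.root) : res L (ng α) = -res L α := by
  ext v
  simp

lemma nRes_neg (X : Aff L) : nRes (-X) = nRes X := by
  refine Finset.card_bij (fun γ _ => ng γ) (fun γ hγ => ?_) (fun _ _ _ _ h => ng_injective h)
    (fun γ hγ => ⟨ng γ, ?_, ng_ng γ⟩)
  · have : res L γ = -X := mem_fs.mp hγ
    rw [mem_fs]
    change res L (ng γ) = X
    rw [res_ng, this, neg_neg]
  · have : res L γ = X := mem_fs.mp hγ
    rw [mem_fs]
    change res L (ng γ) = -X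
    rw [res_ng, this]

/-! ### Highest weights -/

lemma hwSpace_rootSum (S : Set H.root) (e : 𝔤) (μ : Aff L) :
    hwSpace (rootSum S) e μ =
      rootSum (S ∩ resFib μ) ⊓ LinearMap.ker (LieAlgebra.ad ℂ 𝔤 e) := by
  ext y
  simp only [hwSpace, Submodule.mem_inf, Submodule.mem_iInf, Module.End.mem_eigenspace_iff,
    LieAlgebra.ad_apply]
  refine ⟨fun h => ⟨mem_resFib_inter h.1.1 h.2, h.1.2⟩, fun h => ⟨⟨rootSum_mono
    Set.inter_subset_left h.1, h.2⟩, lie_resFib (rootSum_mono Set.inter_subset_right h.1)⟩⟩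

lemma isHighestWeight_iff (U : Submodule ℂ 𝔤) (e : 𝔤) (μ : Aff L) :
    IsHighestWeight U e μ ↔ hwMult U e μ ≠ 0 := by
  rw [IsHighestWeight, hwMult, Ne, Ne, Submodule.finrank_eq_zero]

/-- Since the module contains the whole weight space, primitive vectors can be counted in `𝔤`; the
count depends only on the restrictions of coroots and not on the triple. -/
lemma hwMult_eq {S : Set H.root} {e f : 𝔤} (h : IsTriple L e f) {μ : Aff L} (hμ : Nonconst μ)
    (hS : resFib μ ⊆ S) : hwMult (rootSum S) e μ = nRes μ - nRes (μ + cst L 1) := by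
  rw [hwMult, hwSpace_rootSum, Set.inter_eq_right.mpr hS, h.slTriple.finrank_ker hμ]

lemma exists_of_hwMult {S : Set H.root} {e : 𝔤} {μ : Aff L} (h : hwMult (rootSum S) e μ ≠ 0) :
    ∃ α ∈ S, res L α = μ := by
  by_contra! hc
  apply h
  have : S ∩ resFib μ = ∅ := by
    ext α
    simp only [Set.mem_inter_iff, Set.mem_empty_iff_false, iff_false, not_and]
    exact fun hα => hc α hα
  rw [hwMult, hwSpace_rootSum, this, rootSum_eq_span, Set.image_empty, Submodule.span_empty,
    bot_inf_eq, finrank_bot]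

lemma exists_nat_of_hwMult {S : Set H.root} {e f : 𝔤} (h : IsTriple L e f) {μ : Aff L}
    (hμ : Nonconst μ) (h0 : hwMult (rootSum S) e μ ≠ 0) : ∃ m : ℕ, μ (center L) = (m : ℂ) / 2 := by
  rw [hwMult, hwSpace_rootSum] at h0
  have h1 : rootSum (S ∩ resFib μ) ⊓ LinearMap.ker (LieAlgebra.ad ℂ 𝔤 e) ≠ ⊥ := by
    intro h1
    rw [h1, finrank_bot] at h0
    exact h0 rfl
  obtain ⟨y, hy, hy0⟩ := Submodule.exists_mem_ne_zero_of_ne_bot h1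
  obtain ⟨n, hn⟩ := h.slTriple.primitive hμ (rootSum_mono Set.inter_subset_right hy.1) hy0 hy.2
  exact ⟨n, by linear_combination hn / 2⟩

end

section

variable {𝔤 : Type*} [LieRing 𝔤] [LieAlgebra ℂ 𝔤] [FiniteDimensional ℂ 𝔤]
  [LieAlgebra.IsKilling ℂ 𝔤] {H : LieSubalgebra ℂ 𝔤} [H.IsCartanSubalgebra]
  {b : (LieAlgebra.IsKilling.rootSystem H).Base} {i₀ : H.root}
  {L : AffineSubspace ℝ H} [Nonempty L]

/-! ### Evaluation of the multiplicity functions -/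

lemma one_sub_one_sub (X : Aff L) : cst L 1 - (cst L 1 - X) = X := by abel

lemma Nonconst.one_sub {X : Aff L} (hX : Nonconst X) : Nonconst (cst L 1 - X) := by
  have := hX.neg.add_cst 1
  rwa [neg_add_eq_sub] at this

lemma Nonconst.ne_one_sub {X : Aff L} (hX : Nonconst X) : X ≠ cst L 1 - X := by
  intro h
  refine hX ⟨1 / 2, fun v => ?_⟩
  have := congrArg (fun Y : Aff L => Y v) h
  simp only [AffineMap.coe_sub, Pi.sub_apply, AffineMap.const_apply] at this
  linear_combination this / 2

/-- The class of a nonconstant affine function. -/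
abbrev cls (X : Aff L) (hX : Nonconst X) : AffClass L := Quotient.mk (affSetoid L) ⟨X, hX⟩

open Classical in
lemma clsF_cls (Y : Aff L) {X : Aff L} (hX : Nonconst X) :
    clsF Y (cls X hX) = if Y = X ∨ Y = cst L 1 - X then 1 else 0 := by
  by_cases hY : Nonconst Y
  · rw [clsF, dif_pos hY, Finsupp.single_apply]
    congr 1
    rw [eq_iff_iff]
    constructor
    · intro h
      rcases Quotient.exact h with h1 | h1
      · exact Or.inl h1.symm
      · refine Or.inr ?_
        simp only at h1
        rw [h1, one_sub_one_sub]
    · intro h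
      refine Quotient.sound (s := affSetoid L) ?_
      rcases h with h1 | h1
      · exact Or.inl h1.symm
      · refine Or.inr ?_
        simp only [h1]
        rw [one_sub_one_sub]
  · rw [clsF, dif_neg hY, if_neg]
    · rfl
    · rintro (rfl | rfl)
      · exact hY hX
      · exact hY hX.one_sub

lemma cls_one_sub {X : Aff L} (hX : Nonconst X) : cls (cst L 1 - X) hX.one_sub = cls X hX :=
  Quotient.sound (s := affSetoid L) (Or.inr (one_sub_one_sub X).symm)

lemma mult_of_nonconst (m : AffClass L →₀ ℕ) {X : Aff L} (hX : Nonconst X) :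
    mult m X = m (cls X hX) := dif_pos hX

lemma mult_one_sub (m : AffClass L →₀ ℕ) {X : Aff L} (hX : Nonconst X) :
    mult m (cst L 1 - X) = mult m X := by
  rw [mult_of_nonconst m hX, mult_of_nonconst m hX.one_sub, cls_one_sub]

lemma nonconst_of_mult {m : AffClass L →₀ ℕ} {X : Aff L} (h : mult m X ≠ 0) : Nonconst X := by
  by_contra hX
  exact h (dif_neg hX)

lemma genMult_apply (Q S : Set H.root) (x : H ≃ₗ[ℂ] H) (ν : AffClass L) :
    genMult b Q L S x ν = (@Finset.filter _ (fun z : reflGroup Q => Surv b Q L (z.1 * x))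
      (Classical.decPred _) Finset.univ).sup fun z => dS L S ν - eY b L (z.1 * x) ν := by
  rw [genMult]
  exact Finset.apply_sup_eq_sup_comp (fun m : AffClass L →₀ ℕ => m ν) (fun _ _ => rfl) rfl

lemma dS_cls (S : Set H.root) {X : Aff L} (hX : Nonconst X) :
    dS L S (cls X hX) = (fs (S ∩ (resFib X ∪ resFib (cst L 1 - X)))).card := by
  classical
  rw [dS, Finsupp.finsetSum_apply, Finset.card_eq_sum_ones, ← Finset.sum_filter_add_sum_filter_not
    (fs S) fun γ => γ ∈ resFib X ∪ resFib (cst L 1 - X)]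
  have h : fs (S ∩ (resFib X ∪ resFib (cst L 1 - X))) =
      (fs S).filter fun γ => γ ∈ resFib X ∪ resFib (cst L 1 - X) := by
    ext γ; simp
  rw [h, Finset.sum_eq_zero (s := (fs S).filter fun γ => ¬ γ ∈ resFib X ∪ resFib (cst L 1 - X))
    (fun γ hγ => by rw [clsF_cls, if_neg]; exact (Finset.mem_filter.mp hγ).2), add_zero]
  refine Finset.sum_congr rfl fun γ hγ => ?_
  rw [clsF_cls, if_pos]
  exact (Finset.mem_filter.mp hγ).2

/-! ### Bounding and attaining the multiplicities -/

/-- The coroots `β` such that `y β` is negative, where `σ` describes the action of `y`. -/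
def negSet (b : (LieAlgebra.IsKilling.rootSystem H).Base) (σ : H.root ≃ H.root) : Set H.root :=
  {β | σ.symm β ∉ posCoroots b}

lemma eY_cls {y : H ≃ₗ[ℂ] H} {σ : H.root ≃ H.root} (hσ : ∀ α v, ev α (y v) = ev (σ α) v)
    {X : Aff L} (hX : Nonconst X) :
    eY b L y (cls X hX) = (fs ((negSet b σ)ᶜ ∩ (resFib X ∪ resFib (cst L 1 - X)))).card := by
  rw [← dS_cls, eY, dS, Finsupp.finsetSum_apply, Finsupp.finsetSum_apply]
  refine Finset.sum_bij (fun α _ => σ α) (fun α hα => ?_) (fun _ _ _ _ h => σ.injective h)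
    (fun β hβ => ⟨σ.symm β, ?_, σ.apply_symm_apply β⟩) fun α _ => ?_
  · rw [mem_fs] at hα ⊢
    simpa [negSet] using hα
  · rw [mem_fs] at hβ ⊢
    simpa [negSet] using hβ
  · have : rl L (ev α ∘ₗ y.toLinearMap) = res L (σ α) := by
      ext v
      exact hσ α v
    rw [this]

lemma ng_negSet {y : H ≃ₗ[ℂ] H} {σ : H.root ≃ H.root} (hσ : ∀ α v, ev α (y v) = ev (σ α) v)
    (β : H.root) : ng β ∈ negSet b σ ↔ β ∉ negSet b σ := by
  have h : σ.symm (ng β) = ng (σ.symm β) := by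
    rw [Equiv.symm_apply_eq]
    refine ev_injective (LinearMap.ext fun v => ?_)
    rw [← hσ, ev_ng, ev_ng, LinearMap.neg_apply, LinearMap.neg_apply, hσ, σ.apply_symm_apply]
  simp only [negSet, Set.mem_ofPred_eq, h, ng_mem_pos]

/-- A term cancels the coroots over `X` and over `1 - X` that it makes positive. Negation turns
those over `1 - X` into the coroots over `X - 1` that it makes negative. -/
lemma dS_sub_eY {S : Set H.root} {y : H ≃ₗ[ℂ] H} {σ : H.root ≃ H.root}
    (hσ : ∀ α v, ev α (y v) = ev (σ α) v) {X : Aff L} (hX : Nonconst X)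
    (hS : resFib X ⊆ S) (hS' : S ∩ resFib (cst L 1 - X) = ∅) :
    dS L S (cls X hX) - eY b L y (cls X hX) =
      (fs (negSet b σ ∩ resFib X)).card - (fs (negSet b σ ∩ resFib (X + cst L (-1)))).card := by
  classical
  have h1 : S ∩ (resFib X ∪ resFib (cst L 1 - X)) = resFib X := by
    rw [Set.inter_union_distrib_left, hS', Set.union_empty, Set.inter_eq_right.mpr hS]
  have h2 : (fs (resFib X)).card =
      (fs (negSet b σ ∩ resFib X)).card + (fs ((negSet b σ)ᶜ ∩ resFib X)).card := by
    rw [← Finset.card_union_of_disjoint]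
    · congr 1; ext γ
      simp only [mem_fs, Finset.mem_union, Set.mem_inter_iff, Set.mem_compl_iff]
      tauto
    · rw [Finset.disjoint_left]
      intro γ h h'
      rw [mem_fs] at h h'
      exact h'.1 h.1
  have h3 : (fs ((negSet b σ)ᶜ ∩ (resFib X ∪ resFib (cst L 1 - X)))).card =
      (fs ((negSet b σ)ᶜ ∩ resFib X)).card + (fs ((negSet b σ)ᶜ ∩ resFib (cst L 1 - X))).card := by
    rw [← Finset.card_union_of_disjoint]
    · congr 1; ext γ
      simp only [mem_fs, Finset.mem_union, Set.mem_inter_iff, Set.mem_union]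
      tauto
    · rw [Finset.disjoint_left]
      intro γ h h'
      rw [mem_fs] at h h'
      exact hX.ne_one_sub ((show res L γ = X from h.2).symm.trans h'.2)
  have h4 : (fs ((negSet b σ)ᶜ ∩ resFib (cst L 1 - X))).card =
      (fs (negSet b σ ∩ resFib (X + cst L (-1)))).card := by
    have hneg : -(cst L 1 - X) = X + cst L (-1) := by
      ext v
      simp only [AffineMap.coe_sub, AffineMap.coe_add, AffineMap.coe_neg, Pi.neg_apply,
        Pi.sub_apply, Pi.add_apply, AffineMap.const_apply]
      ring
    refine Finset.card_bij (fun γ _ => ng γ) (fun γ hγ => ?_) (fun _ _ _ _ h => ng_injective h)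
      (fun γ hγ => ⟨ng γ, ?_, ng_ng γ⟩)
    · rw [mem_fs] at hγ ⊢
      refine ⟨(ng_negSet hσ γ).mpr hγ.1, ?_⟩
      change res L (ng γ) = _
      rw [res_ng, show res L γ = _ from hγ.2, hneg]
    · rw [mem_fs] at hγ ⊢
      refine ⟨fun h => (ng_negSet hσ γ).mp h hγ.1, ?_⟩
      change res L (ng γ) = _
      rw [res_ng, show res L γ = _ from hγ.2, ← hneg, neg_neg]
  rw [dS_cls, eY_cls hσ, h1, h2, h3, h4]
  omega

/-- The bound given by the lowering operator. -/
lemma card_negSet_le {e f : 𝔤} (h : IsTriple L e f) (hf : f ∈ rootSum (ng '' poleCoroots L))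
    {y : H ≃ₗ[ℂ] H} {σ : H.root ≃ H.root} (hσ : ∀ α v, ev α (y v) = ev (σ α) v)
    (hP : ∀ α ∈ poleCoroots L, α ∉ negSet b σ) {X : Aff L} (hX : Nonconst X) :
    (fs (negSet b σ ∩ resFib X)).card ≤
      (fs (negSet b σ ∩ resFib (X + cst L (-1)))).card + (nRes X - nRes (X + cst L (-1))) := by
  -- Were the image of `β - α` positive, adding the positive image of `α` would make that of `β`
  -- positive.
  have hadd : ∀ α ∈ poleCoroots L, ∀ β ∈ negSet b σ, ∀ γ : H.root, ev γ = -ev α + ev β →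
      γ ∈ negSet b σ := by
    intro α hα β hβ γ hγ h1
    refine hβ (pos_add b (not_not.mp (hP α hα)) h1 (LinearMap.ext fun v => ?_))
    have h2 := LinearMap.congr_fun hγ (y.symm v)
    have h3 : ∀ δ : H.root, ev (σ.symm δ) v = ev δ (y.symm v) := fun δ => by
      have := hσ (σ.symm δ) (y.symm v)
      rwa [y.apply_symm_apply, σ.apply_symm_apply] at this
    rw [LinearMap.add_apply, h3, h3, h3]
    simp only [LinearMap.add_apply, LinearMap.neg_apply] at h2
    linear_combination -h2
  have hmaps : ∀ z ∈ rootSum (negSet b σ ∩ resFib X),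
      LieAlgebra.ad ℂ 𝔤 f z ∈ rootSum (negSet b σ ∩ resFib (X + cst L (-1))) := by
    intro z hz
    refine mem_resFib_inter ?_ fun v => ?_
    · refine rootSum_induction (p := fun f => ⁅f, z⁆ ∈ rootSum (negSet b σ)) hf ?_ (by simp)
        (fun y z hy hz => by rw [add_lie]; exact add_mem hy hz)
      rintro - ⟨α, hα, rfl⟩ f' hf'
      refine rootSum_induction (p := fun z => ⁅f', z⁆ ∈ rootSum (negSet b σ)) hz ?_ (by simp)
        (fun y z hy hz => by rw [lie_add]; exact add_mem hy hz)
      intro β hβ z' hz'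
      -- The case `β = α`, in which the bracket would fall into the Cartan subalgebra, is excluded:
      -- elements of `P_L` are not made negative.
      rcases lie_rsp_rsp hf' hz' (by
        rw [ev_ng]
        intro h0
        have h1 : β = α := ev_injective (by rw [neg_add_eq_zero] at h0; exact h0.symm)
        exact hP α hα (h1 ▸ hβ.1)) with h0 | ⟨γ, hγ, hmem⟩
      · rw [h0]; exact zero_mem _
      · exact mem_rootSum (hadd α hα β hβ.1 γ (by rw [hγ, ev_ng])) hmem
    · have := lie_resFib (h.slTriple.swap.lie_mem hX
        (rootSum_mono Set.inter_subset_right hz)) v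
      exact this
  -- Rank-nullity for `T`: the image is bounded by the target, and the kernel by the kernel of `ad
  -- f` on the full weight space, whose dimension comes from the swapped triple.
  let T : rootSum (negSet b σ ∩ resFib X) →ₗ[ℂ]
      rootSum (negSet b σ ∩ resFib (X + cst L (-1))) := (LieAlgebra.ad ℂ 𝔤 f).restrict hmaps
  have hrn := LinearMap.finrank_range_add_finrank_ker T
  have h1 : finrank ℂ (LinearMap.range T) ≤ _ := Submodule.finrank_le _
  have h2 : finrank ℂ (LinearMap.ker T) ≤ finrank ℂ
      (rootSum (resFib X) ⊓ LinearMap.ker (LieAlgebra.ad ℂ 𝔤 f) : Submodule ℂ 𝔤) := by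
    rw [← Submodule.finrank_map_subtype_eq]
    refine Submodule.finrank_mono ?_
    rintro - ⟨z, hz, rfl⟩
    exact ⟨rootSum_mono Set.inter_subset_right z.2, congrArg Subtype.val hz⟩
  rw [h.slTriple.swap.finrank_ker hX] at h2
  rw [finrank_rootSum] at h1 hrn
  omega

lemma genMult_eq_zero {Q S : Set H.root} {x : H ≃ₗ[ℂ] H} {X : Aff L} (hX : Nonconst X)
    (hS : ∀ γ ∈ S, res L γ ≠ X ∧ res L γ ≠ cst L 1 - X) :
    genMult b Q L S x (cls X hX) = 0 := by
  have : S ∩ (resFib X ∪ resFib (cst L 1 - X)) = ∅ := by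
    ext γ
    simp only [Set.mem_inter_iff, Set.mem_empty_iff_false, iff_false, not_and]
    rintro hγ (h | h)
    · exact (hS γ hγ).1 h
    · exact (hS γ hγ).2 h
  rw [genMult_apply, dS_cls, this, ← Nat.le_zero]
  refine Finset.sup_le fun z _ => ?_
  have h0 : fs (∅ : Set H.root) = ∅ := by ext; simp
  rw [h0, Finset.card_empty]
  omega

/-- The elements `z` that contribute to the denominators map `P_L` to positive coroots. -/
def PoleStable (b : (LieAlgebra.IsKilling.rootSystem H).Base) (Q : Set H.root)
    (L : AffineSubspace ℝ H) [Nonempty L] (x : H ≃ₗ[ℂ] H) : Prop :=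
  ∀ z : reflGroup Q, Surv b Q L (z.1 * x) → ∃ σ : H.root ≃ H.root,
    (∀ α v, ev α ((z.1 * x) v) = ev (σ α) v) ∧ ∀ α ∈ poleCoroots L, α ∉ negSet b σ

lemma genMult_cls_le {Q S : Set H.root} {x : H ≃ₗ[ℂ] H} (hx : PoleStable b Q L x)
    {e f : 𝔤} (h : IsTriple L e f) (hf : f ∈ rootSum (ng '' poleCoroots L))
    {X : Aff L} (hX : Nonconst X) (hS : resFib X ⊆ S) (hS' : S ∩ resFib (cst L 1 - X) = ∅) :
    genMult b Q L S x (cls X hX) ≤ nRes X - nRes (X + cst L (-1)) := by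
  classical
  rw [genMult_apply]
  refine Finset.sup_le fun z hz => ?_
  obtain ⟨σ, hσ, hP⟩ := hx z (Finset.mem_filter.mp hz).2
  rw [dS_sub_eY hσ hX hS hS']
  have := card_negSet_le h hf hσ hP hX
  omega

/-- When the whole fibre of `X` becomes negative, the first count in `dS_sub_eY` is maximal and the
second is at most the full fibre of `X - 1`, so the upper bound is attained. -/
lemma genMult_cls_eq {Q S : Set H.root} {x : H ≃ₗ[ℂ] H} (hx : PoleStable b Q L x)
    {e f : 𝔤} (h : IsTriple L e f) (hf : f ∈ rootSum (ng '' poleCoroots L))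
    {X : Aff L} (hX : Nonconst X) (hS : resFib X ⊆ S) (hS' : S ∩ resFib (cst L 1 - X) = ∅)
    (z : reflGroup Q) {σ : H.root ≃ H.root} (hσ : ∀ α v, ev α ((z.1 * x) v) = ev (σ α) v)
    (hP : ∀ α ∈ poleCoroots L, α ∉ negSet b σ) (hz : resFib X ⊆ negSet b σ) :
    genMult b Q L S x (cls X hX) = nRes X - nRes (X + cst L (-1)) := by
  classical
  refine le_antisymm (genMult_cls_le hx h hf hX hS hS') ?_
  -- Survival is automatic: a positive coroot pulling back to `-1` on `L` is the image of the
  -- negative of an element of `P_L`, which would thus be made negative.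
  have hsurv : Surv b Q L (z.1 * x) := by
    intro α hα
    by_contra! hc
    have h1 : ng (σ α) ∈ poleCoroots L := by
      intro v hv
      rw [ev_ng, LinearMap.neg_apply, ← hσ, hc ⟨v, subset_affineSpan ℂ _ hv⟩, neg_neg]
    refine hP _ h1 ((ng_negSet hσ _).mpr ?_)
    simpa [negSet] using hα.2
  rw [genMult_apply]
  refine le_trans ?_ (Finset.le_sup (f := fun z : reflGroup Q =>
    dS L S (cls X hX) - eY b L (z.1 * x) (cls X hX))
    (Finset.mem_filter.mpr ⟨Finset.mem_univ z, hsurv⟩))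
  rw [dS_sub_eY hσ hX hS hS', Set.inter_eq_right.mpr hz]
  refine Nat.sub_le_sub_left (Finset.card_le_card fun γ hγ => ?_) _
  rw [mem_fs] at hγ ⊢
  exact hγ.2

/-! ### The relevant Weyl group elements -/

/-- If an element of `P_L` is made negative, the opposite of its image is a positive coroot with
value `-1`, which kills the `c`-function over the full Weyl group. -/
lemma poleStable_of_perm {x : H ≃ₗ[ℂ] H}
    (hx : ∀ z ∈ weyl H, ∃ σ : H.root ≃ H.root, ∀ α v, ev α ((z * x) v) = ev (σ α) v) :
    PoleStable b Set.univ L x := by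
  intro z hz
  obtain ⟨σ, hσ⟩ := hx z.1 z.2
  refine ⟨σ, hσ, fun α hα hn => ?_⟩
  have h1 := (ng_mem_pos b _).mpr hn
  obtain ⟨v, hv⟩ := hz _ ⟨trivial, h1⟩
  apply hv
  rw [ev_ng, LinearMap.neg_apply, hσ, σ.apply_symm_apply, ev_eq_of_const ⟨1, hα⟩ hα v]

lemma reflGroup_fix {Q : Set H.root} {v : H} (hv : ∀ α ∈ Q, ev α v = 0) {z : H ≃ₗ[ℂ] H}
    (hz : z ∈ reflGroup Q) : z v = v := by
  have h1 : ∀ β ∈ Q, (LieAlgebra.IsKilling.rootSystem H).coreflection β v = v := fun β hβ => by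
    rw [coreflection_apply', hv β hβ, zero_smul, sub_zero]
  induction hz using Subgroup.closure_induction with
  | mem x hx => obtain ⟨β, hβ, rfl⟩ := hx; exact h1 β hβ
  | one => rfl
  | mul x y _ _ hx hy => rw [LinearEquiv.mul_apply, hy, hx]
  | inv x _ hx =>
    change x.symm v = v
    rw [LinearEquiv.symm_apply_eq, hx]

/-- For good pairs, the elements that contribute to `Σ'` map `P_L` to positive coroots. -/
lemma poleStable_of_good {w : H ≃ₗ[ℂ] H} (hw : w ∈ weyl H) (hgood : IsGood b i₀ L w) :
    PoleStable b (levi b i₀) L w := by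
  -- This dominant vector vanishes on the Levi subsystem, and its values are therefore unchanged by
  -- `W'`; a positive coroot vanishing at it belongs to the Levi subsystem.
  obtain ⟨x, -, h0, hpos⟩ := exists_grading (b := b) (J := {α | α ∈ b.support ∧ α ≠ i₀})
    (fun α hα => hα.1)
  change ∀ α ∈ levi b i₀, ev α x = 0 at h0
  change ∀ α ∈ posCoroots b, ∃ n : ℕ, ev α x = n ∧ (n = 0 → α ∈ levi b i₀) at hpos
  intro z hz
  obtain ⟨σ, hσ⟩ := exists_perm ((weyl H).mul_mem (reflGroup_le _ z.2) hw)
  refine ⟨σ, hσ, fun α hα hn => ?_⟩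
  obtain ⟨τ, hτ⟩ := exists_perm (reflGroup_le _ z.2)
  set a := σ.symm α with ha
  have h1 : ∀ v, ev (τ a) (w v) = ev α v := fun v => by
    rw [← hτ, ← LinearEquiv.mul_apply, hσ, ha, σ.apply_symm_apply]
  have h2 : τ a ∈ posCoroots b ∪ levi b i₀ := hgood ⟨α, hα, h1⟩
  have h3 : ev a x = ev (τ a) x := by rw [← hτ, reflGroup_fix h0 z.2]
  have h4 : ∃ n : ℕ, ev a x = n := by
    rw [h3]
    rcases h2 with h2 | h2
    · obtain ⟨n, hn, -⟩ := hpos _ h2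
      exact ⟨n, hn⟩
    · exact ⟨0, by rw [h0 _ h2, Nat.cast_zero]⟩
  have h5 := (ng_mem_pos b a).mpr hn
  obtain ⟨n, hn⟩ := h4
  obtain ⟨m, hm, hm0⟩ := hpos _ h5
  rw [ev_ng, LinearMap.neg_apply, hn] at hm
  -- Goodness makes the value of the image at `x` nonnegative, negativity of the image makes it
  -- nonpositive. So the image lies in the Levi subsystem and its opposite gives a vanishing factor
  -- of `c'`.
  have h6 : m = 0 := by
    have : ((n + m : ℕ) : ℂ) = 0 := by push_cast; linear_combination -hm
    have := Nat.cast_eq_zero.mp this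
    omega
  obtain ⟨v, hv⟩ := hz _ ⟨hm0 h6, h5⟩
  apply hv
  rw [ev_ng, LinearMap.neg_apply, hσ, σ.apply_symm_apply, ev_eq_of_const ⟨1, hα⟩ hα v]

/-- There is a Weyl group element that maps `P_L` to positive coroots, and the nonconstant coroots
of a given sign to negative ones. -/
lemma exists_weyl_sign (hpole : IsPoleSpace b i₀ L) (hstd : IsStandard b L) {s : ℝ}
    (hs : s = 1 ∨ s = -1) : ∃ y ∈ weyl H, ∀ σ : H.root ≃ H.root,
      (∀ α v, ev α (s • y v) = ev (σ α) v) →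
      (∀ α ∈ poleCoroots L, α ∉ negSet b σ) ∧
      ∀ α ∉ constCoroots L, (α ∈ posCoroots b ↔ s = 1) → α ∈ negSet b σ := by
  obtain ⟨u, hu, -, h0, hpos⟩ := exists_direction hpole hstd
  have hcL := (center_spec (realForm_of_pole hpole)).1
  set c : H := ((center L : cplx L) : H)
  have hc := realForm_of_pole hpole c hcL
  -- The bound `N` makes the displacement along `u` outweigh the values at `c`. Coroots in `P_L` do
  -- not see the displacement and keep the value `1`.
  obtain ⟨N, hN⟩ : ∃ N : ℝ, ∀ α : H.root, |(ev α c).re| < N := by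
    obtain ⟨M, hM⟩ := (Set.finite_range fun α : H.root => |(ev α c).re|).bddAbove
    exact ⟨M + 1, fun α => (hM ⟨α, rfl⟩).trans_lt (lt_add_one M)⟩
  have hv : s • (c - s • N • u) ∈ realForm H :=
    Submodule.smul_mem _ _ (sub_mem hc (Submodule.smul_mem _ _ (Submodule.smul_mem _ _ hu)))
  obtain ⟨y, hy, hdom⟩ := exists_weyl_dominant b hv
  have hss : s * s = 1 := by rcases hs with rfl | rfl <;> norm_num
  refine ⟨y, hy, fun σ hσ => ?_⟩
  have hsy : ∀ v : H, s • y v = y (s • v) := fun v => by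
    rw [← Complex.coe_smul, ← Complex.coe_smul, map_smul]
  have hre : ∀ (t : ℝ) (α : H.root) (v : H), (ev α (t • v)).re = t * (ev α v).re := fun t α v => by
    rw [← Complex.coe_smul, map_smul, smul_eq_mul, Complex.re_ofReal_mul]
  have hdom' : ∀ α ∈ posCoroots b, 0 ≤ (ev (σ α) (c - s • N • u)).re := by
    intro α hα
    rw [← hσ, hsy]
    exact hdom α hα
  constructor
  · intro α hα hn
    have h1 := hdom' _ ((ng_mem_pos b _).mpr hn)
    rw [← hσ, ev_ng, LinearMap.neg_apply, hσ, σ.apply_symm_apply, map_sub, hα c hcL,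
      Complex.neg_re, Complex.sub_re, hre, hre, h0 α (pole_subset_const hα)] at h1
    norm_num at h1
  · intro α hα hsgn hp
    have h1 := hdom' _ hp
    rw [σ.apply_symm_apply, map_sub, Complex.sub_re, hre, hre] at h1
    have h2 := (abs_lt.mp (hN α)).2
    have hN0 : 0 < N := lt_of_le_of_lt (abs_nonneg _) (hN α)
    have h3 : 1 ≤ s * (ev α u).re := by
      rcases hs with rfl | rfl
      · rw [one_mul]
        exact hpos α ⟨hsgn.mpr rfl, hα⟩
      · have h4 : α ∉ posCoroots b := fun h => by have := hsgn.mp h; norm_num at this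
        have := hpos (ng α) ⟨(ng_mem_pos b α).mpr h4, fun h => hα (ng_mem_const.mp h)⟩
        rw [ev_ng, LinearMap.neg_apply, Complex.neg_re] at this
        linarith
    nlinarith

end

section

variable {𝔤 : Type*} [LieRing 𝔤] [LieAlgebra ℂ 𝔤] [FiniteDimensional ℂ 𝔤]
  [LieAlgebra.IsKilling ℂ 𝔤] {H : LieSubalgebra ℂ 𝔤} [H.IsCartanSubalgebra]
  (b : (LieAlgebra.IsKilling.rootSystem H).Base) (i₀ : H.root)

/-! ### `Σ`, `Σ_τ`, `Σ'` as sums over reflection groups -/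

/-- The product of all `ρ(γ)` and all `γ`, for `γ` in the root system. -/
def fullProd (ρ : ℂ → ℂ) (v : H) : ℂ := ∏ γ : H.root, (ρ (ev γ v) * ev γ v)

lemma ent_fullProd {ρ : ℂ → ℂ} (hρ : Differentiable ℂ ρ) : Ent (fullProd (H := H) ρ) :=
  ent_prod _ fun γ _ => ((ent_linear (ev γ)).of_differentiable hρ).mul (ent_linear (ev γ))

lemma fullProd_ne_zero {ρ : ℂ → ℂ} (hρ : Differentiable ℂ ρ) (h0 : ρ ≠ 0) :
    fullProd (H := H) ρ ≠ 0 := by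
  obtain ⟨z, hz⟩ := Function.ne_iff.mp h0
  have hsurj : ∀ (γ : H.root) (z : ℂ), ∃ v, ev γ v = z := fun γ z =>
    (LinearMap.surjective_iff_ne_zero.mpr (ev_ne_zero γ)) z
  obtain ⟨v, hv⟩ := ent_prod_ne_zero (Finset.univ : Finset H.root)
    (f := fun γ v => ρ (ev γ v) * ev γ v)
    (fun γ _ => ((ent_linear (ev γ)).of_differentiable hρ).mul (ent_linear (ev γ))) fun γ _ => by
      obtain ⟨v, h1, h2⟩ := ent_and_ne_zero ((ent_linear (ev γ)).of_differentiable hρ)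
        (ent_linear (ev γ)) (by obtain ⟨v, hv⟩ := hsurj γ z; exact ⟨v, by rwa [hv]⟩)
        (by obtain ⟨v, hv⟩ := hsurj γ 1; exact ⟨v, by rw [hv]; exact one_ne_zero⟩)
      exact ⟨v, mul_ne_zero h1 h2⟩
  exact Function.ne_iff.mpr ⟨v, Finset.prod_ne_zero_iff.mpr hv⟩

lemma rho_ne_zero_of_fullProd {ρ : ℂ → ℂ} {v : H} (h : fullProd ρ v ≠ 0) (γ : H.root) :
    ρ (ev γ v) ≠ 0 ∧ ev γ v ≠ 0 :=
  mul_ne_zero_iff.mp (Finset.prod_ne_zero_iff.mp h γ (Finset.mem_univ γ))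

lemma rFun_eq (ρ : ℂ → ℂ) (v : H) : rFun b ρ v = ∏ γ ∈ fs (posCoroots b), ρ (ev γ v) := rfl

lemma rFun_neg (ρ : ℂ → ℂ) (v : H) :
    rFun b ρ (-v) = ∏ γ ∈ fs ((posCoroots b)ᶜ), ρ (ev γ v) := by
  rw [rFun_eq]
  refine Finset.prod_bij (fun γ _ => ng γ) (fun γ hγ => ?_) (fun _ _ _ _ h => ng_injective h)
    (fun γ hγ => ⟨ng γ, ?_, ng_ng γ⟩) fun γ _ => ?_
  · rw [mem_fs] at hγ ⊢
    exact fun h => (ng_mem_pos b γ).mp h hγ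
  · rw [mem_fs] at hγ ⊢
    exact (ng_mem_pos b γ).mpr hγ
  · rw [ev_ng, map_neg, LinearMap.neg_apply]

lemma rFun_mul_rFun_neg (ρ : ℂ → ℂ) (v : H) :
    rFun b ρ v * rFun b ρ (-v) = ∏ γ : H.root, ρ (ev γ v) := by
  classical
  rw [rFun_neg, rFun_eq, ← Finset.prod_mul_prod_compl (fs (posCoroots b)) fun γ => ρ (ev γ v)]
  congr 1
  refine Finset.prod_congr ?_ fun _ _ => rfl
  ext γ
  simp

lemma cFun_eq (v : H) : cFun b v =
    (∏ α ∈ fs (Set.univ ∩ posCoroots b), (ev α v + 1)) / posProd b Set.univ v := by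
  rw [Set.univ_inter, posProd, Set.univ_inter, ← Finset.prod_div_distrib]
  rfl

lemma cFun'_eq (v : H) : cFun' b i₀ v =
    (∏ α ∈ fs (levi b i₀ ∩ posCoroots b), (ev α v + 1)) / posProd b (levi b i₀) v := by
  rw [posProd, ← Finset.prod_div_distrib, cFun']
  refine Finset.prod_congr ?_ fun _ _ => rfl
  ext α
  simp

/-- The product `r(v) r(-v)` runs over all coroots and is Weyl-invariant, so `r(-v) / r(-wv)` equals
`r(wv) / r(v)`, which has the required common denominator. -/
lemma isReflSum_sigmaTau : IsReflSum b Set.univ (posCoroots b) 1 (sigmaTau b) := by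
  intro ρ hρ _ hρ0 φ _
  refine ⟨_, ent_fullProd hρ, fullProd_ne_zero hρ hρ0, fun v hv => ?_⟩
  have hv' := rho_ne_zero_of_fullProd hv
  rw [← rFun_eq, LinearEquiv.coe_one, id, sigmaTau, sigma, numer, Finset.mul_sum]
  refine Finset.sum_congr rfl fun z _ => ?_
  obtain ⟨σ, hσ⟩ := exists_perm z.2
  have h1 : rFun b ρ (z.1 v) * rFun b ρ (-(z.1 v)) = rFun b ρ v * rFun b ρ (-v) := by
    rw [rFun_mul_rFun_neg, rFun_mul_rFun_neg, ← Equiv.prod_comp σ fun γ => ρ (ev γ v)]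
    exact Finset.prod_congr rfl fun γ _ => by rw [hσ]
  have h2 : rFun b ρ v * rFun b ρ (-v) ≠ 0 := by
    rw [rFun_mul_rFun_neg]
    exact Finset.prod_ne_zero_iff.mpr fun γ _ => (hv' γ).1
  have h3 : rFun b ρ (-(z.1 v)) ≠ 0 := right_ne_zero_of_mul (h1 ▸ h2)
  have h4 : posProd b Set.univ v ≠ 0 := Finset.prod_ne_zero_iff.mpr fun γ _ => (hv' γ).2
  have h5 := posProd_sgn (b := b) reflClosed_univ z v
  rw [map_neg, neg_neg, cFun_eq, h5, ← rFun_eq]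
  generalize ∏ α ∈ fs (Set.univ ∩ posCoroots b), (ev α (z.1 v) + 1) = N
  rcases sgn_eq (b := b) Set.univ z with h | h <;> rw [h] <;> field_simp
  · linear_combination (-N * φ (z.1 v)) * h1
  · linear_combination (N * φ (z.1 v)) * h1

lemma isReflSum_sigma : IsReflSum b Set.univ (posCoroots b)ᶜ (LinearEquiv.neg ℂ) (sigma b) := by
  intro ρ hρ hs hρ0 φ hφ
  obtain ⟨D, hD, hD0, h⟩ := isReflSum_sigmaTau b ρ hρ hs hρ0 φ hφ
  refine ⟨fun v => D (-v), hD.comp_linear (-LinearMap.id), ?_, fun v hv => ?_⟩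
  · obtain ⟨v, hv⟩ := Function.ne_iff.mp hD0
    exact Function.ne_iff.mpr ⟨-v, by simpa using hv⟩
  · have := h (-v) hv
    rw [← rFun_eq, rFun_neg, sigmaTau, neg_neg] at this
    exact this

lemma isReflSum_sigma' (x : H ≃ₗ[ℂ] H) :
    IsReflSum b (levi b i₀) (posCoroots b) x (sigma' b i₀ x) := by
  intro ρ hρ _ hρ0 φ _
  have hx0 : ∃ v, posProd b (levi b i₀) (x v) ≠ 0 := by
    obtain ⟨v, hv⟩ := exists_posProd_ne_zero (b := b) (levi b i₀)
    exact ⟨x.symm v, by rwa [x.apply_symm_apply]⟩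
  have hP := (ent_posProd (b := b) (levi b i₀)).comp_linear x.toLinearMap
  -- As `x` is arbitrary, the pullbacks of coroots along it need not be coroots; their zeros must be
  -- excluded separately.
  refine ⟨_, (ent_fullProd hρ).mul hP, ?_, fun v hv => ?_⟩
  · obtain ⟨v, h1, h2⟩ := ent_and_ne_zero (ent_fullProd (H := H) hρ) hP
      (Function.ne_iff.mp (fullProd_ne_zero hρ hρ0)) hx0
    exact Function.ne_iff.mpr ⟨v, mul_ne_zero h1 h2⟩
  have hv' := rho_ne_zero_of_fullProd (left_ne_zero_of_mul hv)
  have h4 : posProd b (levi b i₀) (x v) ≠ 0 := right_ne_zero_of_mul hv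
  have h2 : rFun b ρ v ≠ 0 := Finset.prod_ne_zero_iff.mpr fun γ _ => (hv' γ).1
  rw [← rFun_eq, sigma', numer, Finset.mul_sum]
  refine Finset.sum_congr rfl fun (z : reflGroup (levi b i₀)) _ => ?_
  have h5 : posProd b (levi b i₀) (z.1 (x v)) =
      sgn b (levi b i₀) z * posProd b (levi b i₀) (x v) :=
    posProd_sgn (reflClosed_spanned _) z (x v)
  rw [cFun'_eq, h5, ← rFun_eq]
  generalize ∏ α ∈ fs (levi b i₀ ∩ posCoroots b), (ev α (z.1 (x v)) + 1) = N
  rcases sgn_eq (b := b) (levi b i₀) z with h | h <;> rw [h] <;> field_simp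

/-! ### The denominators on a standard regular pole space -/

variable {b i₀} {L : AffineSubspace ℝ H} [Nonempty L]

lemma exists_ev_ne_zero (hreg : IsRegular L) (α : H.root) : ∃ v : cplx L, ev α v ≠ 0 := by
  by_contra! hc
  have : α ∈ zeroCoroots L := fun v hv => hc ⟨v, subset_affineSpan ℂ _ hv⟩
  rw [hreg] at this
  exact this

variable (b L) in
/-- The multiplicity function of `Σ`. -/
def multSigma : AffClass L →₀ ℕ := genMult b Set.univ L (posCoroots b)ᶜ (LinearEquiv.neg ℂ)

variable (b L) in
/-- The multiplicity function of `Σ_τ`. -/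
def multSigmaTau : AffClass L →₀ ℕ := genMult b Set.univ L (posCoroots b) 1

variable (b i₀ L) in
/-- The multiplicity function of `Σ'`. -/
def multSigma' (w : H ≃ₗ[ℂ] H) : AffClass L →₀ ℕ := genMult b (levi b i₀) L (posCoroots b) w

lemma isDenSigma_multSigma (hreg : IsRegular L) : IsDenSigma b L (multSigma b L) :=
  isDenMult_genMult reflClosed_univ (isReflSum_sigma b) fun α _ => by
    obtain ⟨v, hv⟩ := exists_ev_ne_zero hreg α
    exact ⟨v, by simpa using hv⟩

lemma isDenSigmaTau_multSigmaTau (hreg : IsRegular L) : IsDenSigmaTau b L (multSigmaTau b L) :=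
  isDenMult_genMult reflClosed_univ (isReflSum_sigmaTau b) fun α _ => exists_ev_ne_zero hreg α

lemma isDenSigma'_multSigma' (hreg : IsRegular L) {w : H ≃ₗ[ℂ] H} (hw : w ∈ weyl H) :
    IsDenSigma' b i₀ L w (multSigma' b i₀ L w) :=
  isDenMult_genMult (reflClosed_spanned _) (isReflSum_sigma' b i₀ w) fun α _ => by
    obtain ⟨σ, hσ⟩ := exists_perm hw
    obtain ⟨v, hv⟩ := exists_ev_ne_zero hreg (σ α)
    exact ⟨v, by rwa [hσ]⟩

lemma resFib_subset_pos (hpole : IsPoleSpace b i₀ L) (hstd : IsStandard b L) {α : H.root}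
    (hα : α ∈ posCoroots b \ constCoroots L) :
    resFib (res L α) ⊆ posCoroots b \ constCoroots L := fun γ hγ =>
  pos_of_res hpole hstd hα (z := 0) (by
    rw [show res L γ = _ from hγ]; ext v; simp)

lemma resFib_subset_neg (hpole : IsPoleSpace b i₀ L) (hstd : IsStandard b L) {α : H.root}
    (hα : α ∈ posCoroots b \ constCoroots L) :
    resFib (-res L α) ⊆ (posCoroots b)ᶜ \ constCoroots L := fun γ hγ =>
  neg_of_res hpole hstd hα (z := 0) (by
    rw [show res L γ = _ from hγ]; ext v; simp)

lemma pos_inter_eq_empty (hpole : IsPoleSpace b i₀ L) (hstd : IsStandard b L) {α : H.root}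
    (hα : α ∈ posCoroots b \ constCoroots L) :
    posCoroots b ∩ resFib (cst L 1 - res L α) = ∅ := by
  ext γ
  simp only [Set.mem_inter_iff, Set.mem_empty_iff_false, iff_false, not_and]
  intro hγ h
  refine (neg_of_res hpole hstd hα (z := 1) (β := γ) ?_).1 hγ
  rw [show res L γ = _ from h, neg_add_eq_sub]

lemma neg_inter_eq_empty (hpole : IsPoleSpace b i₀ L) (hstd : IsStandard b L) {α : H.root}
    (hα : α ∈ posCoroots b \ constCoroots L) :
    (posCoroots b)ᶜ ∩ resFib (cst L 1 - -res L α) = ∅ := by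
  ext γ
  simp only [Set.mem_inter_iff, Set.mem_empty_iff_false, iff_false, not_and]
  intro hγ h
  refine hγ (pos_of_res hpole hstd hα (z := 1) (β := γ) ?_).1
  rw [show res L γ = _ from h, sub_neg_eq_add, add_comm]

/-- The difference counts vectors of weight `res L α` killed by the lowering operator, that is,
lowest weight vectors. -/
lemma multSigmaTau_res (hpole : IsPoleSpace b i₀ L) (hstd : IsStandard b L)
    (hreg : IsRegular L) {α : H.root} (hα : α ∈ posCoroots b \ constCoroots L) :
    mult (multSigmaTau b L) (res L α) = nRes (res L α) - nRes (res L α + cst L (-1)) := by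
  obtain ⟨e, f, h, hf⟩ := exists_isTriple hpole hreg
  obtain ⟨y, hy, hs⟩ := exists_weyl_sign hpole hstd (s := 1) (Or.inl rfl)
  obtain ⟨σ, hσ⟩ := exists_perm hy
  obtain ⟨h1, h2⟩ := hs σ fun α v => by rw [one_smul, hσ]
  have hX := nonconst_of_not_mem hα.2
  rw [mult_of_nonconst _ hX]
  refine genMult_cls_eq (poleStable_of_perm fun z hz => by rw [mul_one]; exact exists_perm hz)
    h hf hX (fun γ hγ => (resFib_subset_pos hpole hstd hα hγ).1)
    (pos_inter_eq_empty hpole hstd hα) ⟨y, hy⟩ (σ := σ) (by simpa using hσ) h1 fun γ hγ => ?_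
  have := resFib_subset_pos hpole hstd hα hγ
  exact h2 γ this.2 ⟨fun _ => rfl, fun _ => this.1⟩

/-- The sign change of the variable exchanges `X` and `-X`, so the shift by `-1` becomes a shift by
`+1` and highest weight vectors are counted. -/
lemma multSigma_res (hpole : IsPoleSpace b i₀ L) (hstd : IsStandard b L)
    (hreg : IsRegular L) {α : H.root} (hα : α ∈ posCoroots b \ constCoroots L) :
    mult (multSigma b L) (-res L α) = nRes (res L α) - nRes (res L α + cst L 1) := by
  obtain ⟨e, f, h, hf⟩ := exists_isTriple hpole hreg
  obtain ⟨y, hy, hs⟩ := exists_weyl_sign hpole hstd (s := -1) (Or.inr rfl)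
  have hperm : ∀ z ∈ weyl H, ∃ σ : H.root ≃ H.root,
      ∀ α v, ev α ((z * (LinearEquiv.neg ℂ : H ≃ₗ[ℂ] H)) v) = ev (σ α) v := by
    intro z hz
    obtain ⟨σ, hσ⟩ := exists_perm hz
    refine ⟨σ.trans ⟨ng, ng, ng_ng, ng_ng⟩, fun α v => ?_⟩
    rw [LinearEquiv.mul_apply, LinearEquiv.neg_apply, hσ]
    simp
  obtain ⟨σ, hσ⟩ := hperm y hy
  obtain ⟨h1, h2⟩ := hs σ fun α v => by
    rw [← hσ, LinearEquiv.mul_apply, LinearEquiv.neg_apply, map_neg, neg_one_smul]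
  have hX := (nonconst_of_not_mem hα.2).neg
  have h3 : nRes (-res L α + cst L (-1)) = nRes (res L α + cst L 1) := by
    rw [← nRes_neg]
    congr 1
    ext v
    simp only [AffineMap.coe_add, AffineMap.coe_neg, Pi.add_apply, Pi.neg_apply,
      AffineMap.const_apply]
    ring
  rw [mult_of_nonconst _ hX, ← h3, ← nRes_neg (res L α)]
  refine genMult_cls_eq (poleStable_of_perm hperm)
    h hf hX (fun γ hγ => (resFib_subset_neg hpole hstd hα hγ).1)
    (neg_inter_eq_empty hpole hstd hα) ⟨y, hy⟩ (σ := σ) hσ h1 fun γ hγ => ?_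
  have := resFib_subset_neg hpole hstd hα hγ
  refine h2 γ this.2 ⟨fun h => absurd h this.1, fun h => ?_⟩
  norm_num at h

/-- The kernel dimension bounds every surviving term of `Σ'`, and `Σ_τ` attains it. -/
lemma multSigma'_le (hpole : IsPoleSpace b i₀ L) (hstd : IsStandard b L)
    (hreg : IsRegular L) {w : H ≃ₗ[ℂ] H} (hw : w ∈ weyl H) (hgood : IsGood b i₀ L w) :
    multSigma' b i₀ L w ≤ multSigmaTau b L := by
  obtain ⟨e, f, h, hf⟩ := exists_isTriple hpole hreg
  have key : ∀ α ∈ posCoroots b, ∀ hX : Nonconst (res L α),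
      multSigma' b i₀ L w (cls (res L α) hX) ≤ multSigmaTau b L (cls (res L α) hX) := by
    intro α hα hX
    have hα' : α ∈ posCoroots b \ constCoroots L := ⟨hα, fun h => const_iff.mp h hX⟩
    rw [← mult_of_nonconst (multSigmaTau b L), multSigmaTau_res hpole hstd hreg hα']
    exact genMult_cls_le (poleStable_of_good hw hgood) h hf hX
      (fun γ hγ => (resFib_subset_pos hpole hstd hα' hγ).1) (pos_inter_eq_empty hpole hstd hα')
  intro ν
  obtain ⟨⟨X, hX⟩, rfl⟩ := Quotient.exists_rep ν
  by_cases hc : ∀ γ ∈ posCoroots b, res L γ ≠ X ∧ res L γ ≠ cst L 1 - X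
  · exact (genMult_eq_zero (b := b) (Q := levi b i₀) (x := w) hX hc).le.trans (Nat.zero_le _)
  · push Not at hc
    obtain ⟨γ, hγ, h1⟩ := hc
    by_cases h2 : res L γ = X
    · subst h2
      exact key γ hγ hX
    · have h3 := h1 h2
      have h4 : Nonconst (res L γ) := h3 ▸ hX.one_sub
      have h5 : (Quotient.mk (affSetoid L) ⟨X, hX⟩) = cls (res L γ) h4 :=
        Quotient.sound (s := affSetoid L) (Or.inr h3)
      rw [h5]
      exact key γ hγ h4

lemma exists_of_multSigmaTau {Y : Aff L} (h : mult (multSigmaTau b L) Y ≠ 0) :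
    ∃ α ∈ posCoroots b \ constCoroots L, Y = res L α ∨ Y = cst L 1 - res L α := by
  have hY := nonconst_of_mult h
  by_contra! hc
  rw [mult_of_nonconst _ hY] at h
  refine h (genMult_eq_zero hY fun γ hγ => ?_)
  by_cases hγc : γ ∈ constCoroots L
  · exact ⟨fun h => const_iff.mp hγc (h ▸ hY), fun h => const_iff.mp hγc (h ▸ hY.one_sub)⟩
  · obtain ⟨h1, h2⟩ := hc γ ⟨hγ, hγc⟩
    exact ⟨fun h => h1 h.symm, fun h => h2 (by rw [h, one_sub_one_sub])⟩

lemma exists_of_multSigma {Y : Aff L} (h : mult (multSigma b L) Y ≠ 0) :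
    ∃ α ∈ posCoroots b \ constCoroots L, Y = -res L α ∨ Y = res L α + cst L 1 := by
  have hY := nonconst_of_mult h
  by_contra! hc
  rw [mult_of_nonconst _ hY] at h
  refine h (genMult_eq_zero hY fun γ hγ => ?_)
  by_cases hγc : γ ∈ constCoroots L
  · exact ⟨fun h => const_iff.mp hγc (h ▸ hY), fun h => const_iff.mp hγc (h ▸ hY.one_sub)⟩
  · obtain ⟨h1, h2⟩ := hc (ng γ) ⟨(ng_mem_pos b γ).mpr hγ, fun h => hγc (ng_mem_const.mp h)⟩
    rw [res_ng] at h1 h2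
    refine ⟨fun h => h1 (by rw [h, neg_neg]), fun h => h2 ?_⟩
    rw [h, neg_sub]
    abel

end

section

variable {𝔤 : Type*} [LieRing 𝔤] [LieAlgebra ℂ 𝔤] [FiniteDimensional ℂ 𝔤]
  [LieAlgebra.IsKilling ℂ 𝔤] {H : LieSubalgebra ℂ 𝔤} [H.IsCartanSubalgebra]
  {b : (LieAlgebra.IsKilling.rootSystem H).Base} {i₀ : H.root}
  {L : AffineSubspace ℝ H} [Nonempty L]

/-! ### Highest weights and denominators -/

/-- The affine function with the same gradient and the opposite value at the center. -/
def cflip (X : Aff L) : Aff L := X - cst L (2 * X (center L))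

lemma flip_apply (X : Aff L) (v : cplx L) : cflip X v = X v - 2 * X (center L) := rfl

lemma flip_flip (X : Aff L) : cflip (cflip X) = X := by
  ext v
  simp only [flip_apply]
  ring

lemma flip_add_cst (X : Aff L) (z : ℂ) : cflip (X + cst L z) = cflip X + cst L (-z) := by
  ext v
  simp only [flip_apply, AffineMap.coe_add, Pi.add_apply, AffineMap.const_apply]
  ring

lemma flip_eq (X : Aff L) : cflip X = grad X - cst L (X (center L)) := by
  ext v
  simp only [flip_apply, grad, AffineMap.coe_sub, Pi.sub_apply, AffineMap.const_apply]
  ring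

lemma one_sub_flip (X : Aff L) :
    cst L 1 - cflip X = -grad X + cst L (X (center L)) + cst L 1 := by
  rw [flip_eq]; abel

lemma Nonconst.flip {X : Aff L} (hX : Nonconst X) : Nonconst (cflip X) := by
  have := hX.add_cst (-(2 * X (center L)))
  convert this using 1
  ext v
  simp [flip_apply, sub_eq_add_neg]

lemma IsTriple.nRes_flip {e f : 𝔤} (h : IsTriple L e f) {X : Aff L} (hX : Nonconst X) :
    nRes (cflip X) = nRes X := (h.slTriple.nRes_symm hX).symm

lemma IsTriple.nRes_flip_sub {e f : 𝔤} (h : IsTriple L e f) {X : Aff L} (hX : Nonconst X) :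
    nRes (cflip X) - nRes (cflip X + cst L (-1)) =
      nRes X - nRes (X + cst L 1) := by
  rw [h.nRes_flip hX, ← flip_add_cst, h.nRes_flip (hX.add_cst 1)]

lemma exists_root_of_nRes {X : Aff L} (h : nRes X ≠ 0) : ∃ α, res L α = X := by
  obtain ⟨α, hα⟩ := Finset.card_ne_zero.mp h
  exact ⟨α, mem_fs.mp hα⟩

lemma hwMult_nilrad (hpole : IsPoleSpace b i₀ L) (hstd : IsStandard b L) {e f : 𝔤}
    (h : IsTriple L e f) {α : H.root} (hα : α ∈ posCoroots b \ constCoroots L) :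
    hwMult (nilrad b L) e (res L α) = nRes (res L α) - nRes (res L α + cst L 1) :=
  hwMult_eq h (nonconst_of_not_mem hα.2) (resFib_subset_pos hpole hstd hα)

lemma hwMult_nilradOpp (hpole : IsPoleSpace b i₀ L) (hstd : IsStandard b L) {e f : 𝔤}
    (h : IsTriple L e f) {α : H.root} (hα : α ∈ posCoroots b \ constCoroots L) :
    hwMult (nilradOpp b L) e (-res L α) = nRes (res L α) - nRes (res L α + cst L (-1)) := by
  have h1 : nRes (-res L α + cst L 1) = nRes (res L α + cst L (-1)) := by
    rw [← nRes_neg]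
    congr 1
    ext v
    simp only [AffineMap.coe_add, AffineMap.coe_neg, Pi.add_apply, Pi.neg_apply,
      AffineMap.const_apply]
    ring
  rw [← h1, ← nRes_neg (res L α)]
  exact hwMult_eq h (nonconst_of_not_mem hα.2).neg (resFib_subset_neg hpole hstd hα)

lemma exists_of_nilradOpp {e : 𝔤} {μ : Aff L} (h : hwMult (nilradOpp b L) e μ ≠ 0) :
    ∃ α ∈ posCoroots b \ constCoroots L, μ = -res L α := by
  obtain ⟨β, hβ, rfl⟩ := exists_of_hwMult h
  exact ⟨ng β, ⟨(ng_mem_pos b β).mpr hβ.1, fun h => hβ.2 (ng_mem_const.mp h)⟩,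
    by rw [res_ng, neg_neg]⟩

/-- The flip of the restriction of a coroot with positive gradient is again the restriction of such
a coroot. -/
lemma exists_flip (hpole : IsPoleSpace b i₀ L) (hstd : IsStandard b L) {e f : 𝔤}
    (h : IsTriple L e f) {α : H.root} (hα : α ∈ posCoroots b \ constCoroots L) :
    ∃ β ∈ posCoroots b \ constCoroots L, res L β = cflip (res L α) := by
  have h1 : nRes (cflip (res L α)) ≠ 0 := by
    rw [h.nRes_flip (nonconst_of_not_mem hα.2)]
    exact Finset.card_ne_zero.mpr ⟨α, mem_fs.mpr rfl⟩
  obtain ⟨β, hβ⟩ := exists_root_of_nRes h1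
  refine ⟨β, pos_of_res hpole hstd hα (z := -(2 * res L α (center L))) ?_, hβ⟩
  rw [hβ]
  ext v
  simp [flip_apply, sub_eq_add_neg]

/-- Reversing the value at the centre exchanges lowest and highest weights of the same irreducible
modules. -/
lemma multSigmaTau_flip (hpole : IsPoleSpace b i₀ L) (hstd : IsStandard b L) (hreg : IsRegular L)
    {e f : 𝔤} (h : IsTriple L e f) {α : H.root} (hα : α ∈ posCoroots b \ constCoroots L) :
    mult (multSigmaTau b L) (cflip (res L α)) = hwMult (nilrad b L) e (res L α) := by
  obtain ⟨β, hβ, hβ'⟩ := exists_flip hpole hstd h hα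
  rw [hwMult_nilrad hpole hstd h hα, ← h.nRes_flip_sub (nonconst_of_not_mem hα.2), ← hβ',
    multSigmaTau_res hpole hstd hreg hβ]

lemma mem_affPos_iff {X : Aff L} (z : ℂ) : X + cst L z ∈ affPos b L ↔ X ∈ affPos b L := by
  have h : ∀ (X : Aff L) (z : ℂ), X ∈ affPos b L → X + cst L z ∈ affPos b L := by
    rintro X z ⟨hX, hp⟩
    refine ⟨hX.add_cst z, fun v hv => ?_⟩
    obtain ⟨t, ht, hv⟩ := hp v hv
    refine ⟨t, ht, ?_⟩
    rw [← hv]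
    simp only [grad, AffineMap.coe_sub, AffineMap.coe_add, Pi.sub_apply, Pi.add_apply,
      AffineMap.const_apply]
    ring
  refine ⟨fun hX => ?_, h X z⟩
  have := h _ (-z) hX
  convert this using 1
  ext v
  simp only [AffineMap.coe_add, Pi.add_apply, AffineMap.const_apply]
  ring

lemma res_mem_affPos (hpole : IsPoleSpace b i₀ L) {α : H.root}
    (hα : α ∈ posCoroots b \ constCoroots L) : res L α ∈ affPos b L := by
  refine ⟨nonconst_of_not_mem hα.2, fun v hv => ?_⟩
  obtain ⟨s, hs⟩ := ev_real α (realForm_of_pole hpole _ hv.1)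
  obtain ⟨t, ht⟩ := ev_center_real (realForm_of_pole hpole) α
  have h1 : grad (res L α) v = ((s - t : ℝ) : ℂ) := by
    simp only [grad, AffineMap.coe_sub, Pi.sub_apply, AffineMap.const_apply, res_apply, hs, ht]
    push_cast; rfl
  have h2 := hv.2 α hα
  rw [h1, Complex.ofReal_re] at h2
  exact ⟨_, h2, h1⟩

lemma not_mem_affPos_of_neg (hpole : IsPoleSpace b i₀ L) (hstd : IsStandard b L) {X : Aff L}
    (hX : X ∈ affPos b L) : -X ∉ affPos b L := by
  intro hX'
  obtain ⟨p, hp, -⟩ := exists_posCone hpole hstd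
  obtain ⟨s, hs, h1⟩ := hX.2 p hp
  obtain ⟨t, ht, h2⟩ := hX'.2 p hp
  have h3 : grad (-X) p = -grad X p := by
    simp only [grad, AffineMap.coe_sub, AffineMap.coe_neg, Pi.sub_apply, Pi.neg_apply,
      AffineMap.const_apply]
    ring
  rw [h1, h2] at h3
  have : t = -s := by exact_mod_cast h3
  linarith

lemma hwMult_iff {e : 𝔤} {μ : Aff L} : IsHighestWeight (nilrad b L) e μ ↔
    ∃ α ∈ posCoroots b \ constCoroots L, μ = res L α ∧
      hwMult (nilrad b L) e (res L α) ≠ 0 := by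
  rw [isHighestWeight_iff]
  constructor
  · intro h
    obtain ⟨α, hα, rfl⟩ := exists_of_hwMult h
    exact ⟨α, hα, rfl, h⟩
  · rintro ⟨α, hα, rfl, h⟩
    exact h

lemma multSigma_add_one (hpole : IsPoleSpace b i₀ L) (hstd : IsStandard b L) (hreg : IsRegular L)
    {e f : 𝔤} (h : IsTriple L e f) {α : H.root} (hα : α ∈ posCoroots b \ constCoroots L) :
    mult (multSigma b L) (res L α + cst L 1) = hwMult (nilrad b L) e (res L α) := by
  rw [hwMult_nilrad hpole hstd h hα, ← multSigma_res hpole hstd hreg hα,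
    ← mult_one_sub _ (nonconst_of_not_mem hα.2).neg, sub_neg_eq_add, add_comm]

lemma den_multSigma (hpole : IsPoleSpace b i₀ L) (hstd : IsStandard b L) (hreg : IsRegular L)
    {e f : 𝔤} (h : IsTriple L e f) : den (multSigma b L) =
      {Y | ∃ μ : Aff L, IsHighestWeight (nilrad b L) e μ ∧ (Y = μ + cst L 1 ∨ Y = -μ)} := by
  have hneg : ∀ α ∈ posCoroots b \ constCoroots L,
      mult (multSigma b L) (-res L α) = hwMult (nilrad b L) e (res L α) := fun α hα => by
    rw [multSigma_res hpole hstd hreg hα, hwMult_nilrad hpole hstd h hα]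
  ext Y
  constructor
  · intro hY
    obtain ⟨α, hα, h1⟩ := exists_of_multSigma hY
    refine ⟨res L α, hwMult_iff.mpr ⟨α, hα, rfl, ?_⟩, h1.symm⟩
    change mult (multSigma b L) Y ≠ 0 at hY
    rcases h1 with rfl | rfl
    · rwa [hneg α hα] at hY
    · rwa [multSigma_add_one hpole hstd hreg h hα] at hY
  · rintro ⟨μ, hμ, h1⟩
    obtain ⟨α, hα, rfl, h0⟩ := hwMult_iff.mp hμ
    change mult (multSigma b L) Y ≠ 0
    rcases h1 with rfl | rfl
    · rwa [multSigma_add_one hpole hstd hreg h hα]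
    · rwa [hneg α hα]

lemma den_multSigmaTau (hpole : IsPoleSpace b i₀ L) (hstd : IsStandard b L) (hreg : IsRegular L)
    {e f : 𝔤} (h : IsTriple L e f) : den (multSigmaTau b L) =
      {Y | ∃ μ : Aff L, IsHighestWeight (nilrad b L) e μ ∧
        (Y = cflip μ ∨ Y = cst L 1 - cflip μ)} := by
  ext Y
  constructor
  · intro hY
    obtain ⟨α, hα, h1⟩ := exists_of_multSigmaTau hY
    obtain ⟨β, hβ, hβ'⟩ := exists_flip hpole hstd h hα
    have h2 : cflip (res L β) = res L α := by rw [hβ', flip_flip]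
    refine ⟨res L β, hwMult_iff.mpr ⟨β, hβ, rfl, ?_⟩, by rwa [h2]⟩
    change mult (multSigmaTau b L) Y ≠ 0 at hY
    rw [← multSigmaTau_flip hpole hstd hreg h hβ, h2]
    rcases h1 with rfl | rfl
    · exact hY
    · rwa [mult_one_sub _ (nonconst_of_not_mem hα.2)] at hY
  · rintro ⟨μ, hμ, h1⟩
    obtain ⟨α, hα, rfl, h0⟩ := hwMult_iff.mp hμ
    change mult (multSigmaTau b L) Y ≠ 0
    rcases h1 with rfl | rfl
    · rwa [multSigmaTau_flip hpole hstd hreg h hα]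
    · rwa [mult_one_sub _ (nonconst_of_not_mem hα.2).flip, multSigmaTau_flip hpole hstd hreg h hα]

lemma hw_center (hpole : IsPoleSpace b i₀ L) {e f : 𝔤} (h : IsTriple L e f) {μ : Aff L}
    (hμ : IsHighestWeight (nilrad b L) e μ) :
    μ ∈ affPos b L ∧ ∃ m : ℕ, μ (center L) = (m : ℂ) / 2 := by
  obtain ⟨α, hα, rfl, h0⟩ := hwMult_iff.mp hμ
  exact ⟨res_mem_affPos hpole hα, exists_nat_of_hwMult h (nonconst_of_not_mem hα.2) h0⟩

lemma denPos_multSigma (hpole : IsPoleSpace b i₀ L) (hstd : IsStandard b L) (hreg : IsRegular L)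
    {e f : 𝔤} (h : IsTriple L e f) : denPos b (multSigma b L) =
      {Y | ∃ μ : Aff L, IsHighestWeight (nilrad b L) e μ ∧ Y = μ + cst L 1} := by
  ext Y
  rw [denPos, den_multSigma hpole hstd hreg h]
  constructor
  · rintro ⟨⟨μ, hμ, rfl | rfl⟩, hpos⟩
    · exact ⟨μ, hμ, rfl⟩
    · exact absurd hpos (not_mem_affPos_of_neg hpole hstd (hw_center hpole h hμ).1)
  · rintro ⟨μ, hμ, rfl⟩
    exact ⟨⟨μ, hμ, Or.inl rfl⟩, (mem_affPos_iff 1).mpr (hw_center hpole h hμ).1⟩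

lemma flip_mem_affPos {X : Aff L} (hX : X ∈ affPos b L) : cflip X ∈ affPos b L := by
  have := (mem_affPos_iff (-(2 * X (center L)))).mpr hX
  convert this using 1
  ext v
  simp [flip_apply, sub_eq_add_neg]

lemma mult_add_one_nilradOpp (hpole : IsPoleSpace b i₀ L) (hstd : IsStandard b L)
    (hreg : IsRegular L) {e f : 𝔤} (h : IsTriple L e f) {α : H.root}
    (hα : α ∈ posCoroots b \ constCoroots L) :
    mult (multSigmaTau b L) (-res L α + cst L 1) = hwMult (nilradOpp b L) e (-res L α) := by
  rw [neg_add_eq_sub, mult_one_sub _ (nonconst_of_not_mem hα.2), multSigmaTau_res hpole hstd hreg hα,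
    hwMult_nilradOpp hpole hstd h hα]

lemma denNeg_multSigmaTau (hpole : IsPoleSpace b i₀ L) (hstd : IsStandard b L)
    (hreg : IsRegular L) {e f : 𝔤} (h : IsTriple L e f) : denNeg b (multSigmaTau b L) =
      {Y | ∃ μ : Aff L, IsHighestWeight (nilradOpp b L) e μ ∧ Y = μ + cst L 1} := by
  ext Y
  constructor
  · rintro ⟨hY, hneg⟩
    obtain ⟨α, hα, rfl | rfl⟩ := exists_of_multSigmaTau hY
    · exact absurd hneg (not_mem_affPos_of_neg hpole hstd (res_mem_affPos hpole hα))
    · refine ⟨-res L α, (isHighestWeight_iff _ _ _).mpr ?_, (neg_add_eq_sub _ _).symm⟩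
      rw [← mult_add_one_nilradOpp hpole hstd hreg h hα, neg_add_eq_sub]
      exact hY
  · rintro ⟨μ, hμ, rfl⟩
    rw [isHighestWeight_iff] at hμ
    obtain ⟨α, hα, rfl⟩ := exists_of_nilradOpp hμ
    rw [← mult_add_one_nilradOpp hpole hstd hreg h hα] at hμ
    refine ⟨hμ, ?_⟩
    have h1 : -(-res L α + cst L 1) = res L α + cst L (-1) := by
      ext v
      simp only [AffineMap.coe_add, AffineMap.coe_neg, Pi.add_apply, Pi.neg_apply,
        AffineMap.const_apply]
      ring
    rw [h1, mem_affPos_iff]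
    exact res_mem_affPos hpole hα

lemma classesIn_multSigma (hpole : IsPoleSpace b i₀ L) (hstd : IsStandard b L)
    (hreg : IsRegular L) {e f : 𝔤} (h : IsTriple L e f) :
    ClassesIn (den (multSigma b L)) (DL b L) := by
  have key : ∀ μ : Aff L, IsHighestWeight (nilrad b L) e μ → μ + cst L 1 ∈ DL b L := by
    intro μ hμ
    obtain ⟨h1, m, hm⟩ := hw_center hpole h hμ
    refine ⟨(mem_affPos_iff 1).mpr h1, m / 2 + 1, by linarith [show (0 : ℝ) ≤ m / 2 by positivity],
      ?_⟩
    simp only [AffineMap.coe_add, Pi.add_apply, AffineMap.const_apply, hm]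
    push_cast; rfl
  intro Y hY
  rw [den_multSigma hpole hstd hreg h] at hY
  obtain ⟨μ, hμ, rfl | rfl⟩ := hY
  · exact Or.inl (key μ hμ)
  · refine Or.inr ?_
    rw [sub_neg_eq_add, add_comm]
    exact key μ hμ

lemma classesIn_multSigmaTau (hpole : IsPoleSpace b i₀ L) (hstd : IsStandard b L)
    (hreg : IsRegular L) {e f : 𝔤} (h : IsTriple L e f) :
    ClassesIn (den (multSigmaTau b L)) (DL' b L) := by
  have key : ∀ μ : Aff L, IsHighestWeight (nilrad b L) e μ → cflip μ ∈ DL' b L := by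
    intro μ hμ
    obtain ⟨h1, m, hm⟩ := hw_center hpole h hμ
    refine ⟨flip_mem_affPos h1, -(m / 2), by linarith [show (0 : ℝ) ≤ m / 2 by positivity], ?_⟩
    rw [flip_apply, hm]
    push_cast; ring
  intro Y hY
  rw [den_multSigmaTau hpole hstd hreg h] at hY
  obtain ⟨μ, hμ, rfl | rfl⟩ := hY
  · exact Or.inl (key μ hμ)
  · refine Or.inr ?_
    rw [one_sub_one_sub]
    exact key μ hμ

lemma den_mono {m n : AffClass L →₀ ℕ} (h : m ≤ n) : den m ⊆ den n := by
  intro Y hY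
  have hY' : mult m Y ≠ 0 := hY
  have hn := nonconst_of_mult hY'
  rw [mult_of_nonconst _ hn] at hY'
  change mult n Y ≠ 0
  rw [mult_of_nonconst _ hn]
  have := h (cls Y hn)
  omega

end

end PoleSpaces

end

/-! ### Assembly of the proposition -/

open PoleSpaces in
theorem proposition2p14 {𝔤 : Type*} [LieRing 𝔤] [LieAlgebra ℂ 𝔤] [FiniteDimensional ℂ 𝔤]
    [LieAlgebra.IsKilling ℂ 𝔤] (H : LieSubalgebra ℂ 𝔤) [H.IsCartanSubalgebra]
    (b : (LieAlgebra.IsKilling.rootSystem H).Base) (i₀ : H.root) (hi₀ : i₀ ∈ b.support)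
    (L : AffineSubspace ℝ H) [Nonempty L]
    (hpole : IsPoleSpace b i₀ L) (hstd : IsStandard b L) (hreg : IsRegular L) :
    (∃ e f : 𝔤, IsTriple L e f) ∧
    ∃ mS mT : AffClass L →₀ ℕ, IsDenSigma b L mS ∧ IsDenSigmaTau b L mT ∧
      (∀ e f : 𝔤, IsTriple L e f →
        -- the highest weights of the nilradical are restrictions of coroots `∇_α + m/2`
        (∀ μ : Aff L, IsHighestWeight (nilrad b L) e μ →
          ∃ α ∈ posCoroots b \ constCoroots L, ∃ m : ℕ,
            μ = res L α ∧ μ = grad (res L α) + cst L ((m : ℂ) / 2)) ∧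
        -- the denominators of `Σ`
        den mS = {Y | ∃ μ : Aff L, IsHighestWeight (nilrad b L) e μ ∧
          (Y = μ + cst L 1 ∨ Y = -μ)} ∧
        (∀ α ∈ posCoroots b \ constCoroots L,
          mult mS (res L α + cst L 1) = hwMult (nilrad b L) e (res L α)) ∧
        denPos b mS = {Y | ∃ μ : Aff L, IsHighestWeight (nilrad b L) e μ ∧ Y = μ + cst L 1} ∧
        -- the denominators of `Σ_τ`, through the nilradical
        den mT = {Y | ∃ μ : Aff L, IsHighestWeight (nilrad b L) e μ ∧
          (Y = grad μ - cst L (μ (center L)) ∨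
            Y = -grad μ + cst L (μ (center L)) + cst L 1)} ∧
        (∀ μ : Aff L, IsHighestWeight (nilrad b L) e μ →
          mult mT (-grad μ + cst L (μ (center L)) + cst L 1) = hwMult (nilrad b L) e μ) ∧
        -- the denominators of `Σ_τ`, through the opposite nilradical
        denNeg b mT = {Y | ∃ μ : Aff L, IsHighestWeight (nilradOpp b L) e μ ∧
          Y = μ + cst L 1} ∧
        (∀ μ : Aff L, IsHighestWeight (nilradOpp b L) e μ →
          mult mT (μ + cst L 1) = hwMult (nilradOpp b L) e μ)) ∧
      ClassesIn (den mS) (DL b L) ∧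
      ClassesIn (den mT) (DL' b L) ∧
      -- the denominators of `Σ'` for good pairs, counted with multiplicities
      ∀ w ∈ weyl H, IsGood b i₀ L w →
        ∃ mS' : AffClass L →₀ ℕ, IsDenSigma' b i₀ L w mS' ∧ mS' ≤ mT ∧
          den mS' ⊆ den mT ∧ denNeg b mS' ⊆ denNeg b mT ∧ ClassesIn (den mS') (DL' b L) := by
  -- The inclusions in `D_L` and `D'_L` do not mention a triple; this one serves to express the
  -- denominators through highest weights.
  obtain ⟨e₀, f₀, h₀, -⟩ := exists_isTriple hpole hreg
  refine ⟨⟨e₀, f₀, h₀⟩, multSigma b L, multSigmaTau b L, isDenSigma_multSigma hreg,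
    isDenSigmaTau_multSigmaTau hreg, fun e f h => ⟨fun μ hμ => ?_, den_multSigma hpole hstd hreg h,
    fun α hα => multSigma_add_one hpole hstd hreg h hα, denPos_multSigma hpole hstd hreg h, ?_,
    fun μ hμ => ?_, denNeg_multSigmaTau hpole hstd hreg h, fun μ hμ => ?_⟩,
    classesIn_multSigma hpole hstd hreg h₀, classesIn_multSigmaTau hpole hstd hreg h₀,
    fun w hw hgood => ⟨multSigma' b i₀ L w, isDenSigma'_multSigma' hreg hw,
      multSigma'_le hpole hstd hreg hw hgood, ?_, ?_, ?_⟩⟩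
  · obtain ⟨m, hm⟩ := (hw_center hpole h hμ).2
    obtain ⟨α, hα, rfl, -⟩ := hwMult_iff.mp hμ
    exact ⟨α, hα, m, rfl, by rw [← hm, grad, sub_add_cancel]⟩
  · rw [den_multSigmaTau hpole hstd hreg h]
    simp only [← flip_eq, ← one_sub_flip]
  · obtain ⟨α, hα, rfl, -⟩ := hwMult_iff.mp hμ
    rw [← one_sub_flip, mult_one_sub _ (nonconst_of_not_mem hα.2).flip,
      multSigmaTau_flip hpole hstd hreg h hα]
  · obtain ⟨α, hα, rfl⟩ := exists_of_nilradOpp ((isHighestWeight_iff _ _ _).mp hμ)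
    exact mult_add_one_nilradOpp hpole hstd hreg h hα
  · exact den_mono (multSigma'_le hpole hstd hreg hw hgood)
  · exact fun Y hY => ⟨den_mono (multSigma'_le hpole hstd hreg hw hgood) hY.1, hY.2⟩
  · exact fun Y hY => classesIn_multSigmaTau hpole hstd hreg h₀ Y
      (den_mono (multSigma'_le hpole hstd hreg hw hgood) hY)
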